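/- Let $b>1$ and $c>0$. For $k\in(0,\frac{c}{b+1})$ let $\phi=\phi_k\in C^\infty(\mathbb R)$ be the profile of the smooth solitary wave $u(t,x)=\phi(x-ct)$ of the $b$-Camassa--Holm equation on the background $k$, that is, the nonconstant solution of $$-(c-\phi)(\phi'''-\phi')+b\phi'(\phi''-\phi)=0,\qquad \phi'(0)=0,\qquad \phi(x)\to k \text{ as } |x|\to\infty,$$ and let $\mu=\phi-\phi''$. Let $X_k$ be the set of positive functions $m$ with $m-k\in H^1(\mathbb R)$ and, for $m\in X_k$, let $$\Lambda(m)=\int_{\mathbb R}\Big[(m-k)-\omega_1\big(m^{\frac1b}-k^{\frac1b}\big)-\omega_2\Big(\Big(\frac{m_x^2}{b^2m^2}+1\Big)m^{-\frac1b}-k^{-\frac1b}\Big)\Big]dx,$$ $$\omega_1=\tfrac12[(b-1)c+(b+1)k]\,k^{-\frac1b},\qquad \omega_2=\tfrac12(b-1)(c-k)\,k^{\frac1b},$$ and $$Q(\phi)=\int_{\mathbb R}\Big[b\Big(\frac{c-k}{c-\phi}\Big)-\Big(\frac{c-k}{c-\phi}\Big)^b-b+1\Big]dx .$$ Then $\mu\in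 X_k$, the integrals defining $\Lambda$ (on $X_k$) and $Q(\phi)$ converge, and $k\mapsto Q(\phi_k)$ is differentiable on $(0,\frac c{b+1})$. Call $\mu$ a constrained minimizer of $-\Lambda$ if, for every $\tilde m\in H^1(\mathbb R)$ with $$\langle \mu^{\frac1b-1}-k^{\frac1b-1},\tilde m\rangle=0,\qquad(\ast)$$ the first variation of $-\Lambda$ at $\mu$ in the direction $\tilde m$ vanishes and the second variation exists and is nonnegative; here $\langle\cdot,\cdot\rangle$ is the $L^2(\mathbb R)$ inner product. For every $k\in(0,\frac c{b+1})$: (1) $\mu$ is a constrained minimizer of $-\Lambda$ if and only if $\frac{d}{dk}Q(\phi_k)\ge 0$. Consequently, on every open interval $I\subset(0,\frac c{b+1})$, this holds for all $k\in I$ if and only if $k\mapsto Q(\phi_k)$ is nondecreasing on $I$. (2) $\mu$ is a constrained minimizer of $-\Lambda$ that is degenerate only due to the translational symmetry (the only $\tilde m\in H^1(\mathbb R)$ satisfying $(\ast)$ with zero second variation are the multiples of $\mu'$) if and only if $\frac{d}{dk}Q(\phi_k)>0$. This is also equivalent to the existence of $C,\varepsilon>0$ such that $-\Lambda(\mu+\tilde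 m)\ge-\Lambda(\mu)+C\|\tilde m\|_{H^1}^2$ for all $\tilde m\in H^1(\mathbb R)$ with $\|\tilde m\|_{H^1}<\varepsilon$, $(\ast)$ and $\langle\mu',\tilde m\rangle=0$. (3) Let $$\mathcal L=-\frac{d}{dx}\frac{c-\phi}{\mu^2}\frac{d}{dx}+\frac{(b+1)(c-\phi)}{2\mu^2}+\frac{(2b+1)(c-\phi)\mu''}{b\mu^3}-\frac{(2b+1)(3b+1)(c-\phi)(\mu')^2}{2b^2\mu^4}-\frac{(c-k)[(b-1)c+(b+1)k]}{2(c-\phi)\mu^2}$$ and $v_0=(c-\phi)^{b-1}-(c-k)^{b-1}$. The equation $\mathcal Lw=v_0$ has a solution $w\in H^2(\mathbb R)$, and every such solution satisfies $$\langle w,v_0\rangle=-\frac{a\,k\,(b-1)}{c\,b^2}(c-k)^{b-1}\,\frac{d}{dk}Q(\phi_k),\qquad a=k(c-k)^b .$$ -/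

import Mathlib

open Set Filter Topology MeasureTheory Asymptotics
open scoped ContDiff

noncomputable section

namespace BCH

/-- `f ∈ H¹(ℝ)`, through its continuous representative: `f` is locally absolutely continuous,
and `f` and its (almost everywhere defined) derivative are square integrable. -/
def MemH1 (f : ℝ → ℝ) : Prop :=
  (∀ x y : ℝ, AbsolutelyContinuousOnInterval f x y) ∧
    MemLp f 2 volume ∧ MemLp (deriv f) 2 volume

/-- The norm of `H¹(ℝ)`. -/
def h1Norm (f : ℝ → ℝ) : ℝ := Real.sqrt (∫ x, (f x ^ 2 + deriv f x ^ 2))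

/-- `f ∈ H²(ℝ)`, through its continuously differentiable representative. -/
def MemH2 (f : ℝ → ℝ) : Prop := Differentiable ℝ f ∧ MemH1 f ∧ MemH1 (deriv f)

/-- The inner product of `L²(ℝ)`. -/
def inner2 (f g : ℝ → ℝ) : ℝ := ∫ x, f x * g x

/-- The set `X_k`: positive functions `m` with `m - k ∈ H¹(ℝ)`. -/
def X (k : ℝ) : Set (ℝ → ℝ) := {m | MemH1 (fun x => m x - k) ∧ ∀ x, 0 < m x}

/-- `φ` is the profile of a smooth solitary wave `u(t,x) = φ(x - ct)` of the `b`-Camassa-Holm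
equation on the constant background `k`, with the translation normalized by `φ'(0) = 0`. -/
structure IsSolitaryWave (b c k : ℝ) (φ : ℝ → ℝ) : Prop where
  smooth : ContDiff ℝ ∞ φ
  ode : ∀ x, -(c - φ x) * (iteratedDeriv 3 φ x - deriv φ x)
      + b * deriv φ x * (iteratedDeriv 2 φ x - φ x) = 0
  deriv_zero : deriv φ 0 = 0
  tendsto_atTop : Tendsto φ atTop (𝓝 k)
  tendsto_atBot : Tendsto φ atBot (𝓝 k)
  nonconstant : ∃ x, φ x ≠ k

/-- The momentum density `μ = φ - φ''`. -/
def momentum (φ : ℝ → ℝ) (x : ℝ) : ℝ := φ x - iteratedDeriv 2 φ x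

/-- The density of the mass `Ê(m)`. -/
def massDensity (k : ℝ) (m : ℝ → ℝ) (x : ℝ) : ℝ := m x - k

/-- The density of the energy `F̂₁(m)`. -/
def F1Density (b k : ℝ) (m : ℝ → ℝ) (x : ℝ) : ℝ := m x ^ (1 / b) - k ^ (1 / b)

/-- The density of the energy `F̂₂(m)`. -/
def F2Density (b k : ℝ) (m : ℝ → ℝ) (x : ℝ) : ℝ :=
  (deriv m x ^ 2 / (b ^ 2 * m x ^ 2) + 1) * m x ^ (-(1 / b)) - k ^ (-(1 / b))

/-- The Lagrange multiplier `ω₁`. -/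
def omega1 (b c k : ℝ) : ℝ := 1 / 2 * ((b - 1) * c + (b + 1) * k) * k ^ (-(1 / b))

/-- The Lagrange multiplier `ω₂`. -/
def omega2 (b c k : ℝ) : ℝ := 1 / 2 * (b - 1) * (c - k) * k ^ (1 / b)

/-- The density of the action `Λ = Ê - ω₁ F̂₁ - ω₂ F̂₂`. -/
def actionDensity (b c k : ℝ) (m : ℝ → ℝ) (x : ℝ) : ℝ :=
  massDensity k m x - omega1 b c k * F1Density b k m x - omega2 b c k * F2Density b k m x

/-- The action `Λ = Ê - ω₁ F̂₁ - ω₂ F̂₂`. The three densities are integrated together: on `X_k`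
each of them is integrable only when `m - k` is, but in the combination the terms linear in
`m - k` cancel. -/
def action (b c k : ℝ) (m : ℝ → ℝ) : ℝ := ∫ x, actionDensity b c k m x

/-- In the direction `h` the first variation of the functional `J` at `μ` vanishes and the second
variation is `q`: `J(μ + t h) = J(μ) + q t² / 2 + o(t²)` as `t → 0`. -/
def HasSecondVariation (J : (ℝ → ℝ) → ℝ) (μ h : ℝ → ℝ) (q : ℝ) : Prop :=
  (fun t : ℝ => J (fun x => μ x + t * h x) - J μ - q / 2 * t ^ 2) =o[𝓝 0] (fun t : ℝ => t ^ 2)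

/-- `μ` is a local minimizer of `J`, in the sense of the second derivative test, under the
constraint `⟨v, h⟩ = 0` on the perturbation `h ∈ H¹(ℝ)`: `μ` is critical and the second variation
is nonnegative on the constrained space. -/
def IsConstrainedMinimizer (J : (ℝ → ℝ) → ℝ) (μ v : ℝ → ℝ) : Prop :=
  ∀ h : ℝ → ℝ, MemH1 h → inner2 v h = 0 → ∃ q : ℝ, 0 ≤ q ∧ HasSecondVariation J μ h q

/-- The second variation degenerates on the constrained space only in the direction `μ'` of the
translations. -/
def DegenerateOnlyByTranslation (J : (ℝ → ℝ) → ℝ) (μ v : ℝ → ℝ) : Prop :=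
  ∀ h : ℝ → ℝ, MemH1 h → inner2 v h = 0 → HasSecondVariation J μ h 0 →
    ∃ s : ℝ, ∀ x, h x = s * deriv μ x

/-- `μ` is a strict local minimizer of `J` with quadratic growth in `H¹(ℝ)`, among the perturbations
`h` that satisfy the constraint `⟨v, h⟩ = 0` and are orthogonal to the direction `μ'` of the
translations. -/
def IsMinimizerTransverseToTranslation (J : (ℝ → ℝ) → ℝ) (μ v : ℝ → ℝ) : Prop :=
  ∃ C > 0, ∃ ε > 0, ∀ h : ℝ → ℝ, MemH1 h → inner2 v h = 0 → inner2 (deriv μ) h = 0 →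
    h1Norm h < ε → J μ + C * h1Norm h ^ 2 ≤ J (fun x => μ x + h x)

/-- The weight `μ^(1/b-1) - k^(1/b-1)` of the constraint. -/
def weight (b k : ℝ) (μ : ℝ → ℝ) (x : ℝ) : ℝ := μ x ^ (1 / b - 1) - k ^ (1 / b - 1)

/-- The function `v₀ = (c - φ)^(b-1) - (c - k)^(b-1)`. -/
def v0 (b c k : ℝ) (φ : ℝ → ℝ) (x : ℝ) : ℝ := (c - φ x) ^ (b - 1) - (c - k) ^ (b - 1)

/-- The potential of the Sturm-Liouville operator `𝓛`. -/
def potential (b c k : ℝ) (φ : ℝ → ℝ) (x : ℝ) : ℝ :=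
  (b + 1) * (c - φ x) / (2 * momentum φ x ^ 2)
    + (2 * b + 1) * (c - φ x) * iteratedDeriv 2 (momentum φ) x / (b * momentum φ x ^ 3)
    - (2 * b + 1) * (3 * b + 1) * (c - φ x) * deriv (momentum φ) x ^ 2
        / (2 * b ^ 2 * momentum φ x ^ 4)
    - (c - k) * ((b - 1) * c + (b + 1) * k) / (2 * (c - φ x) * momentum φ x ^ 2)

/-- The Sturm-Liouville operator `𝓛`, with leading part `- d/dx (c - φ)/μ² d/dx`. -/
def opL (b c k : ℝ) (φ w : ℝ → ℝ) (x : ℝ) : ℝ :=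
  -deriv (fun y => (c - φ y) / momentum φ y ^ 2 * deriv w y) x + potential b c k φ x * w x

/-- The integrand of `Q(φ)`. -/
def QDensity (b c k : ℝ) (φ : ℝ → ℝ) (x : ℝ) : ℝ :=
  b * ((c - k) / (c - φ x)) - ((c - k) / (c - φ x)) ^ b - b + 1

/-- The mapping `k ↦ Q(φ_k)` along a family `φ` of profiles. -/
def Q (b c : ℝ) (φ : ℝ → ℝ → ℝ) (k : ℝ) : ℝ := ∫ x, QDensity b c k (φ k) x

end BCH

end

/-! Put s = (m/k)^(-1/(2b)). In this variable -Λ becomes γ ∫ (4 s_x² + V(s)) with γ = (b-1)(c-k)/2,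
and the potential V(s) = s² + s⁻² - 2 + κ Y(s) depends on the parameters b and κ = k/(c-k) only
(`neg_actionDensity_eq`). The wave becomes θ = ((c-φ)/(c-k))^(1/2), a homoclinic orbit of 4θ'² =
V(θ), 8θ'' = V'(θ). Hence μ is critical. With σ = Ωh, where Ω = ds/dm at μ, the second variation is
8γ B(σ,σ), where B(σ,σ) = ∫ (σ'² + Wσ²) and W = V''(θ)/8 (`energy_expansion`). The constraint (∗)
becomes ⟨f,σ⟩ = 0 with f = -Y'(θ)/8.

Differentiating the equation of θ in κ shows that ζ = ∂θ/∂κ solves -ζ'' + Wζ = f. Translation gives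
p = θ' in the kernel, with a single zero, so B has one negative direction. As in the
Vakhitov-Kolokolov criterion, B is nonnegative on the orthogonal complement of f exactly when ⟨f,ζ⟩
≤ 0, and coercive modulo p exactly when ⟨f,ζ⟩ < 0. Since Q = ((b-1)/2) ∫ Y(θ), the chain rule
suggests dQ/dκ = -4(b-1)⟨f,ζ⟩, which links the sign to the monotonicity of Q.

The spectral step needs no spectral theorem. Every σ in H¹ is sζ + αp + β|p| + u with u vanishing at
0 and at ±l. The functions p and |p| do not contribute to B, so B(σ,σ) = 2s⟨f,σ⟩ - s²⟨f,ζ⟩ + B(u,u)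
(`form_expand`). The last term controls ∫ u² (`exists_gap`): by a Poincaré inequality on the short
intervals next to 0, and by a strict Riccati supersolution, a perturbation of p'/p, outside them.

No regularity of k ↦ φ_k is assumed, so neither ζ nor dQ/dκ can be obtained by differentiating the
family. With the phase y = -ψ'/(ψ √(1-κb)), for ψ = (φ-k)/(c-k), as coordinate, the wave is an
explicit function of y in (-1,1) and κ. This yields a closed formula for ζ, whose equation is
verified directly, and writes ∫ Y(θ) as an integral over a fixed interval that can be differentiated
under the integral sign (`hasDerivAt_integral_potY`).

Finally 𝓛(σ/Ω) = 4b²(c-k) Ω(-σ'' + Wσ) and v₀ is a constant multiple of Ωf, so a constant multiple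
of ζ/Ω solves 𝓛w = v₀, and the symmetry of 𝓛 makes ⟨w,v₀⟩ the same for all solutions. -/

namespace BCH

/-! ### Calculus in H¹(ℝ) through absolutely continuous representatives -/

/-- Local absolute continuity on the line. -/
def LocAC (f : ℝ → ℝ) : Prop := ∀ x y : ℝ, AbsolutelyContinuousOnInterval f x y

lemma LocAC.continuous {f : ℝ → ℝ} (hf : LocAC f) : Continuous f := by
  rw [continuous_iff_continuousAt]
  intro x
  have h := (hf (x - 1) (x + 1)).continuousOn
  rw [uIcc_of_le (by linarith)] at h
  exact h.continuousAt (Icc_mem_nhds (by linarith) (by linarith))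

lemma LocAC.ae_differentiableAt {f : ℝ → ℝ} (hf : LocAC f) :
    ∀ᵐ x : ℝ, DifferentiableAt ℝ f x := by
  have h : ∀ n : ℕ, ∀ᵐ x : ℝ, x ∈ uIcc (-(n : ℝ)) n → DifferentiableAt ℝ f x :=
    fun n => (hf _ _).ae_differentiableAt
  filter_upwards [ae_all_iff.2 h] with x hx
  obtain ⟨n, hn⟩ := exists_nat_ge |x|
  refine hx n ?_
  rw [uIcc_of_le (by linarith [abs_nonneg x])]
  exact ⟨by linarith [neg_abs_le x], by linarith [le_abs_self x]⟩

lemma LocAC.mul {f g : ℝ → ℝ} (hf : LocAC f) (hg : LocAC g) : LocAC (fun x => f x * g x) :=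
  fun x y => (hf x y).mul (hg x y)

lemma LocAC.add {f g : ℝ → ℝ} (hf : LocAC f) (hg : LocAC g) : LocAC (fun x => f x + g x) :=
  fun x y => (hf x y).add (hg x y)

lemma LocAC.const_mul {f : ℝ → ℝ} (r : ℝ) (hf : LocAC f) : LocAC (fun x => r * f x) :=
  fun x y => (hf x y).const_mul r

lemma locAC_of_contDiff {f : ℝ → ℝ} (hf : ContDiff ℝ 1 f) : LocAC f :=
  fun _ _ => hf.contDiffOn.absolutelyContinuousOnInterval

lemma LocAC.integral_deriv {f : ℝ → ℝ} (hf : LocAC f) (x y : ℝ) :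
    ∫ t in x..y, deriv f t = f y - f x := (hf x y).integral_deriv_eq_sub

lemma LocAC.deriv_mul {f g : ℝ → ℝ} (hf : LocAC f) (hg : LocAC g) :
    deriv (fun x => f x * g x) =ᵐ[volume] fun x => deriv f x * g x + f x * deriv g x := by
  filter_upwards [hf.ae_differentiableAt, hg.ae_differentiableAt] with x h1 h2
  exact (h1.hasDerivAt.mul h2.hasDerivAt).deriv

lemma LocAC.deriv_add {f g : ℝ → ℝ} (hf : LocAC f) (hg : LocAC g) :
    deriv (fun x => f x + g x) =ᵐ[volume] fun x => deriv f x + deriv g x := by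
  filter_upwards [hf.ae_differentiableAt, hg.ae_differentiableAt] with x h1 h2
  exact (h1.hasDerivAt.add h2.hasDerivAt).deriv

lemma deriv_const_mul_fun (r : ℝ) (f : ℝ → ℝ) :
    deriv (fun x => r * f x) = fun x => r * deriv f x := by
  funext x; exact deriv_const_mul_field r

/-- A Lipschitz outer function preserves local absolute continuity, provided it is `C¹`
on a convex set that contains the values. -/
lemma LocAC.comp_contDiffOn {f F : ℝ → ℝ} (hf : LocAC f) {l u : ℝ}
    (hF : ContDiffOn ℝ 1 F (Icc l u)) (hfm : ∀ x, f x ∈ Icc l u) : LocAC (fun x => F (f x)) := by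
  obtain ⟨K, hK⟩ := hF.exists_lipschitzOnWith (by decide) (convex_Icc _ _) isCompact_Icc
  intro x y
  have h := hf x y
  rw [absolutelyContinuousOnInterval_iff] at h ⊢
  intro ε hε
  obtain ⟨δ, hδ, H⟩ := h (ε / (K + 1)) (by positivity)
  refine ⟨δ, hδ, fun E hE hs => ?_⟩
  have h1 := H E hE hs
  have hK0 : (0 : ℝ) ≤ K := K.coe_nonneg
  calc _ ≤ ∑ i ∈ Finset.range E.1, K * dist (f (E.2 i).1) (f (E.2 i).2) :=
        Finset.sum_le_sum fun i _ => hK.dist_le_mul _ (hfm _) _ (hfm _)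
    _ = K * ∑ i ∈ Finset.range E.1, dist (f (E.2 i).1) (f (E.2 i).2) := by
        rw [Finset.mul_sum]
    _ ≤ K * (ε / (K + 1)) := by gcongr
    _ < ε := by
        rw [← mul_div_assoc, div_lt_iff₀ (by positivity)]; nlinarith

/-- Integrability of F' gives F a limit at infinity, and integrability of F excludes a nonzero one.
-/
lemma LocAC.tendsto_atTop {F : ℝ → ℝ} (hF : LocAC F) (hd : Integrable (deriv F))
    (hi : Integrable F) : Tendsto F atTop (𝓝 0) := by
  have h := intervalIntegral_tendsto_integral_Ioi (0 : ℝ) hd.integrableOn tendsto_id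
  have h2 : Tendsto F atTop (𝓝 (F 0 + ∫ x in Ioi (0 : ℝ), deriv F x)) := by
    refine (h.const_add (F 0)).congr fun y => ?_
    simp [hF.integral_deriv]
  have h3 : F 0 + ∫ x in Ioi (0 : ℝ), deriv F x = 0 := by
    refine IntegrableAtFilter.eq_zero_of_tendsto (μ := volume) (l := atTop) (f := F)
      (hi.integrableAtFilter _) ?_ h2
    intro s hs
    rcases mem_atTop_sets.1 hs with ⟨b, hb⟩
    rw [← top_le_iff, ← Real.volume_Ici (a := b)]
    exact measure_mono hb
  rwa [h3] at h2

lemma LocAC.tendsto_atBot {F : ℝ → ℝ} (hF : LocAC F) (hd : Integrable (deriv F))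
    (hi : Integrable F) : Tendsto F atBot (𝓝 0) := by
  have h := intervalIntegral_tendsto_integral_Iic (0 : ℝ) hd.integrableOn tendsto_id
  have h2 : Tendsto F atBot (𝓝 (F 0 - ∫ x in Iic (0 : ℝ), deriv F x)) := by
    refine (h.const_sub (F 0)).congr fun y => ?_
    simp [hF.integral_deriv]
  have h3 : F 0 - ∫ x in Iic (0 : ℝ), deriv F x = 0 := by
    refine IntegrableAtFilter.eq_zero_of_tendsto (μ := volume) (l := atBot) (f := F)
      (hi.integrableAtFilter _) ?_ h2
    intro s hs
    rcases mem_atBot_sets.1 hs with ⟨b, hb⟩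
    rw [← top_le_iff, ← Real.volume_Iic (a := b)]
    exact measure_mono hb
  rwa [h3] at h2

lemma LocAC.integral_deriv_eq_zero {F : ℝ → ℝ} (hF : LocAC F) (hd : Integrable (deriv F))
    (hb : Tendsto F atBot (𝓝 0)) (ht : Tendsto F atTop (𝓝 0)) : ∫ x, deriv F x = 0 := by
  have h := intervalIntegral_tendsto_integral (μ := volume) hd
    (tendsto_neg_atTop_atBot (G := ℝ)) tendsto_id
  refine tendsto_nhds_unique h ?_
  have : Tendsto (fun y : ℝ => F y - F (-y)) atTop (𝓝 (0 - 0)) :=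
    ht.sub (hb.comp tendsto_neg_atTop_atBot)
  rw [sub_zero] at this
  exact this.congr fun y => by simp [hF.integral_deriv]

lemma MemH1.locAC {f : ℝ → ℝ} (hf : MemH1 f) : LocAC f := hf.1

lemma MemH1.continuous {f : ℝ → ℝ} (hf : MemH1 f) : Continuous f := hf.locAC.continuous

lemma memLp_mul_bdd {f g : ℝ → ℝ} (hf : MemLp f 2 volume) (hg : AEStronglyMeasurable g volume)
    {K : ℝ} (hK : ∀ x, |g x| ≤ K) : MemLp (fun x => g x * f x) 2 volume := by
  refine hf.of_le_mul (c := K) (hg.mul hf.1) (Eventually.of_forall fun x => ?_)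
  simp only [norm_mul, Real.norm_eq_abs]
  exact mul_le_mul_of_nonneg_right (hK x) (abs_nonneg _)

lemma integrable_mul_of_memLp {f g : ℝ → ℝ} (hf : MemLp f 2 volume) (hg : MemLp g 2 volume) :
    Integrable (fun x => f x * g x) := hf.integrable_mul hg

lemma MemH1.add {f g : ℝ → ℝ} (hf : MemH1 f) (hg : MemH1 g) : MemH1 (fun x => f x + g x) :=
  ⟨hf.locAC.add hg.locAC, hf.2.1.add hg.2.1,
    (hf.2.2.add hg.2.2).ae_eq (hf.locAC.deriv_add hg.locAC).symm⟩

lemma MemH1.const_mul {f : ℝ → ℝ} (r : ℝ) (hf : MemH1 f) : MemH1 (fun x => r * f x) :=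
  ⟨hf.locAC.const_mul r, hf.2.1.const_mul r, by
    rw [deriv_const_mul_fun]; exact hf.2.2.const_mul r⟩

lemma MemH1.mul_bdd {f g : ℝ → ℝ} (hf : MemH1 f) (hg : ContDiff ℝ 1 g) {K K' : ℝ}
    (hK : ∀ x, |g x| ≤ K) (hK' : ∀ x, |deriv g x| ≤ K') : MemH1 (fun x => g x * f x) := by
  have hac := locAC_of_contDiff hg
  refine ⟨hac.mul hf.locAC, memLp_mul_bdd hf.2.1 hg.continuous.aestronglyMeasurable hK, ?_⟩
  refine MemLp.ae_eq (hac.deriv_mul hf.locAC).symm ?_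
  exact (memLp_mul_bdd hf.2.1 (hg.continuous_deriv le_rfl).aestronglyMeasurable hK').add
    (memLp_mul_bdd hf.2.2 hg.continuous.aestronglyMeasurable hK)

lemma memH1_of_contDiff {f : ℝ → ℝ} (hf : ContDiff ℝ 1 f) (h : MemLp f 2 volume)
    (h' : MemLp (deriv f) 2 volume) : MemH1 f := ⟨locAC_of_contDiff hf, h, h'⟩

lemma MemH1.integrable_sq_add {f : ℝ → ℝ} (hf : MemH1 f) :
    Integrable (fun x => f x ^ 2 + deriv f x ^ 2) := hf.2.1.integrable_sq.add hf.2.2.integrable_sq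

lemma MemH1.mul_locAC {f g : ℝ → ℝ} (hf : MemH1 f) (hg : MemH1 g) :
    LocAC (fun x => f x * g x) ∧ Integrable (deriv fun x => f x * g x) ∧
      Tendsto (fun x => f x * g x) atBot (𝓝 0) ∧ Tendsto (fun x => f x * g x) atTop (𝓝 0) := by
  have h1 := hf.locAC.mul hg.locAC
  have h2 : Integrable (deriv fun x => f x * g x) :=
    ((integrable_mul_of_memLp hf.2.2 hg.2.1).add (integrable_mul_of_memLp hf.2.1 hg.2.2)).congr
      (hf.locAC.deriv_mul hg.locAC).symm
  have h3 := integrable_mul_of_memLp hf.2.1 hg.2.1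
  exact ⟨h1, h2, h1.tendsto_atBot h2 h3, h1.tendsto_atTop h2 h3⟩

/-- Integration by parts in `H¹`. -/
lemma MemH1.integral_by_parts {f g : ℝ → ℝ} (hf : MemH1 f) (hg : MemH1 g) :
    ∫ x, f x * deriv g x = -∫ x, deriv f x * g x := by
  obtain ⟨h1, h2, h3, h4⟩ := hf.mul_locAC hg
  have h := h1.integral_deriv_eq_zero h2 h3 h4
  rw [integral_congr_ae (hf.locAC.deriv_mul hg.locAC),
    integral_add (integrable_mul_of_memLp hf.2.2 hg.2.1) (integrable_mul_of_memLp hf.2.1 hg.2.2)]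
    at h
  linarith

lemma tendsto_zero_of_sq {f : ℝ → ℝ} {l : Filter ℝ} (h : Tendsto (fun x => f x * f x) l (𝓝 0)) :
    Tendsto f l (𝓝 0) := by
  have := (Real.continuous_sqrt.tendsto 0).comp h
  rw [Real.sqrt_zero] at this
  rw [tendsto_zero_iff_abs_tendsto_zero]
  exact this.congr fun x => by simp [Function.comp, Real.sqrt_mul_self_eq_abs]

lemma MemH1.tendsto_atTop {f : ℝ → ℝ} (hf : MemH1 f) : Tendsto f atTop (𝓝 0) :=
  tendsto_zero_of_sq (hf.mul_locAC hf).2.2.2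

lemma MemH1.tendsto_atBot {f : ℝ → ℝ} (hf : MemH1 f) : Tendsto f atBot (𝓝 0) :=
  tendsto_zero_of_sq (hf.mul_locAC hf).2.2.1

lemma h1Norm_nonneg (f : ℝ → ℝ) : 0 ≤ h1Norm f := Real.sqrt_nonneg _

lemma h1Norm_sq (f : ℝ → ℝ) : h1Norm f ^ 2 = ∫ x, (f x ^ 2 + deriv f x ^ 2) :=
  Real.sq_sqrt (integral_nonneg fun x => by positivity)

/-- The Sobolev inequality on the line. -/
lemma MemH1.abs_le {f : ℝ → ℝ} (hf : MemH1 f) (x : ℝ) : |f x| ≤ h1Norm f := by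
  obtain ⟨h1, h2, h3, h4⟩ := hf.mul_locAC hf
  refine abs_le_of_sq_le_sq ?_ (h1Norm_nonneg f)
  rw [h1Norm_sq]
  set F := fun x => f x * f x with hF
  have ha : ∫ t in Iic x, deriv F t = F x := by
    have h := intervalIntegral_tendsto_integral_Iic x h2.integrableOn tendsto_id
    refine tendsto_nhds_unique h ?_
    have : Tendsto (fun y => F x - F y) atBot (𝓝 (F x - 0)) := h3.const_sub _
    rw [sub_zero] at this
    exact this.congr fun y => by simp [h1.integral_deriv]
  have hb : ∫ t in Ioi x, deriv F t = -F x := by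
    have h := intervalIntegral_tendsto_integral_Ioi x h2.integrableOn tendsto_id
    refine tendsto_nhds_unique h ?_
    have : Tendsto (fun y => F y - F x) atTop (𝓝 (0 - F x)) := h4.sub_const _
    rw [zero_sub] at this
    exact this.congr fun y => by simp [h1.integral_deriv]
  have hle : ∀ᵐ t, |deriv F t| ≤ f t ^ 2 + deriv f t ^ 2 := by
    filter_upwards [hf.locAC.deriv_mul hf.locAC] with t ht
    rw [ht, _root_.abs_le]
    constructor <;> nlinarith [sq_nonneg (f t - deriv f t), sq_nonneg (f t + deriv f t)]
  -- The value f(x)² is recovered from (f²)' on either side of x, so twice this value is at most the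
  -- total variation of f².
  have e1 : F x + F x ≤ ∫ t, |deriv F t| := by
    rw [← setIntegral_univ, ← Set.Iic_union_Ioi (a := x), setIntegral_union
      (Iic_disjoint_Ioi le_rfl) measurableSet_Ioi h2.abs.integrableOn h2.abs.integrableOn]
    have i1 := abs_integral_le_integral_abs (μ := volume.restrict (Iic x)) (f := deriv F)
    have i2 := abs_integral_le_integral_abs (μ := volume.restrict (Ioi x)) (f := deriv F)
    rw [ha] at i1
    rw [hb, abs_neg] at i2
    linarith [le_abs_self (F x)]
  have e2 := integral_mono_ae h2.abs hf.integrable_sq_add hle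
  have e3 : F x = f x ^ 2 := by simp only [hF]; ring
  have e4 : 0 ≤ f x ^ 2 := sq_nonneg _
  linarith

lemma h1Norm_const_mul (r : ℝ) (f : ℝ → ℝ) : h1Norm (fun x => r * f x) = |r| * h1Norm f := by
  rw [h1Norm, h1Norm, deriv_const_mul_fun, ← Real.sqrt_sq_eq_abs, ← Real.sqrt_mul (sq_nonneg r),
    ← integral_const_mul]
  congr 2
  funext x; ring

lemma LocAC.integral_Ioi_deriv {F : ℝ → ℝ} (hF : LocAC F) (hd : Integrable (deriv F))
    (ht : Tendsto F atTop (𝓝 0)) (x : ℝ) : ∫ t in Ioi x, deriv F t = -F x := by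
  have h := intervalIntegral_tendsto_integral_Ioi x hd.integrableOn tendsto_id
  refine tendsto_nhds_unique h ?_
  have : Tendsto (fun y => F y - F x) atTop (𝓝 (0 - F x)) := ht.sub_const _
  rw [zero_sub] at this
  exact this.congr fun y => by simp [hF.integral_deriv]

lemma LocAC.integral_Iic_deriv {F : ℝ → ℝ} (hF : LocAC F) (hd : Integrable (deriv F))
    (ht : Tendsto F atBot (𝓝 0)) (x : ℝ) : ∫ t in Iic x, deriv F t = F x := by
  have h := intervalIntegral_tendsto_integral_Iic x hd.integrableOn tendsto_id
  refine tendsto_nhds_unique h ?_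
  have : Tendsto (fun y => F x - F y) atBot (𝓝 (F x - 0)) := ht.const_sub _
  rw [sub_zero] at this
  exact this.congr fun y => by simp [hF.integral_deriv]

/-- Cauchy-Schwarz, from the discriminant of the nonnegative quadratic polynomial t ↦ ∫ (t f + g)².
-/
lemma integral_mul_sq_le {α : Type*} [MeasurableSpace α] {ν : Measure α} {f g : α → ℝ}
    (hf : MemLp f 2 ν) (hg : MemLp g 2 ν) :
    (∫ x, f x * g x ∂ν) ^ 2 ≤ (∫ x, f x ^ 2 ∂ν) * ∫ x, g x ^ 2 ∂ν := by
  have hfg : Integrable (fun x => f x * g x) ν := hf.integrable_mul hg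
  have h : ∀ t : ℝ, 0 ≤ (∫ x, f x ^ 2 ∂ν) * (t * t) + (2 * ∫ x, f x * g x ∂ν) * t
      + ∫ x, g x ^ 2 ∂ν := by
    intro t
    have : (∫ x, f x ^ 2 ∂ν) * (t * t) + (2 * ∫ x, f x * g x ∂ν) * t + ∫ x, g x ^ 2 ∂ν
        = ∫ x, (t * f x + g x) ^ 2 ∂ν := by
      have e : ∀ x, (t * f x + g x) ^ 2 = t * t * f x ^ 2 + 2 * t * (f x * g x) + g x ^ 2 :=
        fun x => by ring
      simp_rw [e]
      have i1 : Integrable (fun x => t * t * f x ^ 2) ν := hf.integrable_sq.const_mul _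
      have i2 : Integrable (fun x => 2 * t * (f x * g x)) ν := hfg.const_mul _
      have i3 : Integrable (fun x => t * t * f x ^ 2 + 2 * t * (f x * g x)) ν := i1.add i2
      rw [integral_add i3 hg.integrable_sq, integral_add i1 i2, integral_const_mul,
        integral_const_mul]
      ring
    rw [this]
    exact integral_nonneg fun x => sq_nonneg _
  have := discrim_le_zero h
  rw [discrim] at this
  nlinarith

/-! ### The quadratic form of a Schrödinger operator and its local lower bounds -/

/-- The bilinear form `∫ σ'τ' + W σ τ`. -/
noncomputable def schForm (W σ τ : ℝ → ℝ) : ℝ := ∫ x, (deriv σ x * deriv τ x + W x * (σ x * τ x))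

/-- A continuous bounded potential. -/
structure BddPotential (W : ℝ → ℝ) (K : ℝ) : Prop where
  cont : Continuous W
  bdd : ∀ x, |W x| ≤ K

lemma BddPotential.nonneg {W : ℝ → ℝ} {K : ℝ} (hW : BddPotential W K) : 0 ≤ K :=
  (abs_nonneg _).trans (hW.bdd 0)

section form
variable {W : ℝ → ℝ} {K : ℝ} (hW : BddPotential W K) {σ τ υ : ℝ → ℝ}
include hW

lemma BddPotential.integrable_mul (hσ : MemLp σ 2 volume) (hτ : MemLp τ 2 volume) :
    Integrable (fun x => W x * (σ x * τ x)) :=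
  (integrable_mul_of_memLp hσ hτ).bdd_mul hW.cont.aestronglyMeasurable
    (Eventually.of_forall fun x => by simpa using hW.bdd x)

lemma BddPotential.integrable_form (hσ : MemH1 σ) (hτ : MemH1 τ) :
    Integrable (fun x => deriv σ x * deriv τ x + W x * (σ x * τ x)) :=
  (integrable_mul_of_memLp hσ.2.2 hτ.2.2).add (hW.integrable_mul hσ.2.1 hτ.2.1)

lemma BddPotential.form_add (hσ : MemH1 σ) (hτ : MemH1 τ) (hυ : MemH1 υ) :
    schForm W (fun x => σ x + τ x) υ = schForm W σ υ + schForm W τ υ := by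
  rw [schForm, schForm, schForm,
    ← integral_add (hW.integrable_form hσ hυ) (hW.integrable_form hτ hυ)]
  refine integral_congr_ae ?_
  filter_upwards [hσ.locAC.deriv_add hτ.locAC] with x hx
  rw [hx]; ring

omit hW in
lemma schForm_const_mul (r : ℝ) (σ υ : ℝ → ℝ) :
    schForm W (fun x => r * σ x) υ = r * schForm W σ υ := by
  rw [schForm, schForm, ← integral_const_mul, deriv_const_mul_fun]
  congr 1; funext x; ring

omit hW in
lemma schForm_comm (σ υ : ℝ → ℝ) : schForm W σ υ = schForm W υ σ := by
  rw [schForm, schForm]; congr 1; funext x; ring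

/-- The form paired with a strong solution of `-ζ'' + W ζ = f`. -/
lemma BddPotential.form_of_solution {ζ f : ℝ → ℝ} (hζ : MemH1 ζ) (hζ' : MemH1 (deriv ζ))
    (hd : ∀ x, HasDerivAt (deriv ζ) (W x * ζ x - f x) x) (hσ : MemH1 σ) :
    schForm W ζ σ = inner2 f σ := by
  have h2 : deriv (deriv ζ) = fun x => W x * ζ x - f x := funext fun x => (hd x).deriv
  have h := hζ'.integral_by_parts hσ
  have i2 := integrable_mul_of_memLp hζ'.2.2 hσ.2.1
  rw [schForm, inner2, integral_add (integrable_mul_of_memLp hζ.2.2 hσ.2.2)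
    (hW.integrable_mul hζ.2.1 hσ.2.1), h, neg_add_eq_sub,
    ← integral_sub (hW.integrable_mul hζ.2.1 hσ.2.1) i2]
  congr 1; funext x; rw [h2]; ring

end form

/-- A Poincaré inequality on a short interval. -/
lemma poincare_interval {W : ℝ → ℝ} {K : ℝ} (hW : BddPotential W K) {u : ℝ → ℝ} (hu : MemH1 u)
    {l r : ℝ} (hlr : l ≤ r) (hul : u l = 0) (hK : (K + 1) * (r - l) ^ 2 ≤ 1) :
    ∫ x in l..r, u x ^ 2 ≤ ∫ x in l..r, (deriv u x * deriv u x + W x * (u x * u x)) := by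
  set D := ∫ x in l..r, deriv u x ^ 2 with hD
  have hI : ∀ x y, IntervalIntegrable (fun t => deriv u t ^ 2) volume x y :=
    fun x y => hu.2.2.integrable_sq.intervalIntegrable
  have hI2 : ∀ x y, IntervalIntegrable (fun t => u t ^ 2) volume x y :=
    fun x y => hu.2.1.integrable_sq.intervalIntegrable
  have hD0 : 0 ≤ D := intervalIntegral.integral_nonneg hlr fun x _ => sq_nonneg _
  -- As u vanishes at l, Cauchy-Schwarz bounds u(x)² by (r-l) ∫ u'². Integration gives ∫ u² ≤ (r-l)²
  -- ∫ u², with u' on the right, and on a short interval ∫ u'² then absorbs both -K ∫ u² and ∫ u².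
  have hpt : ∀ x ∈ Icc l r, u x ^ 2 ≤ (r - l) * D := by
    intro x hx
    have h1 := hu.locAC.integral_deriv l x
    rw [hul, sub_zero, intervalIntegral.integral_of_le hx.1] at h1
    have h2 := integral_mul_sq_le (ν := volume.restrict (Ioc l x)) (f := fun _ => (1 : ℝ))
      (memLp_const 1) (hu.2.2.restrict (Ioc l x))
    simp only [one_mul, one_pow, integral_const, smul_eq_mul, mul_one] at h2
    rw [h1, ← intervalIntegral.integral_of_le hx.1] at h2
    simp only [measureReal_restrict_apply_univ, Real.volume_real_Ioc_of_le hx.1] at h2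
    have h3 : ∫ t in l..x, deriv u t ^ 2 ≤ D :=
      intervalIntegral.integral_mono_interval le_rfl hx.1 hx.2
        (Eventually.of_forall fun t => sq_nonneg _) (hI _ _)
    have h4 : 0 ≤ ∫ t in l..x, deriv u t ^ 2 :=
      intervalIntegral.integral_nonneg hx.1 fun x _ => sq_nonneg _
    calc u x ^ 2 ≤ (x - l) * ∫ t in l..x, deriv u t ^ 2 := h2
      _ ≤ (r - l) * D := mul_le_mul (by linarith [hx.2]) h3 h4 (by linarith)
  have h5 : ∫ x in l..r, u x ^ 2 ≤ (r - l) ^ 2 * D := by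
    calc ∫ x in l..r, u x ^ 2 ≤ ∫ x in l..r, (r - l) * D :=
          intervalIntegral.integral_mono_on hlr (hI2 _ _) (by simp) hpt
      _ = (r - l) ^ 2 * D := by rw [intervalIntegral.integral_const, smul_eq_mul]; ring
  have h6 : D - K * ∫ x in l..r, u x ^ 2
      ≤ ∫ x in l..r, (deriv u x * deriv u x + W x * (u x * u x)) := by
    rw [← intervalIntegral.integral_const_mul,
      ← intervalIntegral.integral_sub (hI _ _) ((hI2 _ _).const_mul _)]
    refine intervalIntegral.integral_mono_on hlr ((hI _ _).sub ((hI2 _ _).const_mul _))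
      (hW.integrable_form hu hu).intervalIntegrable fun x _ => ?_
    have := (abs_le.1 (hW.bdd x)).1
    nlinarith [sq_nonneg (u x)]
  have h7 : 0 ≤ K := hW.nonneg
  nlinarith

/-- Lower bound of the form by a supersolution of the Riccati equation. -/
lemma riccati_interval {W : ℝ → ℝ} {K : ℝ} (hW : BddPotential W K) {u a : ℝ → ℝ} (hu : MemH1 u)
    {l r δ : ℝ} (hlr : l ≤ r) (ha : ContDiffOn ℝ 1 a (Icc l r))
    (had : ∀ x ∈ Icc l r, DifferentiableAt ℝ a x)
    (hδ : ∀ x ∈ Icc l r, δ ≤ W x - deriv a x - a x ^ 2) :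
    (δ * ∫ x in l..r, u x ^ 2) + (a r * u r ^ 2 - a l * u l ^ 2)
      ≤ ∫ x in l..r, (deriv u x * deriv u x + W x * (u x * u x)) := by
  have hac : AbsolutelyContinuousOnInterval a l r :=
    ContDiffOn.absolutelyContinuousOnInterval (by rwa [uIcc_of_le hlr])
  have hF : AbsolutelyContinuousOnInterval (fun x => a x * (u x * u x)) l r :=
    hac.mul ((hu.locAC.mul hu.locAC) l r)
  have hFi := hF.integral_deriv_eq_sub
  have hI2 : IntervalIntegrable (fun t => u t ^ 2) volume l r :=
    hu.2.1.integrable_sq.intervalIntegrable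
  rw [← intervalIntegral.integral_const_mul, sq, sq, ← hFi,
    ← intervalIntegral.integral_add (hI2.const_mul _) hF.intervalIntegrable_deriv]
  refine intervalIntegral.integral_mono_ae_restrict hlr
    ((hI2.const_mul _).add hF.intervalIntegrable_deriv)
    (hW.integrable_form hu hu).intervalIntegrable ?_
  rw [EventuallyLE, ae_restrict_iff' measurableSet_Icc]
  filter_upwards [hu.locAC.ae_differentiableAt] with x hx hxI
  have hd : deriv (fun x => a x * (u x * u x)) x
      = deriv a x * (u x * u x) + a x * (deriv u x * u x + u x * deriv u x) :=
    ((had x hxI).hasDerivAt.mul (hx.hasDerivAt.mul hx.hasDerivAt)).deriv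
  rw [hd]
  -- Completion of the square: u'² + Wu² = (u' - au)² + (au²)' + (W - a' - a²)u².
  nlinarith [hδ x hxI, sq_nonneg (deriv u x - a x * u x), sq_nonneg (u x)]

/-- The right endpoint is sent to infinity; the boundary term a u² disappears because a is bounded
and u tends to 0. -/
lemma riccati_Ioi {W : ℝ → ℝ} {K : ℝ} (hW : BddPotential W K) {u a : ℝ → ℝ} (hu : MemH1 u)
    {l δ Ka : ℝ} (hl : 0 < l) (ha : ContDiffOn ℝ 1 a (Ioi 0)) (hKa : ∀ x ≥ l, |a x| ≤ Ka)
    (hδ : ∀ x ≥ l, δ ≤ W x - deriv a x - a x ^ 2) (hul : u l = 0) :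
    (δ * ∫ x in Ioi l, u x ^ 2) ≤ ∫ x in Ioi l, (deriv u x * deriv u x + W x * (u x * u x)) := by
  have h1 := (intervalIntegral_tendsto_integral_Ioi l hu.2.1.integrable_sq.integrableOn
    tendsto_id).const_mul δ
  have h2 := intervalIntegral_tendsto_integral_Ioi l (hW.integrable_form hu hu).integrableOn
    tendsto_id
  have h3 : Tendsto (fun x => Ka * u x ^ 2) atTop (𝓝 (Ka * 0 ^ 2)) :=
    (hu.tendsto_atTop.pow 2).const_mul _
  have h4 := h2.add h3
  simp only [ne_eq, OfNat.ofNat_ne_zero, not_false_eq_true, zero_pow, mul_zero, add_zero] at h4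
  refine le_of_tendsto_of_tendsto h1 h4 ?_
  filter_upwards [eventually_ge_atTop l] with r hr
  have hsub : Icc l r ⊆ Ioi 0 := fun x hx => lt_of_lt_of_le hl hx.1
  have h5 := riccati_interval hW hu hr (ha.mono hsub)
    (fun x hx => (ha.differentiableOn (by norm_num)).differentiableAt (Ioi_mem_nhds (hsub hx)))
    (fun x hx => hδ x hx.1)
  rw [hul] at h5
  have h6 := (abs_le.1 (hKa r hr)).1
  simp only [id]
  nlinarith [sq_nonneg (u r)]

lemma riccati_Iic {W : ℝ → ℝ} {K : ℝ} (hW : BddPotential W K) {u a : ℝ → ℝ} (hu : MemH1 u)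
    {l δ Ka : ℝ} (hl : l < 0) (ha : ContDiffOn ℝ 1 a (Iio 0)) (hKa : ∀ x ≤ l, |a x| ≤ Ka)
    (hδ : ∀ x ≤ l, δ ≤ W x - deriv a x - a x ^ 2) (hul : u l = 0) :
    (δ * ∫ x in Iic l, u x ^ 2) ≤ ∫ x in Iic l, (deriv u x * deriv u x + W x * (u x * u x)) := by
  have h1 := (intervalIntegral_tendsto_integral_Iic l hu.2.1.integrable_sq.integrableOn
    tendsto_id).const_mul δ
  have h2 := intervalIntegral_tendsto_integral_Iic l (hW.integrable_form hu hu).integrableOn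
    tendsto_id
  have h3 : Tendsto (fun x => Ka * u x ^ 2) atBot (𝓝 (Ka * 0 ^ 2)) :=
    (hu.tendsto_atBot.pow 2).const_mul _
  have h4 := h2.add h3
  simp only [ne_eq, OfNat.ofNat_ne_zero, not_false_eq_true, zero_pow, mul_zero, add_zero] at h4
  refine le_of_tendsto_of_tendsto h1 h4 ?_
  filter_upwards [eventually_le_atBot l] with r hr
  have hsub : Icc r l ⊆ Iio 0 := fun x hx => lt_of_le_of_lt hx.2 hl
  have h5 := riccati_interval hW hu hr (ha.mono hsub)
    (fun x hx => (ha.differentiableOn (by norm_num)).differentiableAt (Iio_mem_nhds (hsub hx)))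
    (fun x hx => hδ x hx.2)
  rw [hul] at h5
  have h6 := (abs_le.1 (hKa r hr)).2
  simp only [id]
  nlinarith [sq_nonneg (u r)]

/-! ### The form on the orthogonal complement of f -/

/-- The data of a Schrödinger operator `-d²/dx² + W` with an odd-like ground state `p` of its
kernel, a solution `ζ` of `-ζ'' + W ζ = f`, and a Riccati supersolution away from the origin. -/
structure SpectralData (W p ζ f ϖ : ℝ → ℝ) (K : ℝ) : Prop where
  pot : BddPotential W K
  p_mem : MemH1 p
  p_mem' : MemH1 (deriv p)
  p_eq : ∀ x, HasDerivAt (deriv p) (W x * p x - 0) x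
  p_zero : p 0 = 0
  p_pos : ∀ x > 0, 0 < p x
  p_neg : ∀ x < 0, p x < 0
  ζ_mem : MemH1 ζ
  ζ_mem' : MemH1 (deriv ζ)
  ζ_eq : ∀ x, HasDerivAt (deriv ζ) (W x * ζ x - f x) x
  ζ_zero : ζ 0 ≠ 0
  f_mem : MemLp f 2 volume
  f_half : ∫ x in Ioi 0, f x * p x ≠ 0
  f_inner : ∫ x in Iic 0, f x * p x = -∫ x in Ioi 0, f x * p x
  ϖ_cont : Continuous ϖ
  ϖ_pos : ∀ x, 0 < ϖ x
  ϖ_bdd : ∃ C, ∀ x, |ϖ x| ≤ C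
  gap_right : ∀ l > 0, ∃ δ > 0, ∃ a : ℝ → ℝ, ContDiffOn ℝ 1 a (Ioi 0) ∧
    (∃ Ka, ∀ x ≥ l, |a x| ≤ Ka) ∧ ∀ x ≥ l, δ ≤ W x - deriv a x - a x ^ 2
  gap_left : ∀ l < 0, ∃ δ > 0, ∃ a : ℝ → ℝ, ContDiffOn ℝ 1 a (Iio 0) ∧
    (∃ Ka, ∀ x ≤ l, |a x| ≤ Ka) ∧ ∀ x ≤ l, δ ≤ W x - deriv a x - a x ^ 2

namespace SpectralData
variable {W p ζ f ϖ : ℝ → ℝ} {K : ℝ} (S : SpectralData W p ζ f ϖ K) {σ u : ℝ → ℝ}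
include S

lemma form_p (hσ : MemH1 σ) : schForm W p σ = 0 := by
  rw [S.pot.form_of_solution (f := fun _ => 0) S.p_mem S.p_mem' S.p_eq hσ]
  simp [inner2]

lemma form_ζ (hσ : MemH1 σ) : schForm W ζ σ = inner2 f σ :=
  S.pot.form_of_solution S.ζ_mem S.ζ_mem' S.ζ_eq hσ

lemma abs_eq_of_pos {x : ℝ} (hx : 0 < x) : |p x| = p x := abs_of_pos (S.p_pos x hx)

lemma abs_eq_of_neg {x : ℝ} (hx : x < 0) : |p x| = -p x := abs_of_neg (S.p_neg x hx)

lemma deriv_abs_of_pos {x : ℝ} (hx : 0 < x) : deriv (fun x => |p x|) x = deriv p x := by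
  refine EventuallyEq.deriv_eq ?_
  filter_upwards [Ioi_mem_nhds hx] with y hy using S.abs_eq_of_pos hy

lemma deriv_abs_of_neg {x : ℝ} (hx : x < 0) : deriv (fun x => |p x|) x = -deriv p x := by
  rw [← deriv.fun_neg]
  refine EventuallyEq.deriv_eq ?_
  filter_upwards [Iio_mem_nhds hx] with y hy using S.abs_eq_of_neg hy

lemma abs_deriv_abs : ∀ᵐ x, |deriv (fun x => |p x|) x| = |deriv p x| := by
  filter_upwards [compl_mem_ae_iff.2 (measure_singleton (0 : ℝ))] with x hx
  rcases lt_or_gt_of_ne (show x ≠ 0 from hx) with h | h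
  · rw [S.deriv_abs_of_neg h, abs_neg]
  · rw [S.deriv_abs_of_pos h]

lemma memH1_abs : MemH1 (fun x => |p x|) := by
  refine ⟨?_, S.p_mem.2.1.abs, ?_⟩
  · intro x y
    have h := S.p_mem.1 x y
    rw [absolutelyContinuousOnInterval_iff] at h ⊢
    intro ε hε
    obtain ⟨δ, hδ, H⟩ := h ε hε
    refine ⟨δ, hδ, fun E hE hs => lt_of_le_of_lt (Finset.sum_le_sum fun i _ => ?_) (H E hE hs)⟩
    rw [Real.dist_eq, Real.dist_eq]
    exact abs_abs_sub_abs_le_abs_sub _ _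
  · refine S.p_mem.2.2.of_le (measurable_deriv _).aestronglyMeasurable ?_
    filter_upwards [S.abs_deriv_abs] with x hx
    simpa using hx.le

/-- The quadratic form does not see the sign: |p|² = p² and, away from the origin, (|p|')² = p'². -/
lemma form_abs_abs : schForm W (fun x => |p x|) (fun x => |p x|) = 0 := by
  rw [← S.form_p S.p_mem, schForm, schForm]
  refine integral_congr_ae ?_
  filter_upwards [S.abs_deriv_abs] with x hx
  have h1 := abs_mul_abs_self (p x)
  have h2 : deriv (fun x => |p x|) x * deriv (fun x => |p x|) x = deriv p x * deriv p x := by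
    rw [← abs_mul_abs_self, hx, abs_mul_abs_self]
  rw [h1, h2]

/-- On each half-line |p| is ±p and solves the homogeneous equation. Only the jump of its derivative
at 0 could contribute, and this jump is multiplied by u(0) = 0. -/
lemma form_abs (hu : MemH1 u) (h0 : u 0 = 0) : schForm W (fun x => |p x|) u = 0 := by
  obtain ⟨h1, h2, h3, h4⟩ := S.p_mem'.mul_locAC hu
  have hI := S.pot.integrable_form S.memH1_abs hu
  have hd : deriv (fun x => deriv p x * u x) =ᵐ[volume]
      fun x => deriv p x * deriv u x + W x * (p x * u x) := by
    filter_upwards [S.p_mem'.locAC.deriv_mul hu.locAC] with x hx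
    rw [hx, (S.p_eq x).deriv]; ring
  rw [schForm, ← setIntegral_univ, ← Set.Iic_union_Ioi (a := (0 : ℝ)), setIntegral_union
      (Iic_disjoint_Ioi le_rfl) measurableSet_Ioi hI.integrableOn hI.integrableOn]
  have e1 : ∫ x in Ioi (0 : ℝ), (deriv (fun x => |p x|) x * deriv u x + W x * (|p x| * u x)) = 0 := by
    have e3 : ∫ x in Ioi (0 : ℝ), deriv (fun x => deriv p x * u x) x = 0 := by
      rw [h1.integral_Ioi_deriv h2 h4, h0, mul_zero, neg_zero]
    refine Eq.trans ?_ e3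
    refine setIntegral_congr_ae measurableSet_Ioi ?_
    filter_upwards [hd] with x hx hx0
    rw [hx, S.deriv_abs_of_pos hx0, S.abs_eq_of_pos hx0]
  have e2 : ∫ x in Iic (0 : ℝ), (deriv (fun x => |p x|) x * deriv u x + W x * (|p x| * u x)) = 0 := by
    have e3 : ∫ x in Iic (0 : ℝ), -deriv (fun x => deriv p x * u x) x = 0 := by
      rw [integral_neg, h1.integral_Iic_deriv h2 h3, h0, mul_zero, neg_zero]
    refine Eq.trans ?_ e3
    refine setIntegral_congr_ae measurableSet_Iic ?_
    filter_upwards [hd, compl_mem_ae_iff.2 (measure_singleton (0 : ℝ))] with x hx hx1 hx0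
    have hx2 : x < 0 := lt_of_le_of_ne hx0 hx1
    rw [hx, S.deriv_abs_of_neg hx2, S.abs_eq_of_neg hx2]; ring
  rw [e1, e2, add_zero]

lemma inner_f_p : inner2 f p = 0 := by
  have hI := integrable_mul_of_memLp S.f_mem S.p_mem.2.1
  rw [inner2, ← setIntegral_univ, ← Set.Iic_union_Ioi (a := (0 : ℝ)), setIntegral_union
      (Iic_disjoint_Ioi le_rfl) measurableSet_Ioi hI.integrableOn hI.integrableOn, S.f_inner]
  ring

/-- The integrals of f p over the two half-lines are opposite and nonzero: they cancel against p and
add up against |p|. -/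
lemma inner_f_abs : inner2 f (fun x => |p x|) ≠ 0 := by
  have hI := integrable_mul_of_memLp S.f_mem S.memH1_abs.2.1
  rw [inner2, ← setIntegral_univ, ← Set.Iic_union_Ioi (a := (0 : ℝ)), setIntegral_union
      (Iic_disjoint_Ioi le_rfl) measurableSet_Ioi hI.integrableOn hI.integrableOn]
  have e1 : ∫ x in Ioi (0 : ℝ), f x * |p x| = ∫ x in Ioi (0 : ℝ), f x * p x :=
    setIntegral_congr_fun measurableSet_Ioi fun x hx => by
      simp only [S.abs_eq_of_pos hx]
  have e2 : ∫ x in Iic (0 : ℝ), f x * |p x| = ∫ x in Ioi (0 : ℝ), f x * p x := by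
    rw [← neg_inj, ← S.f_inner, ← integral_neg]
    refine setIntegral_congr_fun measurableSet_Iic fun x hx => ?_
    rcases lt_or_eq_of_le (show x ≤ 0 from hx) with h | h
    · simp only [S.abs_eq_of_neg h]; ring
    · simp [h, S.p_zero]
  rw [e1, e2]
  intro h
  exact S.f_half (by linarith)

/-- Coercivity of the form on functions with three zeros. -/
lemma exists_gap : ∃ l > 0, ∃ δ > 0, ∀ u, MemH1 u → u 0 = 0 → u l = 0 → u (-l) = 0 →
    (δ * ∫ x, u x ^ 2) ≤ schForm W u u := by
  have hK := S.pot.nonneg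
  -- Short enough for the Poincaré inequality on [-l,0] and [0,l], since (K+1) l² = 1/(K+1) ≤ 1.
  set l : ℝ := 1 / (K + 1) with hl
  have hl0 : 0 < l := by positivity
  have hKl : (K + 1) * l ^ 2 ≤ 1 := by
    rw [hl]; field_simp; linarith
  obtain ⟨δ₁, hδ₁, a₁, ha₁, ⟨K₁, hK₁⟩, hb₁⟩ := S.gap_right l hl0
  obtain ⟨δ₂, hδ₂, a₂, ha₂, ⟨K₂, hK₂⟩, hb₂⟩ := S.gap_left (-l) (by linarith)
  refine ⟨l, hl0, min 1 (min δ₁ δ₂), by positivity, fun u hu h0 h1 h2 => ?_⟩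
  have d1 : min 1 (min δ₁ δ₂) ≤ 1 := min_le_left _ _
  have d2 : min 1 (min δ₁ δ₂) ≤ δ₁ := (min_le_right _ _).trans (min_le_left _ _)
  have d3 : min 1 (min δ₁ δ₂) ≤ δ₂ := (min_le_right _ _).trans (min_le_right _ _)
  set δ := min 1 (min δ₁ δ₂)
  have split : ∀ g : ℝ → ℝ, Integrable g → ∫ x, g x = (∫ x in Iic (-l), g x)
      + (∫ x in (-l)..0, g x) + (∫ x in (0 : ℝ)..l, g x) + ∫ x in Ioi l, g x := by
    intro g hg
    have e1 := intervalIntegral.integral_Iic_add_Ioi (b := l) hg.integrableOn hg.integrableOn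
    have e2 := intervalIntegral.integral_Iic_sub_Iic (a := -l) (b := l) (f := g) (μ := volume)
      hg.integrableOn hg.integrableOn
    have e3 := intervalIntegral.integral_add_adjacent_intervals (μ := volume) (f := g) (a := -l)
      (b := 0) (c := l) hg.intervalIntegrable hg.intervalIntegrable
    linarith
  have n : ∀ s : Set ℝ, 0 ≤ ∫ x in s, u x ^ 2 := fun s => integral_nonneg fun x => sq_nonneg _
  have n1 : 0 ≤ ∫ x in (-l)..0, u x ^ 2 :=
    intervalIntegral.integral_nonneg (by linarith) fun x _ => sq_nonneg _
  have n2 : 0 ≤ ∫ x in (0 : ℝ)..l, u x ^ 2 :=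
    intervalIntegral.integral_nonneg (by linarith) fun x _ => sq_nonneg _
  rw [schForm, split _ hu.2.1.integrable_sq, split _ (S.pot.integrable_form hu hu)]
  have i1 := riccati_Ioi S.pot hu hl0 ha₁ hK₁ hb₁ h1
  have i2 := riccati_Iic S.pot hu (by linarith) ha₂ hK₂ hb₂ h2
  have i3 := poincare_interval S.pot hu (l := 0) (r := l) hl0.le h0 (by simpa using hKl)
  have i4 := poincare_interval S.pot hu (l := -l) (r := 0) (by linarith) h2 (by simpa using hKl)
  have j1 := mul_le_mul_of_nonneg_right d2 (n (Ioi l))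
  have j2 := mul_le_mul_of_nonneg_right d3 (n (Iic (-l)))
  have j3 := mul_le_mul_of_nonneg_right d1 n1
  have j4 := mul_le_mul_of_nonneg_right d1 n2
  linarith

end SpectralData

lemma inner2_add_right {f g h : ℝ → ℝ} (hf : MemLp f 2 volume) (hg : MemLp g 2 volume)
    (hh : MemLp h 2 volume) : inner2 f (fun x => g x + h x) = inner2 f g + inner2 f h := by
  rw [inner2, inner2, inner2,
    ← integral_add (integrable_mul_of_memLp hf hg) (integrable_mul_of_memLp hf hh)]
  congr 1; funext x; ring

lemma inner2_const_mul_right (r : ℝ) (f g : ℝ → ℝ) :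
    inner2 f (fun x => r * g x) = r * inner2 f g := by
  rw [inner2, inner2, ← integral_const_mul]
  congr 1; funext x; ring

lemma inner2_sq_le {f g : ℝ → ℝ} (hf : MemLp f 2 volume) (hg : MemLp g 2 volume) :
    inner2 f g ^ 2 ≤ (∫ x, f x ^ 2) * ∫ x, g x ^ 2 := integral_mul_sq_le hf hg

lemma MemH1.h1Norm_sq_eq {σ : ℝ → ℝ} (hσ : MemH1 σ) :
    h1Norm σ ^ 2 = (∫ x, σ x ^ 2) + ∫ x, deriv σ x ^ 2 := by
  rw [h1Norm_sq, integral_add hσ.2.1.integrable_sq hσ.2.2.integrable_sq]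

lemma MemH1.eq_zero_of_h1Norm {σ : ℝ → ℝ} (hσ : MemH1 σ) (h : h1Norm σ = 0) (x : ℝ) :
    σ x = 0 := abs_nonpos_iff.1 ((hσ.abs_le x).trans h.le)

/-- A Gårding inequality, from W ≥ -K: once the form controls the L² norm it controls the H¹ norm.
-/
lemma BddPotential.h1Norm_sq_le {W σ : ℝ → ℝ} {K : ℝ} (hW : BddPotential W K) (hσ : MemH1 σ) :
    h1Norm σ ^ 2 ≤ schForm W σ σ + (K + 1) * ∫ x, σ x ^ 2 := by
  rw [hσ.h1Norm_sq_eq, schForm, integral_add (integrable_mul_of_memLp hσ.2.2 hσ.2.2)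
    (hW.integrable_mul hσ.2.1 hσ.2.1)]
  have h : -(K * ∫ x, σ x ^ 2) ≤ ∫ x, W x * (σ x * σ x) := by
    rw [← integral_const_mul, ← integral_neg]
    refine integral_mono (hσ.2.1.integrable_sq.const_mul K).neg
      (hW.integrable_mul hσ.2.1 hσ.2.1) fun x => ?_
    have := (abs_le.1 (hW.bdd x)).1
    simp only
    nlinarith [sq_nonneg (σ x)]
  have h2 : ∫ x, deriv σ x * deriv σ x = ∫ x, deriv σ x ^ 2 := by
    congr 1; funext x; ring
  rw [h2]; linarith

lemma sq_add_two_le (a b : ℝ) : (a + b) ^ 2 ≤ 2 * (a ^ 2 + b ^ 2) := by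
  nlinarith [sq_nonneg (a - b)]

lemma sq_add_three_le (a b c : ℝ) : (a + b + c) ^ 2 ≤ 3 * (a ^ 2 + b ^ 2 + c ^ 2) := by
  nlinarith [sq_nonneg (a - b), sq_nonneg (a - c), sq_nonneg (b - c)]

lemma sq_add_four_le (a b c d : ℝ) :
    (a + (b + (c + d))) ^ 2 ≤ 4 * (a ^ 2 + b ^ 2 + c ^ 2 + d ^ 2) := by
  nlinarith [sq_nonneg (a - b), sq_nonneg (a - c), sq_nonneg (a - d), sq_nonneg (b - c),
    sq_nonneg (b - d), sq_nonneg (c - d)]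

namespace SpectralData
variable {W p ζ f ϖ : ℝ → ℝ} {K : ℝ} (S : SpectralData W p ζ f ϖ K) {σ u : ℝ → ℝ}
include S

/-- The part without ζ has the form of u alone: p is in the kernel, while |p| is isotropic and
orthogonal to u for the form. The cross terms with ζ are pairings with f, by the equation of ζ. -/
lemma form_expand (hu : MemH1 u) (hu0 : u 0 = 0) {s α β : ℝ}
    (hσ : σ = fun x => s * ζ x + (α * p x + (β * |p x| + u x))) :
    schForm W σ σ = 2 * s * inner2 f σ - s ^ 2 * inner2 f ζ + schForm W u u := by
  have ha := S.memH1_abs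
  have m1 : MemH1 (fun x => β * |p x| + u x) := (ha.const_mul β).add hu
  have m2 : MemH1 (fun x => α * p x + (β * |p x| + u x)) := (S.p_mem.const_mul α).add m1
  have mζ := S.ζ_mem.const_mul s
  set σ₀ := fun x => α * p x + (β * |p x| + u x) with hσ₀
  have mσ : MemH1 σ := by rw [hσ]; exact mζ.add m2
  have e0 : ∀ τ, MemH1 τ → schForm W σ₀ τ = β * schForm W (fun x => |p x|) τ + schForm W u τ := by
    intro τ hτ
    rw [hσ₀, S.pot.form_add (S.p_mem.const_mul α) m1 hτ, S.pot.form_add (ha.const_mul β) hu hτ,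
      schForm_const_mul, schForm_const_mul, S.form_p hτ]
    ring
  have e1 : schForm W (fun x => |p x|) σ₀ = 0 := by
    rw [schForm_comm, e0 _ ha, S.form_abs_abs, schForm_comm, S.form_abs hu hu0]; ring
  have e2 : schForm W σ₀ σ₀ = schForm W u u := by
    rw [e0 _ m2, e1, schForm_comm, e0 _ hu, S.form_abs hu hu0]; ring
  have e3 : ∀ τ, MemH1 τ → schForm W σ τ = s * inner2 f τ + schForm W σ₀ τ := by
    intro τ hτ
    rw [hσ, S.pot.form_add mζ m2 hτ, schForm_const_mul, S.form_ζ hτ]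
  have e4 : inner2 f σ = s * inner2 f ζ + inner2 f σ₀ := by
    rw [hσ, inner2_add_right S.f_mem mζ.2.1 m2.2.1, inner2_const_mul_right]
  rw [e3 σ mσ, schForm_comm, e3 σ₀ m2, e2]
  linear_combination (-s) * e4

/-- The conditions on u form a triangular system. Since p(0) = 0, the value at 0 determines s. At l
one has |p| = p and at -l one has |p| = -p, so the values there determine α + β and α - β. -/
lemma exists_decomp {l : ℝ} (hl : 0 < l) (hσ : MemH1 σ) : ∃ s α β : ℝ, ∃ u, MemH1 u ∧ u 0 = 0 ∧
    u l = 0 ∧ u (-l) = 0 ∧ σ = fun x => s * ζ x + (α * p x + (β * |p x| + u x)) := by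
  have hp := S.p_pos l hl
  have hn := S.p_neg (-l) (by linarith)
  set s := σ 0 / ζ 0 with hs
  set A := (σ l - s * ζ l) / p l with hA
  set B := (σ (-l) - s * ζ (-l)) / p (-l) with hB
  refine ⟨s, (A + B) / 2, (A - B) / 2, fun x => σ x + (-s * ζ x + (-((A + B) / 2) * p x +
    -((A - B) / 2) * |p x|)), ?_, ?_, ?_, ?_, ?_⟩
  · exact hσ.add ((S.ζ_mem.const_mul _).add ((S.p_mem.const_mul _).add (S.memH1_abs.const_mul _)))
  · have := S.ζ_zero
    simp only [S.p_zero, hs]; field_simp; simp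
  · have h1 : σ l - s * ζ l = A * p l := by rw [hA]; field_simp
    simp only [abs_of_pos hp]; linear_combination h1
  · have h1 : σ (-l) - s * ζ (-l) = B * p (-l) := by rw [hB]; field_simp [hn.ne]
    simp only [abs_of_neg hn]; linear_combination h1
  · funext x; ring

/-- On the constraint the expansion leaves -s²⟨f,ζ⟩ plus the form of u, both nonnegative. -/
lemma form_nonneg (hN : inner2 f ζ ≤ 0) (hσ : MemH1 σ) (h0 : inner2 f σ = 0) :
    0 ≤ schForm W σ σ := by
  obtain ⟨l, hl, δ, hδ, hgap⟩ := S.exists_gap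
  obtain ⟨s, α, β, u, hu, u0, u1, u2, rfl⟩ := S.exists_decomp hl hσ
  rw [S.form_expand hu u0 rfl, h0]
  have h1 := hgap u hu u0 u1 u2
  have h2 : 0 ≤ δ * ∫ x, u x ^ 2 := mul_nonneg hδ.le (integral_nonneg fun x => sq_nonneg _)
  nlinarith [sq_nonneg s]

lemma memLp_ϖp : MemLp (fun x => ϖ x * p x) 2 volume := by
  obtain ⟨C, hC⟩ := S.ϖ_bdd
  exact memLp_mul_bdd S.p_mem.2.1 S.ϖ_cont.aestronglyMeasurable hC

lemma inner_ϖp_p : 0 < inner2 (fun x => ϖ x * p x) p := by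
  have hI := integrable_mul_of_memLp S.memLp_ϖp S.p_mem.2.1
  rw [inner2]
  have hc : Continuous (fun x => ϖ x * p x * p x) :=
    (S.ϖ_cont.mul S.p_mem.continuous).mul S.p_mem.continuous
  have hnn : ∀ x, 0 ≤ ϖ x * p x * p x := fun x => by
    rw [mul_assoc]; exact mul_nonneg (S.ϖ_pos x).le (mul_self_nonneg _)
  refine integral_pos_of_integrable_nonneg_nonzero (x := 1) hc hI hnn ?_
  have h1 := S.p_pos 1 one_pos
  have h2 := S.ϖ_pos 1
  positivity

/-- The form controls s and u directly. The two orthogonality conditions then determine β and α: the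
first because ⟨f,p⟩ = 0 and ⟨f,|p|⟩ ≠ 0, the second because ⟨ϖp,p⟩ > 0. -/
lemma coercive (hN : inner2 f ζ < 0) : ∃ C > 0, ∀ σ, MemH1 σ → inner2 f σ = 0 →
    inner2 (fun x => ϖ x * p x) σ = 0 → C * h1Norm σ ^ 2 ≤ schForm W σ σ := by
  obtain ⟨l, hl, δ, hδ, hgap⟩ := S.exists_gap
  set N := inner2 f ζ with hNdef
  set J := inner2 f (fun x => |p x|) with hJ
  set P := inner2 (fun x => ϖ x * p x) p with hP
  set Z := inner2 (fun x => ϖ x * p x) ζ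
  set R := inner2 (fun x => ϖ x * p x) (fun x => |p x|)
  set F₂ := ∫ x, f x ^ 2
  set G₂ := ∫ x, (ϖ x * p x) ^ 2
  set Zz := ∫ x, ζ x ^ 2
  set Pp := ∫ x, p x ^ 2
  have hP0 : 0 < P := S.inner_ϖp_p
  have hJ0 : J ≠ 0 := S.inner_f_abs
  have hF₂ : 0 ≤ F₂ := integral_nonneg fun x => sq_nonneg _
  have hG₂ : 0 ≤ G₂ := integral_nonneg fun x => sq_nonneg _
  have hZz : 0 ≤ Zz := integral_nonneg fun x => sq_nonneg _
  have hPp : 0 ≤ Pp := integral_nonneg fun x => sq_nonneg _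
  have hK := S.pot.nonneg
  -- With E the form of σ, the constants `cs`, `cu`, `cb`, `ca` bound s², ∫ u², β² and α² by
  -- multiples of E, in this order; `ct` then bounds ∫ σ².
  set cs := 1 / (-N) with hcs
  set cu := 1 / δ with hcu
  set cb := (2 * N ^ 2 * cs + 2 * F₂ * cu) / J ^ 2 with hcb
  set ca := 3 * (Z ^ 2 * cs + R ^ 2 * cb + G₂ * cu) / P ^ 2 with hca
  have hcs0 : 0 < cs := by rw [hcs]; exact one_div_pos.2 (by linarith)
  have hcu0 : 0 < cu := one_div_pos.2 hδ
  have hJ2 : 0 < J ^ 2 := by positivity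
  have hcb0 : 0 ≤ cb := by positivity
  have hca0 : 0 ≤ ca := by positivity
  set ct := 4 * (cs * Zz + ca * Pp + cb * Pp + cu) with hct
  have hct0 : 0 ≤ ct := by positivity
  refine ⟨1 / (1 + (K + 1) * ct), by positivity, fun σ hσ h1 h2 => ?_⟩
  have hsq := S.pot.h1Norm_sq_le hσ
  obtain ⟨s, α, β, u, hu, u0, u1, u2, hdec⟩ := S.exists_decomp hl hσ
  have hE := S.form_expand hu u0 hdec
  rw [h1] at hE
  set E := schForm W σ σ
  set U := ∫ x, u x ^ 2 with hU
  have hU0 : 0 ≤ U := integral_nonneg fun x => sq_nonneg _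
  have hEge : (-N) * s ^ 2 + δ * U ≤ E := by
    have := hgap u hu u0 u1 u2
    rw [hE]; linarith
  have hNs : 0 ≤ (-N) * s ^ 2 := mul_nonneg (by linarith) (sq_nonneg _)
  have hδU : 0 ≤ δ * U := mul_nonneg hδ.le hU0
  have bs : s ^ 2 ≤ cs * E := by
    rw [hcs, one_div_mul_eq_div, le_div_iff₀ (by linarith)]
    linarith
  have bu : U ≤ cu * E := by
    rw [hcu, one_div_mul_eq_div, le_div_iff₀ hδ]
    linarith
  have hE0 : 0 ≤ E := by linarith
  have ha := S.memH1_abs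
  have m1 : MemH1 (fun x => β * |p x| + u x) := (ha.const_mul β).add hu
  have m2 : MemH1 (fun x => α * p x + (β * |p x| + u x)) := (S.p_mem.const_mul α).add m1
  have mζ := S.ζ_mem.const_mul s
  have expand : ∀ g, MemLp g 2 volume → inner2 g σ = s * inner2 g ζ + α * inner2 g p
      + β * inner2 g (fun x => |p x|) + inner2 g u := by
    intro g hg
    rw [hdec, inner2_add_right hg mζ.2.1 m2.2.1,
      inner2_add_right hg (S.p_mem.const_mul α).2.1 m1.2.1,
      inner2_add_right hg (ha.const_mul β).2.1 hu.2.1, inner2_const_mul_right,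
      inner2_const_mul_right, inner2_const_mul_right]
    ring
  have x1 := expand f S.f_mem
  have x2 := expand _ S.memLp_ϖp
  rw [h1, S.inner_f_p] at x1
  rw [h2] at x2
  have y1 : inner2 f u ^ 2 ≤ F₂ * U := inner2_sq_le S.f_mem hu.2.1
  have y2 : inner2 (fun x => ϖ x * p x) u ^ 2 ≤ G₂ * U := inner2_sq_le S.memLp_ϖp hu.2.1
  have bb : β ^ 2 ≤ cb * E := by
    rw [hcb, div_mul_eq_mul_div, le_div_iff₀ hJ2]
    have e : β * J = -(s * N) - inner2 f u := by linarith
    have e2 : β ^ 2 * J ^ 2 = (-(s * N) - inner2 f u) ^ 2 := by rw [← e]; ring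
    have e3 : (-(s * N) - inner2 f u) ^ 2 ≤ 2 * N ^ 2 * s ^ 2 + 2 * (F₂ * U) := by
      linarith [sq_add_two_le (-(s * N)) (-inner2 f u)]
    have e4 : N ^ 2 * s ^ 2 ≤ N ^ 2 * (cs * E) := mul_le_mul_of_nonneg_left bs (sq_nonneg _)
    have e5 : F₂ * U ≤ F₂ * (cu * E) := mul_le_mul_of_nonneg_left bu hF₂
    rw [e2]; linarith
  have ba : α ^ 2 ≤ ca * E := by
    rw [hca, div_mul_eq_mul_div, le_div_iff₀ (by positivity)]
    have e : α * P = -(s * Z) - β * R - inner2 (fun x => ϖ x * p x) u := by linarith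
    have e2 : α ^ 2 * P ^ 2 = (-(s * Z) - β * R - inner2 (fun x => ϖ x * p x) u) ^ 2 := by
      rw [← e]; ring
    have e3 : (-(s * Z) - β * R - inner2 (fun x => ϖ x * p x) u) ^ 2
        ≤ 3 * (Z ^ 2 * s ^ 2 + R ^ 2 * β ^ 2 + G₂ * U) := by
      linarith [sq_add_three_le (-(s * Z)) (-(β * R)) (-inner2 (fun x => ϖ x * p x) u)]
    have e4 : Z ^ 2 * s ^ 2 ≤ Z ^ 2 * (cs * E) := mul_le_mul_of_nonneg_left bs (sq_nonneg _)
    have e5 : G₂ * U ≤ G₂ * (cu * E) := mul_le_mul_of_nonneg_left bu hG₂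
    have e6 : R ^ 2 * β ^ 2 ≤ R ^ 2 * (cb * E) := mul_le_mul_of_nonneg_left bb (sq_nonneg _)
    rw [e2]; linarith
  have bσ : ∫ x, σ x ^ 2 ≤ 4 * (s ^ 2 * Zz + α ^ 2 * Pp + β ^ 2 * Pp + U) := by
    have i1 := S.ζ_mem.2.1.integrable_sq.const_mul (s ^ 2)
    have i2 := S.p_mem.2.1.integrable_sq.const_mul (α ^ 2)
    have i3 := S.p_mem.2.1.integrable_sq.const_mul (β ^ 2)
    have i12 : Integrable (fun x => s ^ 2 * ζ x ^ 2 + α ^ 2 * p x ^ 2) := i1.add i2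
    have i123 : Integrable (fun x => s ^ 2 * ζ x ^ 2 + α ^ 2 * p x ^ 2 + β ^ 2 * p x ^ 2) :=
      i12.add i3
    have i4 : Integrable (fun x => s ^ 2 * ζ x ^ 2 + α ^ 2 * p x ^ 2 + β ^ 2 * p x ^ 2
      + u x ^ 2) := i123.add hu.2.1.integrable_sq
    rw [hU, ← integral_const_mul, ← integral_const_mul, ← integral_const_mul,
      ← integral_add i1 i2, ← integral_add i12 i3, ← integral_add i123 hu.2.1.integrable_sq,
      ← integral_const_mul]
    refine integral_mono hσ.2.1.integrable_sq (i4.const_mul 4) fun x => ?_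
    simp only [hdec]
    have h1 := sq_add_four_le (s * ζ x) (α * p x) (β * |p x|) (u x)
    rw [mul_pow β, sq_abs, mul_pow, mul_pow] at h1
    linarith
  have bσ2 : ∫ x, σ x ^ 2 ≤ ct * E := by
    have e1 := mul_le_mul_of_nonneg_right bs hZz
    have e2 := mul_le_mul_of_nonneg_right ba hPp
    have e3 := mul_le_mul_of_nonneg_right bb hPp
    rw [hct]; linarith
  rw [one_div_mul_eq_div, div_le_iff₀ (by positivity)]
  have := mul_le_mul_of_nonneg_left bσ2 (by linarith : 0 ≤ K + 1)
  linarith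

/-- Removing the `ϖ p` component does not change the form nor the pairing with `f`. -/
lemma exists_shift (hσ : MemH1 σ) : ∃ β : ℝ, MemH1 (fun x => σ x + β * p x) ∧
    inner2 f (fun x => σ x + β * p x) = inner2 f σ ∧
    inner2 (fun x => ϖ x * p x) (fun x => σ x + β * p x) = 0 ∧
    schForm W (fun x => σ x + β * p x) (fun x => σ x + β * p x) = schForm W σ σ := by
  have hP := S.inner_ϖp_p
  set β := -inner2 (fun x => ϖ x * p x) σ / inner2 (fun x => ϖ x * p x) p
  have hp := S.p_mem.const_mul β
  have hm := hσ.add hp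
  refine ⟨β, hm, ?_, ?_, ?_⟩
  · rw [inner2_add_right S.f_mem hσ.2.1 hp.2.1, inner2_const_mul_right, S.inner_f_p]; ring
  · rw [inner2_add_right S.memLp_ϖp hσ.2.1 hp.2.1, inner2_const_mul_right]
    simp only [β]; field_simp; ring
  · rw [S.pot.form_add hσ hp hm, schForm_const_mul, S.form_p hm, schForm_comm,
      S.pot.form_add hσ hp hσ, schForm_const_mul, S.form_p hσ]; ring

lemma eq_mul_p (hN : inner2 f ζ < 0) (hσ : MemH1 σ) (h0 : inner2 f σ = 0)
    (hB : schForm W σ σ = 0) : ∃ s, ∀ x, σ x = s * p x := by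
  obtain ⟨β, hm, h1, h2, h3⟩ := S.exists_shift hσ
  obtain ⟨C, hC, hco⟩ := S.coercive hN
  have h4 := hco _ hm (h1.trans h0) h2
  rw [h3, hB] at h4
  have h5 : h1Norm (fun x => σ x + β * p x) = 0 := by
    have : h1Norm (fun x => σ x + β * p x) ^ 2 ≤ 0 := by
      by_contra hcon
      push Not at hcon
      have := mul_pos hC hcon
      linarith
    exact pow_eq_zero_iff (two_ne_zero) |>.1 (le_antisymm this (sq_nonneg _))
  exact ⟨-β, fun x => by have := hm.eq_zero_of_h1Norm h5 x; linarith⟩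

/-- The combination sζ + |p| with s = -⟨f,|p|⟩/⟨f,ζ⟩ satisfies the constraint, and its form is
-s²⟨f,ζ⟩ with s ≠ 0. A multiple of p is added to meet the second orthogonality. -/
lemma exists_neg (hN : 0 < inner2 f ζ) : ∃ σ, MemH1 σ ∧ inner2 f σ = 0 ∧
    inner2 (fun x => ϖ x * p x) σ = 0 ∧ schForm W σ σ < 0 := by
  have hJ0 := S.inner_f_abs
  set N := inner2 f ζ with hNdef
  set J := inner2 f (fun x => |p x|) with hJ
  set s := -J / N with hs
  have hz : MemH1 (fun _ : ℝ => (0 : ℝ)) := by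
    simpa using S.p_mem.const_mul 0
  have hσ : MemH1 (fun x => s * ζ x + |p x|) := (S.ζ_mem.const_mul s).add S.memH1_abs
  have h1 : inner2 f (fun x => s * ζ x + |p x|) = 0 := by
    rw [inner2_add_right S.f_mem (S.ζ_mem.const_mul s).2.1 S.memH1_abs.2.1,
      inner2_const_mul_right, ← hJ, ← hNdef, hs]
    field_simp; ring
  have h2 : schForm W (fun x => s * ζ x + |p x|) (fun x => s * ζ x + |p x|) < 0 := by
    rw [S.form_expand (s := s) (α := 0) (β := 1) hz rfl (by funext x; ring), h1]
    have : schForm W (fun _ => 0) (fun _ => 0) = 0 := by simp [schForm]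
    rw [this]
    have hs2 : 0 < s ^ 2 := by
      have : s ≠ 0 := by rw [hs]; exact div_ne_zero (neg_ne_zero.2 hJ0) hN.ne'
      positivity
    nlinarith
  obtain ⟨β, hm, e1, e2, e3⟩ := S.exists_shift hσ
  exact ⟨_, hm, e1.trans h1, e2, e3.trans_lt h2⟩

/-- When ⟨f,ζ⟩ = 0 the function ζ is itself admissible and isotropic. Its value at 0, where p
vanishes, distinguishes it from a translation. -/
lemma exists_null (hN : inner2 f ζ = 0) : ∃ σ, MemH1 σ ∧ inner2 f σ = 0 ∧
    inner2 (fun x => ϖ x * p x) σ = 0 ∧ schForm W σ σ = 0 ∧ σ 0 ≠ 0 := by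
  obtain ⟨β, hm, e1, e2, e3⟩ := S.exists_shift S.ζ_mem
  refine ⟨_, hm, e1.trans hN, e2, ?_, ?_⟩
  · rw [e3, S.form_ζ S.ζ_mem, hN]
  · simpa [S.p_zero] using S.ζ_zero

end SpectralData

/-! ### The Taylor remainder quotient R = `rem b` and its derivatives -/

/-- The moments `∫₀¹ (1 - t) t^i (1 - t y)^(-(b+1+i)) dt`. -/
noncomputable def remInt (b : ℝ) (i : ℕ) (y : ℝ) : ℝ :=
  ∫ t in (0 : ℝ)..1, (1 - t) * t ^ i * (1 - t * y) ^ (-(b + 1 + i))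

lemma one_sub_mul_ge {y r t : ℝ} (hy : y ≤ r) (ht : t ∈ Icc (0 : ℝ) 1) :
    min 1 (1 - r) ≤ 1 - t * y := by
  rcases le_total y 0 with h | h
  · exact (min_le_left _ _).trans (by nlinarith [ht.1])
  · exact (min_le_right _ _).trans (by nlinarith [ht.1, ht.2])

lemma one_sub_mul_pos {y t : ℝ} (hy : y < 1) (ht : t ∈ Icc (0 : ℝ) 1) : 0 < 1 - t * y :=
  lt_of_lt_of_le (lt_min one_pos (by linarith)) (one_sub_mul_ge le_rfl ht)

lemma continuousOn_remInt_integrand (i : ℕ) {y : ℝ} (hy : y < 1) (s : ℝ) :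
    ContinuousOn (fun t : ℝ => (1 - t) * t ^ i * (1 - t * y) ^ s) (Icc 0 1) := by
  refine ContinuousOn.mul (by fun_prop) ?_
  exact ContinuousOn.rpow_const (by fun_prop) fun t ht => Or.inl (one_sub_mul_pos hy ht).ne'

lemma hasDerivAt_remInt {b : ℝ} (hb : 1 < b) (i : ℕ) {y : ℝ} (hy : y < 1) :
    HasDerivAt (remInt b i) ((b + 1 + i) * remInt b (i + 1) y) y := by
  set r := (1 + y) / 2 with hr
  have hr1 : r < 1 := by rw [hr]; linarith
  have hyr : y < r := by rw [hr]; linarith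
  -- A lower bound of 1 - t y for all y ≤ r and t in [0,1]; the 1 covers negative y.
  set m := min 1 (1 - r) with hm
  have hm0 : 0 < m := lt_min one_pos (by linarith)
  have hu : uIoc (0 : ℝ) 1 ⊆ Icc 0 1 := by
    rw [uIoc_of_le zero_le_one]; exact Ioc_subset_Icc_self
  have key := (intervalIntegral.hasDerivAt_integral_of_dominated_loc_of_deriv_le
    (μ := volume) (a := 0) (b := 1) (x₀ := y) (s := Iio r)
    (F := fun y t => (1 - t) * t ^ i * (1 - t * y) ^ (-(b + 1 + i)))
    (F' := fun y t => (b + 1 + i) * ((1 - t) * t ^ (i + 1) * (1 - t * y) ^ (-(b + 1 + (i + 1)))))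
    (bound := fun _ => (b + 1 + i) * m ^ (-(b + 1 + (i + 1)))) (Iio_mem_nhds hyr) ?_ ?_ ?_ ?_ ?_ ?_).2
  · have e : ∫ t in (0 : ℝ)..1, (b + 1 + i) * ((1 - t) * t ^ (i + 1) *
        (1 - t * y) ^ (-(b + 1 + (i + 1)))) = (b + 1 + i) * remInt b (i + 1) y := by
      rw [intervalIntegral.integral_const_mul, remInt]; push_cast; rfl
    rw [e] at key
    exact key
  · filter_upwards [Iio_mem_nhds hy] with z hz
    exact ((continuousOn_remInt_integrand i hz _).mono hu).aestronglyMeasurable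
      measurableSet_uIoc
  · exact ((continuousOn_remInt_integrand i hy _).mono
      (by rw [uIcc_of_le zero_le_one])).intervalIntegrable
  · exact (((continuousOn_remInt_integrand (i + 1) hy _).mono hu).aestronglyMeasurable
      measurableSet_uIoc).const_mul _
  · refine Eventually.of_forall fun t ht z hz => ?_
    have ht' := hu ht
    have h1 := one_sub_mul_ge (le_of_lt hz) ht'
    have h2 : (1 - t * z) ^ (-(b + 1 + ((i : ℝ) + 1))) ≤ m ^ (-(b + 1 + ((i : ℝ) + 1))) :=
      Real.rpow_le_rpow_of_nonpos hm0 h1 (by have : (0 : ℝ) ≤ i := i.cast_nonneg; linarith)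
    have h3 : 0 ≤ (1 - t * z) ^ (-(b + 1 + ((i : ℝ) + 1))) :=
      Real.rpow_nonneg (hm0.le.trans h1) _
    have h4 : 0 ≤ (1 - t) * t ^ (i + 1) := mul_nonneg (by linarith [ht'.2]) (pow_nonneg ht'.1 _)
    have h5 : (1 - t) * t ^ (i + 1) ≤ 1 :=
      mul_le_one₀ (by linarith [ht'.1]) (pow_nonneg ht'.1 _) (pow_le_one₀ ht'.1 ht'.2)
    have h6 : (0 : ℝ) ≤ b + 1 + i := by positivity
    rw [Real.norm_of_nonneg (by positivity)]
    refine mul_le_mul_of_nonneg_left ?_ h6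
    calc _ ≤ 1 * (1 - t * z) ^ (-(b + 1 + ((i : ℝ) + 1))) := mul_le_mul_of_nonneg_right h5 h3
      _ ≤ _ := by rw [one_mul]; exact h2
  · exact intervalIntegrable_const
  · refine Eventually.of_forall fun t ht z hz => ?_
    have ht' := hu ht
    have h1 := one_sub_mul_pos (hz.trans hr1) ht'
    have hd : HasDerivAt (fun z : ℝ => 1 - t * z) (-t) z := by
      simpa using ((hasDerivAt_id z).const_mul t).const_sub 1
    have h2 := (hd.rpow_const (p := -(b + 1 + (i : ℝ))) (Or.inl h1.ne')).const_mul
      ((1 - t) * t ^ i)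
    refine h2.congr_deriv ?_
    rw [show -(b + 1 + ((i : ℝ) + 1)) = -(b + 1 + (i : ℝ)) - 1 by ring]
    ring

lemma remInt_pos {b : ℝ} (i : ℕ) {y : ℝ} (hy : y < 1) : 0 < remInt b i y := by
  refine intervalIntegral.intervalIntegral_pos_of_pos_on ?_ ?_ one_pos
  · exact ((continuousOn_remInt_integrand i hy _).mono
      (by rw [uIcc_of_le zero_le_one])).intervalIntegrable
  · intro t ht
    have h1 := one_sub_mul_pos hy (Ioo_subset_Icc_self ht)
    have h2 : 0 < 1 - t := by linarith [ht.2]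
    have h3 := ht.1
    positivity

/-- The remainder quotient `R(y) = 2 [((1 - y)^(1-b) - 1)/(b - 1) - y] / y²`. -/
noncomputable def rem (b y : ℝ) : ℝ := 2 * b * remInt b 0 y
/-- The derivative of `rem`. -/
noncomputable def rem1 (b y : ℝ) : ℝ := 2 * b * (b + 1) * remInt b 1 y
/-- The second derivative of `rem`. -/
noncomputable def rem2 (b y : ℝ) : ℝ := 2 * b * (b + 1) * (b + 2) * remInt b 2 y

section
variable {b : ℝ} (hb : 1 < b)
include hb

lemma hasDerivAt_rem {y : ℝ} (hy : y < 1) : HasDerivAt (rem b) (rem1 b y) y := by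
  refine ((hasDerivAt_remInt hb 0 hy).const_mul (2 * b)).congr_deriv ?_
  rw [rem1]; push_cast; ring

lemma hasDerivAt_rem1 {y : ℝ} (hy : y < 1) : HasDerivAt (rem1 b) (rem2 b y) y := by
  refine ((hasDerivAt_remInt hb 1 hy).const_mul (2 * b * (b + 1))).congr_deriv ?_
  rw [rem2]; push_cast; ring

lemma continuousOn_rem2 : ContinuousOn (rem2 b) (Iio 1) := fun _ hy =>
  ((hasDerivAt_remInt hb 2 hy).const_mul (2 * b * (b + 1) * (b + 2))).continuousAt.continuousWithinAt

lemma rem_pos {y : ℝ} (hy : y < 1) : 0 < rem b y := by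
  have := remInt_pos (b := b) 0 hy
  rw [rem]; positivity

lemma rem1_pos {y : ℝ} (hy : y < 1) : 0 < rem1 b y := by
  have := remInt_pos (b := b) 1 hy
  rw [rem1]; positivity

omit hb in
lemma rem_zero : rem b 0 = b := by
  have h : ∫ t in (0 : ℝ)..1, ((1 : ℝ) - t) = 1 / 2 := by
    rw [intervalIntegral.integral_sub (by simp) (by simp)]; simp; norm_num
  simp only [rem, remInt, pow_zero, mul_one, mul_zero, sub_zero, Real.one_rpow, h]
  ring

lemma continuousOn_rem : ContinuousOn (rem b) (Iio 1) := fun _ hy =>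
  (hasDerivAt_rem hb hy).continuousAt.continuousWithinAt

lemma continuousOn_rem1 : ContinuousOn (rem1 b) (Iio 1) := fun _ hy =>
  (hasDerivAt_rem1 hb hy).continuousAt.continuousWithinAt

lemma strictMonoOn_rem : StrictMonoOn (rem b) (Iio 1) := by
  refine strictMonoOn_of_deriv_pos (convex_Iio 1) (continuousOn_rem hb) fun y hy => ?_
  rw [interior_Iio] at hy
  rw [(hasDerivAt_rem hb hy).deriv]
  exact rem1_pos hb hy

/-- Taylor's formula at the origin for `(1 - y)^(1-b)/(b - 1)`. -/
lemma sq_mul_rem {y : ℝ} (hy : y < 1) :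
    y ^ 2 * rem b y = 2 * (((1 - y) ^ (1 - b) - 1) / (b - 1) - y) := by
  have hb1 : b - 1 ≠ 0 := by linarith
  -- The antiderivative in t comes from one integration by parts.
  have h := intervalIntegral.integral_eq_sub_of_hasDerivAt (a := 0) (b := 1)
    (f := fun t => (1 - t) * (y * (1 - t * y) ^ (-b)) + (1 - t * y) ^ (1 - b) / (b - 1))
    (f' := fun t => b * y ^ 2 * ((1 - t) * t ^ 0 * (1 - t * y) ^ (-(b + 1 + (0 : ℕ))))) ?_ ?_
  · rw [intervalIntegral.integral_const_mul] at h
    change b * y ^ 2 * remInt b 0 y = _ at h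
    rw [rem]
    simp only [zero_mul, sub_zero, sub_self, one_mul, Real.one_rpow] at h
    linear_combination 2 * h
  · intro t ht
    rw [uIcc_of_le zero_le_one] at ht
    have h1 := one_sub_mul_pos hy ht
    have hd : HasDerivAt (fun t : ℝ => 1 - t * y) (-y) t := by
      simpa using ((hasDerivAt_id t).mul_const y).const_sub 1
    have h2 := (hd.rpow_const (p := -b) (Or.inl h1.ne')).const_mul y
    have h3 := (hd.rpow_const (p := 1 - b) (Or.inl h1.ne')).div_const (b - 1)
    have h4 : HasDerivAt (fun t : ℝ => 1 - t) (-1) t := by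
      simpa using (hasDerivAt_id t).const_sub 1
    refine ((h4.mul h2).add h3).congr_deriv ?_
    rw [show -b - 1 = -(b + 1 + (0 : ℕ)) by push_cast; ring,
      show 1 - b - 1 = -b by ring, pow_zero]
    field_simp
    ring
  · have := ((continuousOn_remInt_integrand 0 hy (-(b + 1 + (0 : ℕ)))).mono
      (by rw [uIcc_of_le zero_le_one])).intervalIntegrable (μ := volume) (a := 0) (b := 1)
    exact this.const_mul _

/-- The derivative of Taylor's formula. It identifies the force (1-y)^(-b) - 1 of the wave equation
with half the derivative of y² R(y), which gives the first integral. -/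
lemma two_mul_rem_add {y : ℝ} (hy : y < 1) :
    2 * y * rem b y + y ^ 2 * rem1 b y = 2 * ((1 - y) ^ (-b) - 1) := by
  have hb1 : b - 1 ≠ 0 := by linarith
  have hd : HasDerivAt (fun y : ℝ => 1 - y) (-1) y := by
    simpa using (hasDerivAt_id y).const_sub 1
  have h1 := ((hasDerivAt_id y).pow 2).mul (hasDerivAt_rem hb hy)
  have h2 := ((((hd.rpow_const (p := 1 - b) (Or.inl (by linarith : 1 - y ≠ 0))).sub_const
    1).div_const (b - 1)).sub (hasDerivAt_id y)).const_mul 2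
  have h3 : (fun y => 2 * (((1 - y) ^ (1 - b) - 1) / (b - 1) - y)) =ᶠ[𝓝 y]
      fun y => y ^ 2 * rem b y := by
    filter_upwards [Iio_mem_nhds hy] with z hz using (sq_mul_rem hb hz).symm
  have h4 := h1.unique (h2.congr_of_eventuallyEq h3.symm)
  rw [show 1 - b - 1 = -b by ring] at h4
  simp only [id] at h4
  have h5 : -1 * (1 - b) * (1 - y) ^ (-b) / (b - 1) = (1 - y) ^ (-b) := by field_simp; ring
  rw [h5] at h4
  simp at h4
  linarith

end

/-! ### Exponentially decaying functions -/

/-- Exponential decay at `±∞`. -/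
def ExpDecay (g : ℝ → ℝ) : Prop := ∃ C > 0, ∃ ν > 0, ∀ x, |g x| ≤ C * Real.exp (-ν * |x|)

lemma ExpDecay.of_le {g h : ℝ → ℝ} (hg : ExpDecay g) {C : ℝ} (hC : ∀ x, |h x| ≤ C * |g x|) :
    ExpDecay h := by
  obtain ⟨C', hC', ν, hν, H⟩ := hg
  refine ⟨(|C| + 1) * C', by positivity, ν, hν, fun x => (hC x).trans ?_⟩
  rw [mul_assoc]
  calc C * |g x| ≤ (|C| + 1) * |g x| :=
        mul_le_mul_of_nonneg_right (by linarith [le_abs_self C]) (abs_nonneg _)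
    _ ≤ _ := mul_le_mul_of_nonneg_left (H x) (by positivity)

lemma ExpDecay.mul_bdd {g h : ℝ → ℝ} (hg : ExpDecay g) {C : ℝ} (hC : ∀ x, |h x| ≤ C) :
    ExpDecay (fun x => h x * g x) :=
  hg.of_le (C := C) fun x => by
    rw [abs_mul]; exact mul_le_mul_of_nonneg_right (hC x) (abs_nonneg _)

lemma ExpDecay.add {g h : ℝ → ℝ} (hg : ExpDecay g) (hh : ExpDecay h) :
    ExpDecay (fun x => g x + h x) := by
  obtain ⟨C, hC, ν, hν, H⟩ := hg
  obtain ⟨C', hC', ν', hν', H'⟩ := hh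
  refine ⟨C + C', by positivity, min ν ν', lt_min hν hν', fun x => (abs_add_le _ _).trans ?_⟩
  rw [add_mul]
  refine add_le_add ((H x).trans ?_) ((H' x).trans ?_)
  · refine mul_le_mul_of_nonneg_left (Real.exp_le_exp.2 ?_) hC.le
    nlinarith [min_le_left ν ν', abs_nonneg x]
  · refine mul_le_mul_of_nonneg_left (Real.exp_le_exp.2 ?_) hC'.le
    nlinarith [min_le_right ν ν', abs_nonneg x]

/-- Half of the decay rate pays for the linear growth. This is needed for the phase shift, which
grows at most linearly. -/
lemma ExpDecay.mul_abs {g h : ℝ → ℝ} (hg : ExpDecay g) {C : ℝ} (hC : ∀ x, |h x| ≤ C * |x|) :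
    ExpDecay (fun x => h x * g x) := by
  obtain ⟨C', hC', ν, hν, H⟩ := hg
  refine ⟨(|C| + 1) * C' * (2 / ν), by positivity, ν / 2, by positivity, fun x => ?_⟩
  rw [abs_mul]
  have h1 : |x| ≤ (2 / ν) * Real.exp (ν / 2 * |x|) := by
    have := Real.add_one_le_exp (ν / 2 * |x|)
    rw [div_mul_eq_mul_div, le_div_iff₀ hν]
    nlinarith
  have h2 : Real.exp (ν / 2 * |x|) * Real.exp (-ν * |x|) = Real.exp (-(ν / 2) * |x|) := by
    rw [← Real.exp_add]; congr 1; ring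
  have h3 : |h x| ≤ (|C| + 1) * ((2 / ν) * Real.exp (ν / 2 * |x|)) := by
    refine (hC x).trans ?_
    calc C * |x| ≤ (|C| + 1) * |x| :=
          mul_le_mul_of_nonneg_right (by linarith [le_abs_self C]) (abs_nonneg _)
      _ ≤ _ := mul_le_mul_of_nonneg_left h1 (by positivity)
  calc |h x| * |g x| ≤ (|C| + 1) * ((2 / ν) * Real.exp (ν / 2 * |x|)) * (C' * Real.exp (-ν * |x|)) :=
        mul_le_mul h3 (H x) (abs_nonneg _) (by positivity)
    _ = (|C| + 1) * C' * (2 / ν) * (Real.exp (ν / 2 * |x|) * Real.exp (-ν * |x|)) := by ring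
    _ = _ := by rw [h2]

lemma integrable_exp_neg_mul_abs {ν : ℝ} (hν : 0 < ν) :
    Integrable (fun x : ℝ => Real.exp (-ν * |x|)) := by
  rw [← integrableOn_univ, ← Set.Iic_union_Ioi (a := (0 : ℝ))]
  refine IntegrableOn.union ?_ ?_
  · refine (integrableOn_exp_mul_Iic hν 0).congr_fun (fun x hx => ?_) measurableSet_Iic
    simp only [abs_of_nonpos (show x ≤ 0 from hx)]; congr 1; ring
  · refine (integrableOn_exp_mul_Ioi (neg_lt_zero.2 hν) 0).congr_fun (fun x hx => ?_)
      measurableSet_Ioi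
    simp only [abs_of_pos (show 0 < x from hx)]

lemma ExpDecay.integrable {g : ℝ → ℝ} (hg : ExpDecay g) (hc : Continuous g) : Integrable g := by
  obtain ⟨C, hC, ν, hν, H⟩ := hg
  exact ((integrable_exp_neg_mul_abs hν).const_mul C).mono' hc.aestronglyMeasurable
    (Eventually.of_forall H)

lemma ExpDecay.memLp {g : ℝ → ℝ} (hg : ExpDecay g) (hc : Continuous g) : MemLp g 2 volume := by
  rw [memLp_two_iff_integrable_sq hc.aestronglyMeasurable]
  obtain ⟨C, hC, ν, hν, H⟩ := hg
  refine ExpDecay.integrable (ExpDecay.of_le (g := g) (C := C) ⟨C, hC, ν, hν, H⟩ fun x => ?_)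
    (hc.pow 2)
  rw [abs_pow, sq]
  refine mul_le_mul_of_nonneg_right ((H x).trans ?_) (abs_nonneg _)
  have : Real.exp (-ν * |x|) ≤ 1 := Real.exp_le_one_iff.2 (by nlinarith [abs_nonneg x])
  nlinarith

lemma ExpDecay.tendsto_cocompact {g : ℝ → ℝ} (hg : ExpDecay g) {l : Filter ℝ}
    (hl : Tendsto (fun x : ℝ => |x|) l atTop) : Tendsto g l (𝓝 0) := by
  obtain ⟨C, hC, ν, hν, H⟩ := hg
  refine squeeze_zero_norm H ?_
  have h1 : Tendsto (fun x : ℝ => -ν * |x|) l atBot := hl.const_mul_atTop_of_neg (by linarith)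
  simpa using (Real.tendsto_exp_atBot.comp h1).const_mul C

lemma ExpDecay.tendsto_atTop {g : ℝ → ℝ} (hg : ExpDecay g) : Tendsto g atTop (𝓝 0) :=
  hg.tendsto_cocompact tendsto_abs_atTop_atTop

lemma ExpDecay.tendsto_atBot {g : ℝ → ℝ} (hg : ExpDecay g) : Tendsto g atBot (𝓝 0) :=
  hg.tendsto_cocompact tendsto_abs_atBot_atTop

lemma ExpDecay.memH1 {g : ℝ → ℝ} (hg : ExpDecay g) (hg' : ExpDecay (deriv g))
    (hc : ContDiff ℝ 1 g) : MemH1 g :=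
  memH1_of_contDiff hc (hg.memLp hc.continuous) (hg'.memLp (hc.continuous_deriv le_rfl))

/-! ### From the solitary wave to its normalized profile -/

/-- A convergent function has vanishing limit of the squared derivative. -/
lemma limit_deriv_sq_eq_zero {f : ℝ → ℝ} (hf : Differentiable ℝ f) {l L : ℝ}
    (h : Tendsto f atBot (𝓝 l)) (hL : Tendsto (fun x => deriv f x ^ 2) atBot (𝓝 L)) : L = 0 := by
  have h1 : ∀ y : ℝ, ∃ ξ < y, deriv f ξ = f y - f (y - 1) := by
    intro y
    obtain ⟨ξ, hξ, e⟩ := exists_deriv_eq_slope f (show y - 1 < y by linarith)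
      hf.continuous.continuousOn hf.differentiableOn
    refine ⟨ξ, hξ.2, by rw [e]; simp⟩
  choose ξ hξ e using h1
  have hξt : Tendsto ξ atBot atBot := tendsto_atBot_mono (fun y => (hξ y).le) tendsto_id
  have h2 := hL.comp hξt
  have h3 : Tendsto (fun y => (f y - f (y - 1)) ^ 2) atBot (𝓝 ((l - l) ^ 2)) :=
    (h.sub (h.comp (tendsto_atBot_add_const_right _ (-1) tendsto_id))).pow 2
  rw [sub_self, zero_pow two_ne_zero] at h3
  refine tendsto_nhds_unique (h2.congr fun y => ?_) h3
  simp [e]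

/-- A convergent function has vanishing limit of the second derivative. -/
lemma limit_deriv_deriv_eq_zero {f : ℝ → ℝ} (hf : Differentiable ℝ f)
    (hf' : Differentiable ℝ (deriv f)) {l L : ℝ}
    (h : Tendsto f atBot (𝓝 l)) (hL : Tendsto (deriv (deriv f)) atBot (𝓝 L)) : L = 0 := by
  -- Two mean value steps exhibit the second difference of f as a value of f''; this difference
  -- tends to 0.
  have h1 : ∀ y : ℝ, ∃ ξ < y, deriv (deriv f) ξ = f y - f (y - 1) - (f (y - 1) - f (y - 2)) := by
    intro y
    have hd : ∀ x, HasDerivAt (fun x => f x - f (x - 1)) (deriv f x - deriv f (x - 1)) x := by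
      intro x
      have := (hf (x - 1)).hasDerivAt.comp_sub_const x 1
      exact (hf x).hasDerivAt.sub this
    have hD : Differentiable ℝ (fun x => f x - f (x - 1)) := fun x => (hd x).differentiableAt
    obtain ⟨ξ, hξ, e⟩ := exists_deriv_eq_slope (fun x => f x - f (x - 1))
      (show y - 1 < y by linarith) hD.continuous.continuousOn hD.differentiableOn
    rw [(hd ξ).deriv] at e
    obtain ⟨ξ', hξ', e'⟩ := exists_deriv_eq_slope (deriv f)
      (show ξ - 1 < ξ by linarith) hf'.continuous.continuousOn hf'.differentiableOn
    refine ⟨ξ', hξ'.2.trans hξ.2, ?_⟩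
    rw [e', sub_sub_cancel, div_one, e, sub_sub_cancel, div_one, show y - 1 - 1 = y - 2 by ring]
  choose ξ hξ e using h1
  have hξt : Tendsto ξ atBot atBot := tendsto_atBot_mono (fun y => (hξ y).le) tendsto_id
  have h2 := hL.comp hξt
  have t1 : Tendsto (fun y => f (y - 1)) atBot (𝓝 l) :=
    h.comp (tendsto_atBot_add_const_right _ (-1) tendsto_id)
  have t2 : Tendsto (fun y => f (y - 2)) atBot (𝓝 l) :=
    h.comp (tendsto_atBot_add_const_right _ (-2) tendsto_id)
  have h3 := (h.sub t1).sub (t1.sub t2)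
  rw [sub_self] at h3
  refine tendsto_nhds_unique (h2.congr fun y => ?_) h3
  simp [e]

/-- A function on the line whose derivative is bounded by a multiple of the function vanishes
identically as soon as it has a zero. -/
lemma eq_zero_of_abs_deriv_le {f : ℝ → ℝ} (hf : Differentiable ℝ f) {K : ℝ}
    (h : ∀ x, |deriv f x| ≤ K * |f x|) {x₀ : ℝ} (h0 : f x₀ = 0) (x : ℝ) : f x = 0 := by
  rcases le_total x₀ x with hx | hx
  · exact eq_zero_of_abs_deriv_le_mul_abs_self_of_eq_zero_right (b := x)
      hf.continuous.continuousOn (fun y _ => (hf y).hasDerivAt.hasDerivWithinAt) h0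
      (fun y _ => h y) x ⟨hx, le_rfl⟩
  · have hd : ∀ y, HasDerivAt (fun y => f (-y)) (-deriv f (-y)) y := fun y =>
      ((hf (-y)).hasDerivAt.comp y (hasDerivAt_neg y)).congr_deriv (by ring)
    have := eq_zero_of_abs_deriv_le_mul_abs_self_of_eq_zero_right (f := fun y => f (-y))
      (a := -x₀) (b := -x) (fun y _ => (hd y).continuousAt.continuousWithinAt)
      (fun y _ => (hd y).hasDerivWithinAt) (by simpa using h0)
      (fun y _ => by simpa using h (-y)) (-x) ⟨by linarith, le_rfl⟩
    simpa using this

/-- The normalized profile `ψ = (φ - k)/(c - k)` of a solitary wave, with `κ = k/(c - k)`. -/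
structure Profile (b κ : ℝ) (ψ : ℝ → ℝ) : Prop where
  hb : 1 < b
  κ_pos : 0 < κ
  κ_lt : κ * b < 1
  smooth : ContDiff ℝ ∞ ψ
  lt_one : ∀ x, ψ x < 1
  pos : ∀ x, 0 < ψ x
  ode : ∀ x, deriv (deriv ψ) x = ψ x + κ * (1 - (1 - ψ x) ^ (-b))
  sq : ∀ x, deriv ψ x ^ 2 = ψ x ^ 2 * (1 - κ * rem b (ψ x))
  deriv_zero : deriv ψ 0 = 0
  tendsto_atTop : Tendsto ψ atTop (𝓝 0)
  tendsto_atBot : Tendsto ψ atBot (𝓝 0)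

lemma iteratedDeriv_two_eq (f : ℝ → ℝ) : iteratedDeriv 2 f = deriv (deriv f) := by
  rw [iteratedDeriv_succ, iteratedDeriv_one]

lemma iteratedDeriv_three_eq (f : ℝ → ℝ) : iteratedDeriv 3 f = deriv (deriv (deriv f)) := by
  rw [iteratedDeriv_succ, iteratedDeriv_two_eq]

namespace IsSolitaryWave
variable {b c k : ℝ} {φ : ℝ → ℝ} (h : IsSolitaryWave b c k φ)
include h

lemma contDiff_deriv : ContDiff ℝ ∞ (deriv φ) := (contDiff_infty_iff_deriv.1 h.smooth).2

lemma contDiff_deriv2 : ContDiff ℝ ∞ (deriv (deriv φ)) :=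
  (contDiff_infty_iff_deriv.1 h.contDiff_deriv).2

lemma contDiff_momentum : ContDiff ℝ ∞ (momentum φ) := by
  have : momentum φ = fun x => φ x - deriv (deriv φ) x := by
    funext x; rw [momentum, iteratedDeriv_two_eq]
  rw [this]; exact h.smooth.sub h.contDiff_deriv2

lemma differentiable : Differentiable ℝ φ := h.smooth.differentiable (by simp)

lemma momentum_deriv (x : ℝ) : (c - φ x) * deriv (momentum φ) x = b * deriv φ x * momentum φ x := by
  have h1 : deriv (momentum φ) x = deriv φ x - deriv (deriv (deriv φ)) x := by
    have : momentum φ = fun x => φ x - deriv (deriv φ) x := by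
      funext x; rw [momentum, iteratedDeriv_two_eq]
    rw [this]
    exact ((h.differentiable x).hasDerivAt.sub
      ((h.contDiff_deriv2.differentiable (by simp)) x).hasDerivAt).deriv
  have h2 := h.ode x
  rw [iteratedDeriv_three_eq] at h2
  rw [h1, momentum]
  linear_combination h2

/-- The equation reads (c-φ)μ' = bφ'μ, so μ(c-φ)^b is constant as long as φ < c. Its value is read
off at -∞: there φ'' converges, hence to 0, and μ tends to k. The half-line appears because φ < c is
not yet known globally. -/
lemma momentum_conserved_aux (hb : 1 < b) (hk : k < c) {x₀ : ℝ} (hlt : ∀ x < x₀, φ x < c) :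
    ∀ x < x₀, momentum φ x * (c - φ x) ^ b = k * (c - k) ^ b := by
  intro x hx
  have hv : ∀ y < x₀, HasDerivAt (fun y => momentum φ y * (c - φ y) ^ b) 0 y := by
    intro y hy
    have hp : 0 < c - φ y := by linarith [hlt y hy]
    have h1 := ((h.differentiable y).hasDerivAt.const_sub c).rpow_const (p := b) (Or.inl hp.ne')
    have h2 := ((h.contDiff_momentum.differentiable (by simp)) y).hasDerivAt.mul h1
    refine h2.congr_deriv ?_
    have e : (c - φ y) ^ b = (c - φ y) * (c - φ y) ^ (b - 1) := by
      rw [← Real.rpow_one_add' hp.le (by linarith)]; congr 1; ring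
    rw [e]
    linear_combination (c - φ y) ^ (b - 1) * h.momentum_deriv y
  set A := momentum φ x * (c - φ x) ^ b with hA
  have hconst : ∀ y ≤ x, momentum φ y * (c - φ y) ^ b = A := by
    intro y hy
    refine (constant_of_has_deriv_right_zero (a := y) (b := x)
      (f := fun y => momentum φ y * (c - φ y) ^ b) ?_ ?_ x ⟨hy, le_rfl⟩).symm
    · exact fun z hz => (hv z (lt_of_le_of_lt hz.2 hx)).continuousAt.continuousWithinAt
    · exact fun z hz => (hv z (hz.2.trans hx)).hasDerivWithinAt
  have hck : 0 < c - k := by linarith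
  have hlim : Tendsto (deriv (deriv φ)) atBot (𝓝 (k - A * (c - k) ^ (-b))) := by
    have h1 : Tendsto (fun y => φ y - A * (c - φ y) ^ (-b)) atBot (𝓝 (k - A * (c - k) ^ (-b))) :=
      h.tendsto_atBot.sub (((h.tendsto_atBot.const_sub c).rpow_const (Or.inl hck.ne')).const_mul A)
    refine h1.congr' ?_
    filter_upwards [eventually_le_atBot x] with y hy
    have hp : 0 < c - φ y := by linarith [hlt y (lt_of_le_of_lt hy hx)]
    rw [← hconst y hy, mul_assoc, ← Real.rpow_add hp, add_neg_cancel, Real.rpow_zero, mul_one,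
      momentum, iteratedDeriv_two_eq]
    ring
  have h0 := limit_deriv_deriv_eq_zero h.differentiable
    (h.contDiff_deriv.differentiable (by simp)) h.tendsto_atBot hlim
  have h1 : k = A * (c - k) ^ (-b) := by linarith
  have h2 : k * (c - k) ^ b = A * ((c - k) ^ (-b) * (c - k) ^ b) := by
    rw [← mul_assoc, ← h1]
  rw [h2, ← Real.rpow_add hck, neg_add_cancel, Real.rpow_zero, mul_one]

/-- At the leftmost point where φ reaches c the conserved quantity μ(c-φ)^b would be 0 by
continuity, but it equals k(c-k)^b > 0. -/
lemma lt_speed (hb : 1 < b) (hk0 : 0 < k) (hk : k < c) (x : ℝ) : φ x < c := by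
  by_contra hcon
  push Not at hcon
  have hev : ∀ᶠ y in atBot, φ y < c := h.tendsto_atBot.eventually_lt_const hk
  obtain ⟨y₀, hy₀⟩ := eventually_atBot.1 hev
  set s := {y | c ≤ φ y} with hs
  have hne : s.Nonempty := ⟨x, hcon⟩
  have hbdd : BddBelow s := ⟨y₀, fun y hy => by
    by_contra hlt
    push Not at hlt
    exact absurd (hy₀ y hlt.le) (not_lt.2 hy)⟩
  have hcl : IsClosed s := isClosed_le continuous_const h.differentiable.continuous
  have hmem : sInf s ∈ s := hcl.csInf_mem hne hbdd
  set x₀ := sInf s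
  have hlt : ∀ y < x₀, φ y < c := fun y hy => by
    by_contra hge
    push Not at hge
    exact absurd (csInf_le hbdd hge) (not_le.2 hy)
  have hcons := h.momentum_conserved_aux hb hk hlt
  have hφc : φ x₀ = c := by
    refine le_antisymm ?_ hmem
    have : Tendsto φ (𝓝[<] x₀) (𝓝 (φ x₀)) :=
      h.differentiable.continuous.continuousAt.continuousWithinAt
    exact le_of_tendsto this (eventually_nhdsWithin_of_forall fun y hy => (hlt y hy).le)
  have hc1 : Continuous (fun y => momentum φ y * (c - φ y) ^ b) :=
    h.contDiff_momentum.continuous.mul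
      ((continuous_const.sub h.differentiable.continuous).rpow_const
        fun _ => Or.inr (by linarith))
  have ht : Tendsto (fun y => momentum φ y * (c - φ y) ^ b) (𝓝[<] x₀)
      (𝓝 (momentum φ x₀ * (c - φ x₀) ^ b)) := hc1.continuousAt.continuousWithinAt
  have ht2 : Tendsto (fun y => momentum φ y * (c - φ y) ^ b) (𝓝[<] x₀) (𝓝 (k * (c - k) ^ b)) :=
    tendsto_const_nhds.congr' (eventually_nhdsWithin_of_forall fun y hy => (hcons y hy).symm)
  have h0 := tendsto_nhds_unique ht ht2
  rw [hφc, sub_self, Real.zero_rpow (by linarith), mul_zero] at h0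
  have : 0 < k * (c - k) ^ b := mul_pos hk0 (Real.rpow_pos_of_pos (by linarith) _)
  linarith

lemma momentum_eq (hb : 1 < b) (hk0 : 0 < k) (hk : k < c) (x : ℝ) :
    momentum φ x = k * (1 - (φ x - k) / (c - k)) ^ (-b) := by
  have hlt := h.lt_speed hb hk0 hk
  have h1 := h.momentum_conserved_aux hb hk (x₀ := x + 1) (fun y _ => hlt y) x (by linarith)
  have hp : 0 < c - φ x := by linarith [hlt x]
  have hck : 0 < c - k := by linarith
  have e : 1 - (φ x - k) / (c - k) = (c - φ x) / (c - k) := by field_simp; ring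
  rw [e, Real.rpow_neg (by positivity), Real.div_rpow hp.le hck.le, inv_div]
  have := Real.rpow_pos_of_pos hp b
  field_simp
  linarith

theorem profile (hb : 1 < b) (hk : k ∈ Ioo 0 (c / (b + 1))) :
    Profile b (k / (c - k)) (fun x => (φ x - k) / (c - k)) := by
  have hk0 : 0 < k := hk.1
  have hkb : k * (b + 1) < c := by rw [← lt_div_iff₀ (by linarith)]; exact hk.2
  have hkc : k < c := by nlinarith
  have hck : 0 < c - k := by linarith
  set κ := k / (c - k) with hκ
  set ψ := fun x => (φ x - k) / (c - k) with hψ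
  have hκ0 : 0 < κ := div_pos hk0 hck
  have hκb : κ * b < 1 := by rw [hκ, div_mul_eq_mul_div, div_lt_one hck]; linarith
  have hsm : ContDiff ℝ ∞ ψ := (h.smooth.sub contDiff_const).div_const _
  have hlt1 : ∀ x, ψ x < 1 := fun x => by
    rw [hψ]; simp only; rw [div_lt_one hck]; linarith [h.lt_speed hb hk0 hkc x]
  have hd1 : deriv ψ = fun x => deriv φ x / (c - k) := funext fun x =>
    (((h.differentiable x).hasDerivAt.sub_const k).div_const (c - k)).deriv
  have hd2 : deriv (deriv ψ) = fun x => deriv (deriv φ) x / (c - k) := by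
    rw [hd1]
    exact funext fun x =>
      ((((h.contDiff_deriv.differentiable (by simp)) x).hasDerivAt).div_const (c - k)).deriv
  have hode : ∀ x, deriv (deriv ψ) x = ψ x + κ * (1 - (1 - ψ x) ^ (-b)) := by
    intro x
    have h1 := h.momentum_eq hb hk0 hkc x
    rw [momentum, iteratedDeriv_two_eq] at h1
    rw [hd2]
    change φ x - deriv (deriv φ) x = k * (1 - ψ x) ^ (-b) at h1
    simp only [hκ]
    have h2 : deriv (deriv φ) x = φ x - k * (1 - ψ x) ^ (-b) := by linarith
    have h3 : ψ x = (φ x - k) / (c - k) := rfl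
    rw [h2, eq_comm]
    nth_rewrite 1 [h3]
    field_simp
    ring
  have hdiff : Differentiable ℝ ψ := hsm.differentiable (by simp)
  have hdiff' : Differentiable ℝ (deriv ψ) :=
    ((contDiff_infty_iff_deriv.1 hsm).2).differentiable (by simp)
  have hbot : Tendsto ψ atBot (𝓝 0) := by
    have := (h.tendsto_atBot.sub_const k).div_const (c - k)
    rwa [sub_self, zero_div] at this
  have htop : Tendsto ψ atTop (𝓝 0) := by
    have := (h.tendsto_atTop.sub_const k).div_const (c - k)
    rwa [sub_self, zero_div] at this
  have hb1 : b - 1 ≠ 0 := by linarith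
  -- Conservation of energy for the second-order equation of ψ. The constant is the limit of ψ'² at
  -- -∞, hence 0 because ψ converges.
  have hEd : ∀ x, HasDerivAt (fun x => deriv ψ x ^ 2 - ψ x ^ 2 * (1 - κ * rem b (ψ x))) 0 x := by
    intro x
    have h1 := (hdiff' x).hasDerivAt.pow 2
    have h2 := (hdiff x).hasDerivAt
    have h3 := (hasDerivAt_rem hb (hlt1 x)).comp x h2
    refine (h1.sub ((h2.pow 2).mul ((h3.const_mul κ).const_sub 1))).congr_deriv ?_
    rw [hode x]
    simp only [Function.comp, Pi.pow_apply]
    push_cast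
    linear_combination (κ * deriv ψ x) * two_mul_rem_add hb (hlt1 x)
  have hE : ∀ x, deriv ψ x ^ 2 - ψ x ^ 2 * (1 - κ * rem b (ψ x))
      = deriv ψ 0 ^ 2 - ψ 0 ^ 2 * (1 - κ * rem b (ψ 0)) := fun x =>
    is_const_of_deriv_eq_zero (fun x => (hEd x).differentiableAt) (fun x => (hEd x).deriv) x 0
  set E₀ := deriv ψ 0 ^ 2 - ψ 0 ^ 2 * (1 - κ * rem b (ψ 0)) with hE₀
  have hElim : Tendsto (fun x => deriv ψ x ^ 2) atBot (𝓝 E₀) := by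
    have h1 : Tendsto (fun x => E₀ + ψ x ^ 2 * (1 - κ * rem b (ψ x))) atBot
        (𝓝 (E₀ + 0 ^ 2 * (1 - κ * rem b 0))) :=
      ((hbot.pow 2).mul ((((hasDerivAt_rem hb one_pos).continuousAt.tendsto.comp
        hbot).const_mul κ).const_sub 1)).const_add _
    rw [zero_pow two_ne_zero, zero_mul, add_zero] at h1
    exact h1.congr fun x => by linarith [hE x]
  have hE00 : E₀ = 0 := limit_deriv_sq_eq_zero hdiff hbot hElim
  have hsq : ∀ x, deriv ψ x ^ 2 = ψ x ^ 2 * (1 - κ * rem b (ψ x)) := fun x => by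
    linarith [hE x]
  -- The first integral gives |ψ'| ≤ |ψ|, so by Gronwall a zero of ψ would make ψ vanish
  -- identically.
  have hle : ∀ x, |deriv ψ x| ≤ 1 * |ψ x| := fun x => by
    rw [one_mul]
    refine sq_le_sq.1 ?_
    rw [hsq x]
    have := mul_pos hκ0 (rem_pos hb (hlt1 x))
    nlinarith [sq_nonneg (ψ x)]
  have hne : ∀ x, ψ x ≠ 0 := fun x hx => by
    obtain ⟨y, hy⟩ := h.nonconstant
    have := eq_zero_of_abs_deriv_le hdiff hle hx y
    rw [hψ] at this
    simp only [div_eq_zero_iff, hck.ne', or_false] at this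
    exact hy (by linarith)
  have hz : deriv ψ 0 = 0 := by rw [hd1]; simp [h.deriv_zero]
  -- At the crest the first integral forces κR(ψ(0)) = 1 > κb = κR(0). Since R increases, ψ(0) > 0.
  have hpos0 : 0 < ψ 0 := by
    have h1 := hsq 0
    rw [hz, zero_pow two_ne_zero, eq_comm, mul_eq_zero] at h1
    rcases h1 with h1 | h1
    · exact absurd (pow_eq_zero_iff two_ne_zero |>.1 h1) (hne 0)
    · by_contra hcon
      have h2 : rem b (ψ 0) ≤ rem b 0 :=
        (strictMonoOn_rem hb).monotoneOn (hlt1 0) (mem_Iio.2 one_pos) (not_lt.1 hcon)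
      rw [rem_zero] at h2
      nlinarith
  have hpos : ∀ x, 0 < ψ x := by
    intro x
    by_contra hcon
    push Not at hcon
    have := isPreconnected_univ.intermediate_value (mem_univ x) (mem_univ 0)
      hdiff.continuous.continuousOn ⟨hcon, hpos0.le⟩
    obtain ⟨y, _, hy⟩ := this
    exact hne y hy
  exact ⟨hb, hκ0, hκb, hsm, hlt1, hpos, hode, hsq, hz, htop, hbot⟩

end IsSolitaryWave

/-! ### The potential energy in the variable θ, and the shape of the profile -/

/-- The function `Y`, proportional to the integrand of `Q`. -/
noncomputable def potY (b t : ℝ) : ℝ := (2 * b * ((t ^ 2)⁻¹ - 1) - 2 * (t ^ (-(2 * b)) - 1)) / (b - 1)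
/-- The function `f`, proportional to `Y'`. -/
noncomputable def potF (b t : ℝ) : ℝ := (t ^ 3)⁻¹ - t ^ (-(2 * b)) / t
/-- The derivative of `f`. -/
noncomputable def potF' (b t : ℝ) : ℝ := -3 * (t ^ 4)⁻¹ + (2 * b + 1) * (t ^ (-(2 * b)) / t ^ 2)
/-- The potential energy `V` of the variable `θ`. -/
noncomputable def potV (b κ t : ℝ) : ℝ := t ^ 2 + (t ^ 2)⁻¹ - 2 + κ * potY b t
/-- The first derivative of `V`. -/
noncomputable def potV1 (b κ t : ℝ) : ℝ := 2 * t - 2 * (t ^ 3)⁻¹ - κ * (4 * b / (b - 1)) * potF b t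
/-- The second derivative of `V`. -/
noncomputable def potV2 (b κ t : ℝ) : ℝ := 2 + 6 * (t ^ 4)⁻¹ - κ * (4 * b / (b - 1)) * potF' b t

section
variable {b κ t : ℝ} (hb : 1 < b) (ht : 0 < t)
include ht

lemma hasDerivAt_rpow_two_mul : HasDerivAt (fun t : ℝ => t ^ (-(2 * b)))
    (-(2 * b) * (t ^ (-(2 * b)) / t)) t := by
  have := Real.hasDerivAt_rpow_const (p := -(2 * b)) (Or.inl ht.ne')
  rwa [Real.rpow_sub_one ht.ne'] at this

lemma hasDerivAt_inv_pow (n : ℕ) : HasDerivAt (fun t : ℝ => (t ^ n)⁻¹)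
    (-(n * t ^ (n - 1)) / (t ^ n) ^ 2) t :=
  (hasDerivAt_pow n t).inv (pow_ne_zero _ ht.ne')

lemma hasDerivAt_potF : HasDerivAt (potF b) (potF' b t) t := by
  refine ((hasDerivAt_inv_pow ht 3).sub ((hasDerivAt_rpow_two_mul (b := b) ht).div
    (hasDerivAt_id t) ht.ne')).congr_deriv ?_
  simp only [potF', id]
  push_cast
  field_simp
  ring

include hb in
lemma hasDerivAt_potY : HasDerivAt (potY b) (-(4 * b / (b - 1)) * potF b t) t := by
  have hb1 : b - 1 ≠ 0 := by linarith
  refine (((((hasDerivAt_inv_pow ht 2).sub_const 1).const_mul (2 * b)).sub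
    (((hasDerivAt_rpow_two_mul (b := b) ht).sub_const 1).const_mul 2)).div_const
      (b - 1)).congr_deriv ?_
  simp only [potF]
  push_cast
  field_simp
  ring

include hb in
lemma hasDerivAt_potV : HasDerivAt (potV b κ) (potV1 b κ t) t := by
  refine ((((hasDerivAt_pow 2 t).add (hasDerivAt_inv_pow ht 2)).sub_const 2).add
    ((hasDerivAt_potY hb ht).const_mul κ)).congr_deriv ?_
  rw [potV1]
  push_cast
  field_simp
  ring

lemma hasDerivAt_potV1 : HasDerivAt (potV1 b κ) (potV2 b κ t) t := by
  refine ((((hasDerivAt_id t).const_mul 2).sub ((hasDerivAt_inv_pow ht 3).const_mul 2)).sub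
    ((hasDerivAt_potF (b := b) ht).const_mul (κ * (4 * b / (b - 1))))).congr_deriv ?_
  rw [potV2]
  push_cast
  field_simp
  ring

lemma contDiffAt_potF' {n : WithTop ℕ∞} : ContDiffAt ℝ n (potF' b) t := by
  have h1 : ContDiffAt ℝ n (fun t : ℝ => t ^ (-(2 * b))) t := contDiffAt_id.rpow_const_of_ne ht.ne'
  have h2 : t ^ 2 ≠ 0 := pow_ne_zero _ ht.ne'
  have h4 : t ^ 4 ≠ 0 := pow_ne_zero _ ht.ne'
  unfold potF'
  exact (contDiffAt_const.mul ((contDiffAt_id.pow 4).inv h4)).add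
    (contDiffAt_const.mul (h1.div (contDiffAt_id.pow 2) h2))

lemma contDiffAt_potF {n : WithTop ℕ∞} : ContDiffAt ℝ n (potF b) t := by
  have h1 : ContDiffAt ℝ n (fun t : ℝ => t ^ (-(2 * b))) t := contDiffAt_id.rpow_const_of_ne ht.ne'
  have h3 : t ^ 3 ≠ 0 := pow_ne_zero _ ht.ne'
  unfold potF
  exact ((contDiffAt_id.pow 3).inv h3).sub (h1.div contDiffAt_id ht.ne')

lemma contDiffAt_potV2 {n : WithTop ℕ∞} : ContDiffAt ℝ n (potV2 b κ) t := by
  have h4 : t ^ 4 ≠ 0 := pow_ne_zero _ ht.ne'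
  unfold potV2
  exact (contDiffAt_const.add (contDiffAt_const.mul ((contDiffAt_id.pow 4).inv h4))).sub
    (contDiffAt_const.mul (contDiffAt_potF' ht))

end

@[simp] lemma potF_one (b : ℝ) : potF b 1 = 0 := by simp [potF]
@[simp] lemma potV1_one (b κ : ℝ) : potV1 b κ 1 = 0 := by simp [potV1]
@[simp] lemma potY_one (b : ℝ) : potY b 1 = 0 := by simp [potY]
@[simp] lemma potV_one (b κ : ℝ) : potV b κ 1 = 0 := by simp [potV]; norm_num

/-- The variable `θ = (1 - ψ)^(1/2)`. -/
noncomputable def theta (ψ : ℝ → ℝ) (x : ℝ) : ℝ := Real.sqrt (1 - ψ x)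

/-- The negative logarithmic derivative `-ψ'/ψ`. -/
noncomputable def logSlope (ψ : ℝ → ℝ) (x : ℝ) : ℝ := -deriv ψ x / ψ x

namespace Profile
variable {b κ : ℝ} {ψ : ℝ → ℝ} (P : Profile b κ ψ)
include P

lemma contDiff_deriv : ContDiff ℝ ∞ (deriv ψ) := (contDiff_infty_iff_deriv.1 P.smooth).2

lemma hasDerivAt (x : ℝ) : HasDerivAt ψ (deriv ψ x) x :=
  (P.smooth.differentiable (by simp) x).hasDerivAt

lemma hasDerivAt_deriv (x : ℝ) : HasDerivAt (deriv ψ) (ψ x + κ * (1 - (1 - ψ x) ^ (-b))) x := by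
  rw [← P.ode]
  exact (P.contDiff_deriv.differentiable (by simp) x).hasDerivAt

lemma continuous : Continuous ψ := P.smooth.continuous

lemma deriv_eq (x : ℝ) : deriv ψ x = -(ψ x * logSlope ψ x) := by
  have := (P.pos x).ne'
  rw [logSlope]; field_simp

lemma logSlope_sq (x : ℝ) : logSlope ψ x ^ 2 = 1 - κ * rem b (ψ x) := by
  have := (P.pos x).ne'
  rw [logSlope, div_pow, neg_sq, P.sq]; field_simp

/-- This derivative is positive: the logarithmic slope increases strictly through 0 at the crest.
Hence ψ has a single maximum and decays exponentially, and the slope can serve as a coordinate on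
the wave. -/
lemma hasDerivAt_logSlope (x : ℝ) :
    HasDerivAt (logSlope ψ) (κ * (ψ x * rem1 b (ψ x)) / 2) x := by
  have h0 := (P.pos x).ne'
  refine ((P.hasDerivAt_deriv x).neg.div (P.hasDerivAt x) h0).congr_deriv ?_
  have h1 := two_mul_rem_add P.hb (P.lt_one x)
  have h2 := P.sq x
  simp only [Pi.neg_apply]
  field_simp
  linear_combination 2 * h2 - κ * ψ x * h1

lemma logSlope_zero : logSlope ψ 0 = 0 := by simp [logSlope, P.deriv_zero]

lemma strictMono_logSlope : StrictMono (logSlope ψ) := by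
  refine strictMono_of_deriv_pos fun x => ?_
  rw [(P.hasDerivAt_logSlope x).deriv]
  have := rem1_pos P.hb (P.lt_one x)
  have := P.pos x
  have := P.κ_pos
  positivity

lemma logSlope_pos {x : ℝ} (hx : 0 < x) : 0 < logSlope ψ x := by
  rw [← P.logSlope_zero]; exact P.strictMono_logSlope hx

lemma logSlope_neg {x : ℝ} (hx : x < 0) : logSlope ψ x < 0 := by
  rw [← P.logSlope_zero]; exact P.strictMono_logSlope hx

lemma lt_rem (x : ℝ) : b < rem b (ψ x) := by
  conv_lhs => rw [← rem_zero (b := b)]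
  exact strictMonoOn_rem P.hb (mem_Iio.2 one_pos) (P.lt_one x) (P.pos x)

lemma logSlope_sq_lt (x : ℝ) : logSlope ψ x ^ 2 < 1 - κ * b := by
  rw [P.logSlope_sq]
  nlinarith [P.lt_rem x, P.κ_pos]

lemma abs_logSlope_le (x : ℝ) : |logSlope ψ x| ≤ 1 := by
  rw [abs_le_one_iff_mul_self_le_one]
  have h1 := P.logSlope_sq_lt x
  have := mul_pos P.κ_pos (zero_lt_one.trans P.hb)
  nlinarith

lemma abs_deriv_le (x : ℝ) : |deriv ψ x| ≤ 1 * |ψ x| := by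
  rw [P.deriv_eq, abs_neg, abs_mul, mul_comm]
  exact mul_le_mul_of_nonneg_right (P.abs_logSlope_le x) (abs_nonneg _)

lemma deriv_neg {x : ℝ} (hx : 0 < x) : deriv ψ x < 0 := by
  rw [P.deriv_eq]; linarith [mul_pos (P.pos x) (P.logSlope_pos hx)]

lemma deriv_pos {x : ℝ} (hx : x < 0) : 0 < deriv ψ x := by
  rw [P.deriv_eq]; linarith [mul_neg_of_pos_of_neg (P.pos x) (P.logSlope_neg hx)]

lemma le_zero (x : ℝ) : ψ x ≤ ψ 0 := by
  rcases le_total 0 x with h | h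
  · refine (strictAntiOn_of_deriv_neg (convex_Ici 0) P.continuous.continuousOn
      fun y hy => ?_).antitoneOn self_mem_Ici h h
    rw [interior_Ici] at hy
    exact P.deriv_neg hy
  · refine (strictMonoOn_of_deriv_pos (convex_Iic 0) P.continuous.continuousOn
      fun y hy => ?_).monotoneOn h self_mem_Iic h
    rw [interior_Iic] at hy
    exact P.deriv_pos hy

/-- Beyond ±1 the slope -ψ'/ψ exceeds in absolute value what it is at ±1, so ψ exp(ν|x|) is monotone
there; the bound ψ < 1 gives the constant. -/
lemma expDecay : ExpDecay ψ := by
  have h1 : 0 < logSlope ψ 1 := P.logSlope_pos one_pos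
  have h2 : logSlope ψ (-1) < 0 := P.logSlope_neg (by norm_num)
  set ν := min (logSlope ψ 1) (-logSlope ψ (-1)) with hν
  have hν0 : 0 < ν := lt_min h1 (by linarith)
  have d : ∀ s y : ℝ, HasDerivAt (fun y => ψ y * Real.exp (s * y))
      (ψ y * Real.exp (s * y) * (s - logSlope ψ y)) y := by
    intro s y
    have he : HasDerivAt (fun y => Real.exp (s * y)) (Real.exp (s * y) * s) y := by
      simpa using ((hasDerivAt_id y).const_mul s).exp
    refine ((P.hasDerivAt y).mul he).congr_deriv ?_
    rw [P.deriv_eq]; ring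
  refine ⟨Real.exp ν, Real.exp_pos _, ν, hν0, fun x => ?_⟩
  rw [abs_of_pos (P.pos x), ← Real.exp_add]
  rcases le_total |x| 1 with hx | hx
  · refine (P.lt_one x).le.trans (Real.one_le_exp ?_)
    nlinarith
  · rcases le_total 0 x with h | h
    · rw [abs_of_nonneg h] at hx ⊢
      have hanti : AntitoneOn (fun y => ψ y * Real.exp (ν * y)) (Ici 1) := by
        refine antitoneOn_of_deriv_nonpos (convex_Ici 1)
          (fun y _ => (d ν y).continuousAt.continuousWithinAt)
          (fun y _ => (d ν y).differentiableAt.differentiableWithinAt) fun y hy => ?_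
        rw [interior_Ici] at hy
        rw [(d ν y).deriv]
        have : logSlope ψ 1 < logSlope ψ y := P.strictMono_logSlope hy
        exact mul_nonpos_of_nonneg_of_nonpos (mul_nonneg (P.pos y).le (Real.exp_pos _).le)
          (by linarith [min_le_left (logSlope ψ 1) (-logSlope ψ (-1))])
      have h3 := hanti self_mem_Ici (show (1 : ℝ) ≤ x from hx) hx
      simp only [mul_one] at h3
      rw [Real.exp_add, neg_mul, Real.exp_neg, ← div_eq_mul_inv, le_div_iff₀ (Real.exp_pos _)]
      nlinarith [P.lt_one 1, Real.exp_pos ν]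
    · rw [abs_of_nonpos h] at hx ⊢
      have hmono : MonotoneOn (fun y => ψ y * Real.exp (-ν * y)) (Iic (-1)) := by
        refine monotoneOn_of_deriv_nonneg (convex_Iic (-1))
          (fun y _ => (d (-ν) y).continuousAt.continuousWithinAt)
          (fun y _ => (d (-ν) y).differentiableAt.differentiableWithinAt) fun y hy => ?_
        rw [interior_Iic] at hy
        rw [(d (-ν) y).deriv]
        have : logSlope ψ y < logSlope ψ (-1) := P.strictMono_logSlope hy
        exact mul_nonneg (mul_nonneg (P.pos y).le (Real.exp_pos _).le)
          (by linarith [min_le_right (logSlope ψ 1) (-logSlope ψ (-1))])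
      have h3 := hmono (show x ≤ -1 by linarith) self_mem_Iic (by linarith : x ≤ -1)
      simp only [mul_neg, neg_mul, mul_one, neg_neg] at h3
      rw [Real.exp_add, show -ν * -x = ν * x by ring, show ν * x = -(-(ν * x)) by ring,
        Real.exp_neg (-(ν * x)), ← div_eq_mul_inv, le_div_iff₀ (Real.exp_pos _)]
      nlinarith [P.lt_one (-1), Real.exp_pos ν]

lemma expDecay_deriv : ExpDecay (deriv ψ) := P.expDecay.of_le P.abs_deriv_le

lemma bdd_comp {F : ℝ → ℝ} (hF : ContinuousOn F (Iio 1)) : ∃ C, ∀ x, |F (ψ x)| ≤ C := by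
  obtain ⟨C, hC⟩ := isCompact_Icc.exists_bound_of_continuousOn
    (hF.mono (fun y (hy : y ∈ Icc 0 (ψ 0)) => lt_of_le_of_lt hy.2 (P.lt_one 0)))
  exact ⟨C, fun x => hC _ ⟨(P.pos x).le, P.le_zero x⟩⟩

lemma continuous_comp {F : ℝ → ℝ} (hF : ContinuousOn F (Iio 1)) :
    Continuous (fun x => F (ψ x)) :=
  hF.comp_continuous P.continuous P.lt_one

lemma one_sub_pos (x : ℝ) : 0 < 1 - ψ x := by linarith [P.lt_one x]

lemma theta_pos (x : ℝ) : 0 < theta ψ x := Real.sqrt_pos.2 (P.one_sub_pos x)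

lemma theta_sq (x : ℝ) : theta ψ x ^ 2 = 1 - ψ x := Real.sq_sqrt (P.one_sub_pos x).le

lemma theta_lt_one (x : ℝ) : theta ψ x < 1 := by
  have := P.theta_sq x
  nlinarith [P.theta_pos x, P.pos x]

lemma theta_zero_le (x : ℝ) : theta ψ 0 ≤ theta ψ x :=
  Real.sqrt_le_sqrt (by linarith [P.le_zero x])

lemma theta_mem (x : ℝ) : theta ψ x ∈ Icc (theta ψ 0) 1 :=
  ⟨P.theta_zero_le x, (P.theta_lt_one x).le⟩

lemma one_sub_theta_le (x : ℝ) : 1 - theta ψ x ≤ ψ x := by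
  have := P.theta_sq x
  nlinarith [P.theta_pos x, P.theta_lt_one x]

lemma contDiff_theta : ContDiff ℝ ∞ (theta ψ) :=
  (contDiff_const.sub P.smooth).sqrt fun x => (P.one_sub_pos x).ne'

lemma continuous_theta : Continuous (theta ψ) := P.contDiff_theta.continuous

lemma hasDerivAt_theta' (x : ℝ) : HasDerivAt (theta ψ) (-deriv ψ x / (2 * theta ψ x)) x :=
  ((P.hasDerivAt x).const_sub 1).sqrt (P.one_sub_pos x).ne'

lemma deriv_theta (x : ℝ) : deriv (theta ψ) x = -deriv ψ x / (2 * theta ψ x) :=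
  (P.hasDerivAt_theta' x).deriv

lemma hasDerivAt_theta (x : ℝ) : HasDerivAt (theta ψ) (deriv (theta ψ) x) x := by
  rw [P.deriv_theta]; exact P.hasDerivAt_theta' x

lemma rpow_neg_eq (x : ℝ) : (1 - ψ x) ^ (-b) = theta ψ x ^ (-(2 * b)) := by
  rw [← P.theta_sq, ← Real.rpow_natCast, ← Real.rpow_mul (P.theta_pos x).le]
  congr 1; push_cast; ring

lemma sq_mul_rem_eq (x : ℝ) : ψ x ^ 2 * rem b (ψ x) = -(theta ψ x ^ 2 * potY b (theta ψ x)) := by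
  have hb1 : b - 1 ≠ 0 := by linarith [P.hb]
  have ht := P.theta_pos x
  have h1 : (1 - ψ x) ^ (1 - b) = theta ψ x ^ 2 * theta ψ x ^ (-(2 * b)) := by
    rw [show 1 - b = 1 + -b by ring, Real.rpow_add (P.one_sub_pos x), Real.rpow_one,
      P.rpow_neg_eq, P.theta_sq]
  have h2 : ψ x = 1 - theta ψ x ^ 2 := by rw [P.theta_sq]; ring
  rw [sq_mul_rem P.hb (P.lt_one x), h1, potY]
  conv_lhs => rw [h2]
  field_simp
  ring

/-- The first integral of ψ in the variable θ. The potential is affine in κ with slope Y, so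
derivatives in κ produce Y and f = -Y'/8. -/
lemma deriv_theta_sq (x : ℝ) : 4 * deriv (theta ψ) x ^ 2 = potV b κ (theta ψ x) := by
  have ht := P.theta_pos x
  have h2 : ψ x = 1 - theta ψ x ^ 2 := by rw [P.theta_sq]; ring
  have h3 := P.sq_mul_rem_eq x
  have h4 := P.sq x
  have h5 : deriv ψ x ^ 2 = ψ x ^ 2 + κ * theta ψ x ^ 2 * potY b (theta ψ x) := by
    linear_combination h4 - κ * h3
  rw [P.deriv_theta, div_pow, neg_sq, h5, h2, potV]
  field_simp
  ring

lemma hasDerivAt_deriv_theta (x : ℝ) :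
    HasDerivAt (deriv (theta ψ)) (potV1 b κ (theta ψ x) / 8) x := by
  have ht := P.theta_pos x
  have hb1 : b - 1 ≠ 0 := by linarith [P.hb]
  have h0 : deriv (theta ψ) = fun x => -deriv ψ x / (2 * theta ψ x) := funext P.deriv_theta
  have h1 := (P.hasDerivAt_deriv x).neg.div ((P.hasDerivAt_theta x).const_mul 2)
    (by positivity : 2 * theta ψ x ≠ 0)
  rw [h0]
  refine h1.congr_deriv ?_
  have h2 : ψ x = 1 - theta ψ x ^ 2 := by rw [P.theta_sq]; ring
  have h3 : deriv ψ x = -(2 * theta ψ x * deriv (theta ψ) x) := by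
    rw [P.deriv_theta]; field_simp
  have h4 := P.deriv_theta_sq x
  simp only [Pi.neg_apply]
  rw [P.rpow_neg_eq, h3, h2]
  simp only [potV, potY, potV1, potF] at h4 ⊢
  field_simp at h4 ⊢
  linear_combination (-4) * h4

lemma deriv_deriv_theta : deriv (deriv (theta ψ)) = fun x => potV1 b κ (theta ψ x) / 8 :=
  funext fun x => (P.hasDerivAt_deriv_theta x).deriv

lemma hasDerivAt_deriv2_theta (x : ℝ) : HasDerivAt (deriv (deriv (theta ψ)))
    (potV2 b κ (theta ψ x) / 8 * deriv (theta ψ) x) x := by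
  rw [P.deriv_deriv_theta]
  refine (((hasDerivAt_potV1 (b := b) (κ := κ) (P.theta_pos x)).comp x
    (P.hasDerivAt_theta x)).div_const 8).congr_deriv ?_
  ring

lemma bdd_comp_theta {F : ℝ → ℝ} (hF : ContinuousOn F (Ioi 0)) :
    ∃ C, ∀ x, |F (theta ψ x)| ≤ C := by
  obtain ⟨C, hC⟩ := isCompact_Icc.exists_bound_of_continuousOn
    (hF.mono (fun y (hy : y ∈ Icc (theta ψ 0) 1) => lt_of_lt_of_le (P.theta_pos 0) hy.1))
  exact ⟨C, fun x => hC _ (P.theta_mem x)⟩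

lemma continuous_comp_theta {F : ℝ → ℝ} (hF : ContinuousOn F (Ioi 0)) :
    Continuous (fun x => F (theta ψ x)) :=
  hF.comp_continuous P.continuous_theta P.theta_pos

/-- A `C¹` function of `θ` that vanishes at `1` is dominated by `ψ`. -/
lemma comp_theta_le {F F' : ℝ → ℝ} (hF : ∀ t > 0, HasDerivAt F (F' t) t)
    (hF' : ContinuousOn F' (Ioi 0)) (h1 : F 1 = 0) : ∃ C, ∀ x, |F (theta ψ x)| ≤ C * |ψ x| := by
  have hsub : Icc (theta ψ 0) 1 ⊆ Ioi 0 := fun y hy => lt_of_lt_of_le (P.theta_pos 0) hy.1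
  obtain ⟨C, hC⟩ := isCompact_Icc.exists_bound_of_continuousOn (hF'.mono hsub)
  refine ⟨C, fun x => ?_⟩
  have h2 := (convex_Icc (theta ψ 0) 1).norm_image_sub_le_of_norm_hasDerivWithin_le
    (fun y hy => (hF y (hsub hy)).hasDerivWithinAt) hC
    (show (1 : ℝ) ∈ Icc (theta ψ 0) 1 from ⟨(P.theta_lt_one 0).le, le_rfl⟩) (P.theta_mem x)
  rw [h1, sub_zero, Real.norm_eq_abs, Real.norm_eq_abs, abs_sub_comm,
    abs_of_pos (by linarith [P.theta_lt_one x] : 0 < 1 - theta ψ x)] at h2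
  refine h2.trans ?_
  rw [abs_of_pos (P.pos x)]
  exact mul_le_mul_of_nonneg_left (P.one_sub_theta_le x)
    ((norm_nonneg _).trans (hC 1 ⟨(P.theta_lt_one 0).le, le_rfl⟩))

lemma expDecay_comp_theta {F F' : ℝ → ℝ} (hF : ∀ t > 0, HasDerivAt F (F' t) t)
    (hF' : ContinuousOn F' (Ioi 0)) (h1 : F 1 = 0) : ExpDecay (fun x => F (theta ψ x)) := by
  obtain ⟨C, hC⟩ := P.comp_theta_le hF hF' h1
  exact P.expDecay.of_le hC

end Profile

lemma continuousOn_of_contDiffAt {F : ℝ → ℝ} (h : ∀ t > 0, ContDiffAt ℝ 0 F t) :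
    ContinuousOn F (Ioi 0) := fun t ht => (h t ht).continuousAt.continuousWithinAt

lemma continuousOn_potF (b : ℝ) : ContinuousOn (potF b) (Ioi 0) :=
  continuousOn_of_contDiffAt fun _ ht => contDiffAt_potF ht

lemma continuousOn_potF' (b : ℝ) : ContinuousOn (potF' b) (Ioi 0) :=
  continuousOn_of_contDiffAt fun _ ht => contDiffAt_potF' ht

lemma continuousOn_potV2 (b κ : ℝ) : ContinuousOn (potV2 b κ) (Ioi 0) :=
  continuousOn_of_contDiffAt fun _ ht => contDiffAt_potV2 ht

/-! ### The derivative of the profile with respect to κ -/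

/-- The quotient `X(y)/y` of the parameter derivative of the profile at fixed phase. -/
noncomputable def phaseQuot (b κ y : ℝ) : ℝ := -(dslope (rem b) 0 y) / (κ * (1 - κ * b) * rem1 b y)

/-- The derivative of `X(y) = y * phaseQuot y`. -/
noncomputable def phaseDeriv (b κ y : ℝ) : ℝ :=
  -(1 - (rem b y - b) * rem2 b y / rem1 b y ^ 2) / (κ * (1 - κ * b))

/-- The rate of the phase shift. -/
noncomputable def phaseRate (b κ y : ℝ) : ℝ :=
  phaseDeriv b κ y - phaseQuot b κ y + b / (2 * (1 - κ * b))

section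
variable {b : ℝ} (hb : 1 < b) (κ : ℝ)

/-- The divided difference makes the quotient (R(y) - b)/y continuous at y = 0, where R = b. -/
lemma mul_dslope_rem (b y : ℝ) : y * dslope (rem b) 0 y = rem b y - b := by
  have := sub_smul_dslope (rem b) 0 y
  rwa [sub_zero, smul_eq_mul, rem_zero] at this

include hb

lemma continuousOn_phaseQuot (hκ : κ * (1 - κ * b) ≠ 0) : ContinuousOn (phaseQuot b κ) (Iio 1) := by
  refine ContinuousOn.div ?_ (continuousOn_const.mul (continuousOn_rem1 hb))
    fun y hy => mul_ne_zero hκ (rem1_pos hb hy).ne'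
  exact ((continuousOn_dslope (Iio_mem_nhds one_pos)).2
    ⟨continuousOn_rem hb, (hasDerivAt_rem hb one_pos).differentiableAt⟩).neg

lemma continuousOn_phaseDeriv : ContinuousOn (phaseDeriv b κ) (Iio 1) := by
  refine ContinuousOn.div_const (ContinuousOn.neg (continuousOn_const.sub ?_)) _
  exact (((continuousOn_rem hb).sub continuousOn_const).mul (continuousOn_rem2 hb)).div
    ((continuousOn_rem1 hb).pow 2) fun y hy => pow_ne_zero _ (rem1_pos hb hy).ne'

lemma continuousOn_phaseRate (hκ : κ * (1 - κ * b) ≠ 0) : ContinuousOn (phaseRate b κ) (Iio 1) :=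
  ((continuousOn_phaseDeriv hb κ).sub (continuousOn_phaseQuot hb κ hκ)).add continuousOn_const

/-- Origin of the formula: the phase y = -ψ'/(ψ √(1-κb)) satisfies R(ψ) = (1-y²)/κ + b y².
Differentiation in κ at fixed phase gives ∂ψ/∂κ = -(R(ψ) - b)/(κ(1-κb)R'(ψ)), which is the function
X(ψ) = ψ `phaseQuot`(ψ). -/
lemma hasDerivAt_phase (hκ : κ * (1 - κ * b) ≠ 0) {y : ℝ} (hy : y < 1) :
    HasDerivAt (fun y => y * phaseQuot b κ y) (phaseDeriv b κ y) y := by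
  have h1 := (rem1_pos hb hy).ne'
  have e : (fun y => y * phaseQuot b κ y)
      = fun y => -(rem b y - b) / (κ * (1 - κ * b) * rem1 b y) := by
    funext y
    rw [phaseQuot, ← mul_dslope_rem]; ring
  rw [e]
  refine ((((hasDerivAt_rem hb hy).sub_const b).neg).div
    ((hasDerivAt_rem1 hb hy).const_mul (κ * (1 - κ * b))) (mul_ne_zero hκ h1)).congr_deriv ?_
  rw [phaseDeriv]
  obtain ⟨h2, h3⟩ := mul_ne_zero_iff.1 hκ
  simp only [Pi.neg_apply]
  field_simp
  ring

end

/-- The phase shift. -/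
noncomputable def phaseShift (b κ : ℝ) (ψ : ℝ → ℝ) (x : ℝ) : ℝ :=
  ∫ t in (0 : ℝ)..x, phaseRate b κ (ψ t)

/-- The derivative of the profile with respect to the parameter `κ`. -/
noncomputable def paramDeriv (b κ : ℝ) (ψ : ℝ → ℝ) (x : ℝ) : ℝ :=
  ψ x * phaseQuot b κ (ψ x) - deriv ψ x * phaseShift b κ ψ x

/-- The derivative of `θ` with respect to the parameter `κ`. -/
noncomputable def thetaParam (b κ : ℝ) (ψ : ℝ → ℝ) (x : ℝ) : ℝ :=
  -paramDeriv b κ ψ x / (2 * theta ψ x)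

/-- The potential of the Schrödinger operator. -/
noncomputable def schPot (b κ : ℝ) (ψ : ℝ → ℝ) (x : ℝ) : ℝ := potV2 b κ (theta ψ x) / 8

/-- The right-hand side `-Y'(θ)/8`. -/
noncomputable def schRhs (b : ℝ) (ψ : ℝ → ℝ) (x : ℝ) : ℝ := b / (2 * (b - 1)) * potF b (theta ψ x)

namespace Profile
variable {b κ : ℝ} {ψ : ℝ → ℝ} (P : Profile b κ ψ)
include P

lemma gap_pos : 0 < 1 - κ * b := by linarith [P.κ_lt]

lemma gap_ne : κ * (1 - κ * b) ≠ 0 := mul_ne_zero P.κ_pos.ne' P.gap_pos.ne'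

lemma continuous_phaseRate : Continuous (fun x => phaseRate b κ (ψ x)) :=
  P.continuous_comp (continuousOn_phaseRate P.hb κ P.gap_ne)

lemma hasDerivAt_phaseShift (x : ℝ) :
    HasDerivAt (phaseShift b κ ψ) (phaseRate b κ (ψ x)) x :=
  intervalIntegral.integral_hasDerivAt_right (P.continuous_phaseRate.intervalIntegrable _ _)
    P.continuous_phaseRate.aestronglyMeasurable.stronglyMeasurableAtFilter
    P.continuous_phaseRate.continuousAt

lemma continuous_phaseShift : Continuous (phaseShift b κ ψ) :=
  continuous_iff_continuousAt.2 fun x => (P.hasDerivAt_phaseShift x).continuousAt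

lemma abs_phaseShift_le : ∃ C, ∀ x, |phaseShift b κ ψ x| ≤ C * |x| := by
  obtain ⟨C, hC⟩ := P.bdd_comp (continuousOn_phaseRate P.hb κ P.gap_ne)
  refine ⟨C, fun x => ?_⟩
  have := intervalIntegral.norm_integral_le_of_norm_le_const (a := 0) (b := x)
    (f := fun t => phaseRate b κ (ψ t)) (fun t _ => hC t)
  rwa [sub_zero] at this

/-- At fixed x, ∂ψ/∂κ = X(ψ) - ψ' g with g = ∂x/∂κ at fixed phase. From ∂x/∂y = (∂ψ/∂y)/ψ' and ψ' =
-ψ y √(1-κb) one gets g' = X'(ψ) - X(ψ)/ψ + b/(2(1-κb)), which is `phaseRate`; g(0) = 0 because the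
crest stays at 0. The term X'(ψ) cancels here. -/
lemma hasDerivAt_paramDeriv (x : ℝ) : HasDerivAt (paramDeriv b κ ψ)
    (deriv ψ x * (phaseQuot b κ (ψ x) - b / (2 * (1 - κ * b)))
      - deriv (deriv ψ) x * phaseShift b κ ψ x) x := by
  have h1 := (hasDerivAt_phase P.hb κ P.gap_ne (P.lt_one x)).comp x (P.hasDerivAt x)
  have h2 := (P.hasDerivAt_deriv x).mul (P.hasDerivAt_phaseShift x)
  refine (h1.sub h2).congr_deriv ?_
  rw [P.ode, phaseRate]
  ring

lemma ode' (x : ℝ) : deriv (deriv ψ) x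
    = ψ x * (1 - κ * rem b (ψ x)) - κ * ψ x ^ 2 * rem1 b (ψ x) / 2 := by
  rw [P.ode]
  linear_combination (κ / 2) * two_mul_rem_add P.hb (P.lt_one x)

/-- The derivative of the energy relation `ψ'² = G(ψ, κ)` with respect to `κ`. -/
lemma two_mul_deriv_mul (x : ℝ) : 2 * deriv ψ x * deriv (paramDeriv b κ ψ) x
    = 2 * deriv (deriv ψ) x * paramDeriv b κ ψ x - ψ x ^ 2 * rem b (ψ x) := by
  have h1 := P.sq x
  have h2 := (rem1_pos P.hb (P.lt_one x)).ne'
  have h3 := mul_dslope_rem b (ψ x)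
  have h4 := P.gap_pos.ne'
  have h5 := P.κ_pos.ne'
  have hq : κ * rem1 b (ψ x) * (ψ x * phaseQuot b κ (ψ x)) = -(rem b (ψ x) - b) / (1 - κ * b) := by
    rw [← h3, phaseQuot]; field_simp
  have hq2 : (1 - κ * b) * (κ * rem1 b (ψ x) * (ψ x * phaseQuot b κ (ψ x)))
      = -(rem b (ψ x) - b) := by rw [hq]; field_simp
  have hd : (1 - κ * b) * (b / (2 * (1 - κ * b))) = b / 2 := by field_simp
  rw [(P.hasDerivAt_paramDeriv x).deriv, paramDeriv]
  set B := b / (2 * (1 - κ * b))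
  set D := phaseQuot b κ (ψ x)
  set g := phaseShift b κ ψ x
  have e : 2 * deriv ψ x ^ 2 * (D - B) = 2 * deriv (deriv ψ) x * (ψ x * D)
      - ψ x ^ 2 * rem b (ψ x) := by
    rw [h1, P.ode']
    refine mul_left_cancel₀ h4 ?_
    linear_combination (ψ x ^ 2) * hq2 - 2 * ψ x ^ 2 * (1 - κ * rem b (ψ x)) * hd
  linear_combination e

lemma hasDerivAt_thetaParam (x : ℝ) : HasDerivAt (thetaParam b κ ψ)
    (-deriv (paramDeriv b κ ψ) x / (2 * theta ψ x)
      + paramDeriv b κ ψ x * deriv (theta ψ) x / (2 * theta ψ x ^ 2)) x := by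
  have ht := P.theta_pos x
  have h0 := (P.hasDerivAt_paramDeriv x).differentiableAt.hasDerivAt
  refine (h0.neg.div ((P.hasDerivAt_theta x).const_mul 2)
    (by positivity : 2 * theta ψ x ≠ 0)).congr_deriv ?_
  simp only [Pi.neg_apply]
  field_simp
  ring

lemma potV1_eq (x : ℝ) : potV1 b κ (theta ψ x)
    = -4 * deriv (deriv ψ) x / theta ψ x - 2 * deriv ψ x ^ 2 / theta ψ x ^ 3 := by
  have ht := P.theta_pos x
  have h0 : deriv (theta ψ) = fun x => -deriv ψ x / (2 * theta ψ x) := funext P.deriv_theta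
  have h1 := (P.hasDerivAt_deriv x).neg.div ((P.hasDerivAt_theta x).const_mul 2)
    (by positivity : 2 * theta ψ x ≠ 0)
  have h2 := P.hasDerivAt_deriv_theta x
  rw [h0] at h2
  have h3 := h2.unique h1
  rw [← P.ode, P.deriv_theta] at h3
  simp only [Pi.neg_apply] at h3
  field_simp at h3 ⊢
  linear_combination (1 / 4) * h3

/-- The derivative of the energy relation `4 θ'² = V(θ, κ)` with respect to `κ`. -/
lemma eight_mul_deriv_mul (x : ℝ) : 8 * deriv (theta ψ) x * deriv (thetaParam b κ ψ) x
    = potV1 b κ (theta ψ x) * thetaParam b κ ψ x + potY b (theta ψ x) := by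
  have ht := P.theta_pos x
  have h1 := P.two_mul_deriv_mul x
  have h2 := P.sq_mul_rem_eq x
  rw [(P.hasDerivAt_thetaParam x).deriv, P.potV1_eq, thetaParam, P.deriv_theta]
  rw [h2] at h1
  field_simp
  linear_combination 8 * theta ψ x ^ 2 * h1

lemma deriv_theta_ne {x : ℝ} (hx : x ≠ 0) : deriv (theta ψ) x ≠ 0 := by
  rw [P.deriv_theta]
  have ht := P.theta_pos x
  refine div_ne_zero (neg_ne_zero.2 ?_) (by positivity)
  rcases lt_or_gt_of_ne hx with h | h
  · exact (P.deriv_pos h).ne'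
  · exact (P.deriv_neg h).ne

lemma continuous_paramDeriv : Continuous (paramDeriv b κ ψ) :=
  continuous_iff_continuousAt.2 fun x => (P.hasDerivAt_paramDeriv x).continuousAt

lemma continuous_deriv_paramDeriv : Continuous (deriv (paramDeriv b κ ψ)) := by
  rw [show deriv (paramDeriv b κ ψ) = _ from funext fun x => (P.hasDerivAt_paramDeriv x).deriv]
  refine (P.contDiff_deriv.continuous.mul
    ((P.continuous_comp (continuousOn_phaseQuot P.hb κ P.gap_ne)).sub continuous_const)).sub
    (Continuous.mul ?_ P.continuous_phaseShift)
  exact (contDiff_infty_iff_deriv.1 P.contDiff_deriv).2.continuous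

lemma continuous_thetaParam : Continuous (thetaParam b κ ψ) :=
  continuous_iff_continuousAt.2 fun x => (P.hasDerivAt_thetaParam x).continuousAt

lemma continuous_deriv_theta : Continuous (deriv (theta ψ)) :=
  P.contDiff_theta.continuous_deriv (by simp)

lemma continuous_deriv_thetaParam : Continuous (deriv (thetaParam b κ ψ)) := by
  rw [show deriv (thetaParam b κ ψ) = _ from funext fun x => (P.hasDerivAt_thetaParam x).deriv]
  exact (P.continuous_deriv_paramDeriv.neg.div (continuous_const.mul P.continuous_theta)
    fun x => (mul_pos two_pos (P.theta_pos x)).ne').add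
    ((P.continuous_paramDeriv.mul P.continuous_deriv_theta).div
      (continuous_const.mul (P.continuous_theta.pow 2))
      fun x => (mul_pos two_pos (pow_pos (P.theta_pos x) 2)).ne')

lemma continuous_schPot : Continuous (schPot b κ ψ) :=
  (P.continuous_comp_theta (continuousOn_potV2 b κ)).div_const 8

lemma continuous_schRhs : Continuous (schRhs b ψ) :=
  continuous_const.mul (P.continuous_comp_theta (continuousOn_potF b))

/-- The relation 8θ'ζ' = V'(θ)ζ + Y(θ) is divided by 8θ' and differentiated. Since θ' vanishes at 0
only, continuity extends the resulting equation to that point. -/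
lemma hasDerivAt_deriv_thetaParam (x : ℝ) : HasDerivAt (deriv (thetaParam b κ ψ))
    (schPot b κ ψ x * thetaParam b κ ψ x - schRhs b ψ x) x := by
  suffices H : ∀ x ≠ 0, HasDerivAt (deriv (thetaParam b κ ψ))
      (schPot b κ ψ x * thetaParam b κ ψ x - schRhs b ψ x) x by
    rcases eq_or_ne x 0 with rfl | hx
    · exact hasDerivAt_of_hasDerivAt_of_ne
        (g := fun x => schPot b κ ψ x * thetaParam b κ ψ x - schRhs b ψ x) H
        P.continuous_deriv_thetaParam.continuousAt
        ((P.continuous_schPot.mul P.continuous_thetaParam).sub P.continuous_schRhs).continuousAt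
    · exact H x hx
  intro x hx
  have hp := P.deriv_theta_ne hx
  have hb1 : b - 1 ≠ 0 := by linarith [P.hb]
  have ht := P.theta_pos x
  have e : deriv (thetaParam b κ ψ) =ᶠ[𝓝 x] fun x =>
      (potV1 b κ (theta ψ x) * thetaParam b κ ψ x + potY b (theta ψ x))
        / (8 * deriv (theta ψ) x) := by
    filter_upwards [isOpen_ne.mem_nhds hx] with y hy
    rw [← P.eight_mul_deriv_mul y]
    have := P.deriv_theta_ne hy
    field_simp
  have hζ := (P.hasDerivAt_thetaParam x).differentiableAt.hasDerivAt
  have h1 := ((hasDerivAt_potV1 (b := b) (κ := κ) ht).comp x (P.hasDerivAt_theta x)).mul hζ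
  have h2 := (hasDerivAt_potY P.hb ht).comp x (P.hasDerivAt_theta x)
  have h3 := (h1.add h2).div ((P.hasDerivAt_deriv_theta x).const_mul 8)
    (mul_ne_zero (by norm_num) hp)
  refine (h3.congr_of_eventuallyEq e).congr_deriv ?_
  have h4 := P.eight_mul_deriv_mul x
  simp only [Function.comp, Pi.add_apply, Pi.mul_apply, schPot, schRhs]
  rw [← h4]
  field_simp
  ring

/-- At the crest ψ' = 0, so only the contribution at fixed phase remains, and R(ψ(0)) > b makes it
nonzero. -/
lemma thetaParam_zero_ne : thetaParam b κ ψ 0 ≠ 0 := by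
  have h0 := mul_dslope_rem b (ψ 0)
  have h1 := P.lt_rem 0
  have h2 := (rem1_pos P.hb (P.lt_one 0)).ne'
  have ht := (P.theta_pos 0).ne'
  have h3 : ψ 0 * phaseQuot b κ (ψ 0) = -(rem b (ψ 0) - b) / (κ * (1 - κ * b) * rem1 b (ψ 0)) := by
    rw [← h0, phaseQuot]; ring
  rw [thetaParam, paramDeriv, P.deriv_zero, h3, zero_mul, sub_zero]
  refine div_ne_zero (neg_ne_zero.2 (div_ne_zero (neg_ne_zero.2 (by linarith)) ?_)) ?_
  · exact mul_ne_zero P.gap_ne h2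
  · exact mul_ne_zero two_ne_zero ht

lemma expDecay_deriv2 : ExpDecay (deriv (deriv ψ)) := by
  obtain ⟨C, hC⟩ := P.bdd_comp (F := fun y => (1 - κ * rem b y) - κ * y * rem1 b y / 2) <|
    (continuousOn_const.sub (continuousOn_const.mul (continuousOn_rem P.hb))).sub
    (((continuousOn_const.mul continuousOn_id).mul (continuousOn_rem1 P.hb)).div_const 2)
  refine P.expDecay.of_le (C := C) fun x => ?_
  rw [P.ode', show ψ x * (1 - κ * rem b (ψ x)) - κ * ψ x ^ 2 * rem1 b (ψ x) / 2
    = ((1 - κ * rem b (ψ x)) - κ * ψ x * rem1 b (ψ x) / 2) * ψ x by ring, abs_mul]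
  exact mul_le_mul_of_nonneg_right (hC x) (abs_nonneg _)

lemma bdd_inv_theta : ∃ C, ∀ x, |(theta ψ x)⁻¹| ≤ C :=
  P.bdd_comp_theta (F := fun t => t⁻¹) (continuousOn_id.inv₀ fun _ ht => ht.ne')

lemma expDecay_paramDeriv : ExpDecay (paramDeriv b κ ψ) := by
  obtain ⟨C, hC⟩ := P.bdd_comp (continuousOn_phaseQuot P.hb κ P.gap_ne)
  obtain ⟨C', hC'⟩ := P.abs_phaseShift_le
  have h1 := P.expDecay.mul_bdd hC
  have h2 := P.expDecay_deriv.mul_abs hC'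
  refine (h1.add (h2.mul_bdd (h := fun _ => -1) (C := 1) fun _ => by simp)).of_le
    (C := 1) fun x => ?_
  rw [one_mul, paramDeriv]
  apply le_of_eq; congr 1; ring

lemma expDecay_deriv_paramDeriv : ExpDecay (deriv (paramDeriv b κ ψ)) := by
  obtain ⟨C, hC⟩ := P.bdd_comp
    (F := fun y => phaseQuot b κ y - b / (2 * (1 - κ * b)))
    ((continuousOn_phaseQuot P.hb κ P.gap_ne).sub continuousOn_const)
  obtain ⟨C', hC'⟩ := P.abs_phaseShift_le
  have h1 := P.expDecay_deriv.mul_bdd hC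
  have h2 := P.expDecay_deriv2.mul_abs hC'
  refine (h1.add (h2.mul_bdd (h := fun _ => -1) (C := 1) fun _ => by simp)).of_le
    (C := 1) fun x => ?_
  rw [one_mul, (P.hasDerivAt_paramDeriv x).deriv]
  apply le_of_eq; congr 1; ring

lemma expDecay_deriv_theta : ExpDecay (deriv (theta ψ)) := by
  obtain ⟨C, hC⟩ := P.bdd_inv_theta
  refine (P.expDecay_deriv.mul_bdd hC).of_le (C := 1 / 2) fun x => ?_
  rw [P.deriv_theta]
  apply le_of_eq
  rw [show -deriv ψ x / (2 * theta ψ x) = -(1 / 2) * ((theta ψ x)⁻¹ * deriv ψ x) by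
    field_simp, abs_mul]
  norm_num

lemma expDecay_deriv2_theta : ExpDecay (deriv (deriv (theta ψ))) := by
  rw [P.deriv_deriv_theta]
  refine (P.expDecay_comp_theta (F := potV1 b κ) (fun _ ht => hasDerivAt_potV1 ht)
    (continuousOn_potV2 b κ) (potV1_one b κ)).of_le (C := 1 / 8) fun x => ?_
  rw [abs_div]; apply le_of_eq; norm_num; ring

lemma bdd_schPot : ∃ K, BddPotential (schPot b κ ψ) K := by
  obtain ⟨C, hC⟩ := P.bdd_comp_theta (F := fun t => potV2 b κ t / 8)
    ((continuousOn_potV2 b κ).div_const 8)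
  exact ⟨C, P.continuous_schPot, hC⟩

lemma expDecay_deriv3_theta : ExpDecay (deriv (deriv (deriv (theta ψ)))) := by
  obtain ⟨K, hK⟩ := P.bdd_schPot
  refine (P.expDecay_deriv_theta.mul_bdd hK.bdd).of_le (C := 1) fun x => ?_
  rw [(P.hasDerivAt_deriv2_theta x).deriv, one_mul, schPot]

lemma expDecay_schRhs : ExpDecay (schRhs b ψ) :=
  (P.expDecay_comp_theta (F := potF b) (fun _ ht => hasDerivAt_potF ht)
    (continuousOn_potF' b) (potF_one b)).mul_bdd (h := fun _ => b / (2 * (b - 1)))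
    (fun _ => le_rfl)

lemma expDecay_thetaParam : ExpDecay (thetaParam b κ ψ) := by
  obtain ⟨C, hC⟩ := P.bdd_inv_theta
  refine (P.expDecay_paramDeriv.mul_bdd hC).of_le (C := 1 / 2) fun x => ?_
  rw [thetaParam]
  apply le_of_eq
  rw [show -paramDeriv b κ ψ x / (2 * theta ψ x)
    = -(1 / 2) * ((theta ψ x)⁻¹ * paramDeriv b κ ψ x) by field_simp, abs_mul]
  norm_num

lemma expDecay_deriv_thetaParam : ExpDecay (deriv (thetaParam b κ ψ)) := by
  obtain ⟨C, hC⟩ := P.bdd_inv_theta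
  obtain ⟨C', hC'⟩ := P.bdd_comp_theta (F := fun t => (t ^ 2)⁻¹)
    ((continuousOn_id.pow 2).inv₀ fun _ ht => pow_ne_zero _ ht.ne')
  have hp : ∃ C, ∀ x, |deriv (theta ψ) x| ≤ C := by
    obtain ⟨C, hC, ν, hν, h⟩ := P.expDecay_deriv_theta
    refine ⟨C, fun x => (h x).trans ?_⟩
    have : Real.exp (-ν * |x|) ≤ 1 := Real.exp_le_one_iff.2 (by nlinarith [abs_nonneg x])
    nlinarith
  obtain ⟨C'', hC''⟩ := hp
  have h1 := (P.expDecay_deriv_paramDeriv.mul_bdd hC).mul_bdd (h := fun _ => -1) (C := 1)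
    fun _ => by simp
  have h2 := (P.expDecay_paramDeriv.mul_bdd hC'').mul_bdd hC'
  refine (h1.add h2).of_le (C := 1 / 2) fun x => ?_
  rw [(P.hasDerivAt_thetaParam x).deriv]
  apply le_of_eq
  have ht := (P.theta_pos x).ne'
  rw [show -deriv (paramDeriv b κ ψ) x / (2 * theta ψ x)
      + paramDeriv b κ ψ x * deriv (theta ψ) x / (2 * theta ψ x ^ 2)
    = (1 / 2) * (-1 * ((theta ψ x)⁻¹ * deriv (paramDeriv b κ ψ) x)
      + (theta ψ x ^ 2)⁻¹ * (deriv (theta ψ) x * paramDeriv b κ ψ x)) by field_simp, abs_mul]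
  norm_num

lemma expDecay_deriv2_thetaParam : ExpDecay (deriv (deriv (thetaParam b κ ψ))) := by
  obtain ⟨K, hK⟩ := P.bdd_schPot
  refine ((P.expDecay_thetaParam.mul_bdd hK.bdd).add (P.expDecay_schRhs.mul_bdd
    (h := fun _ => -1) (C := 1) fun _ => by simp)).of_le (C := 1) fun x => ?_
  rw [(P.hasDerivAt_deriv_thetaParam x).deriv, one_mul]
  apply le_of_eq; congr 1; ring

lemma contDiff_deriv_thetaParam : ContDiff ℝ 1 (deriv (thetaParam b κ ψ)) := by
  rw [contDiff_one_iff_deriv]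
  refine ⟨fun x => (P.hasDerivAt_deriv_thetaParam x).differentiableAt, ?_⟩
  rw [show deriv (deriv (thetaParam b κ ψ)) = _ from
    funext fun x => (P.hasDerivAt_deriv_thetaParam x).deriv]
  exact (P.continuous_schPot.mul P.continuous_thetaParam).sub P.continuous_schRhs

lemma contDiff_thetaParam : ContDiff ℝ 1 (thetaParam b κ ψ) :=
  contDiff_one_iff_deriv.2 ⟨fun x => (P.hasDerivAt_thetaParam x).differentiableAt,
    P.continuous_deriv_thetaParam⟩

end Profile

/-! ### The Riccati supersolution and the spectral data of the wave -/

/-- The Riccati supersolution `θ''/θ' + s ε (ψ/θ')²`. -/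
noncomputable def riccati (ψ : ℝ → ℝ) (r x : ℝ) : ℝ :=
  deriv (deriv (theta ψ)) x / deriv (theta ψ) x + r * (ψ x / deriv (theta ψ) x) ^ 2

/-- The weight of the translational direction in the variable `θ`. -/
noncomputable def transWeight (b : ℝ) (ψ : ℝ → ℝ) (x : ℝ) : ℝ :=
  (theta ψ x ^ (-(2 * b)) / theta ψ x) ^ 2

lemma continuousOn_rpow_neg (b : ℝ) : ContinuousOn (fun t : ℝ => t ^ (-(2 * b))) (Ioi 0) :=
  fun _ ht => (hasDerivAt_rpow_two_mul ht).continuousAt.continuousWithinAt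

lemma abs_eq_one_of_sq_eq_one {s : ℝ} (hs : s ^ 2 = 1) : |s| = 1 := by
  rw [← sq_abs] at hs
  exact (pow_eq_one_iff_of_nonneg (abs_nonneg s) two_ne_zero).1 hs

namespace Profile
variable {b κ : ℝ} {ψ : ℝ → ℝ} (P : Profile b κ ψ)
include P

lemma deriv_eq_theta (x : ℝ) : deriv ψ x = -(2 * theta ψ x * deriv (theta ψ) x) := by
  have ht := (P.theta_pos x).ne'
  rw [P.deriv_theta]; field_simp

lemma quot_eq {x : ℝ} (hx : x ≠ 0) : ψ x / deriv (theta ψ) x = 2 * theta ψ x / logSlope ψ x := by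
  have hp := P.deriv_theta_ne hx
  have ht := (P.theta_pos x).ne'
  have hψ := (P.pos x).ne'
  rw [logSlope, P.deriv_eq_theta]
  field_simp

lemma contDiffAt_riccati (r : ℝ) {x : ℝ} (hx : x ≠ 0) : ContDiffAt ℝ 1 (riccati ψ r) x := by
  have hp := P.deriv_theta_ne hx
  have h1 := (contDiff_infty_iff_deriv.1 P.contDiff_theta).2
  have h2 := (contDiff_infty_iff_deriv.1 h1).2
  have c1 : ContDiffAt ℝ 1 (deriv (theta ψ)) x := (h1.of_le (by simp)).contDiffAt
  have c2 : ContDiffAt ℝ 1 (deriv (deriv (theta ψ))) x := (h2.of_le (by simp)).contDiffAt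
  have c3 : ContDiffAt ℝ 1 ψ x := (P.smooth.of_le (by simp)).contDiffAt
  exact (c2.div c1 hp).add (contDiffAt_const.mul ((c3.div c1 hp).pow 2))

/-- θ''/θ' solves the Riccati equation a' + a² = W exactly. The correction r(ψ/θ')² leaves
-2rψψ'/θ'² at first order in r, which is 4rθψ/θ' because ψ' = -2θθ'. -/
lemma riccati_eval (r : ℝ) {x : ℝ} (hx : x ≠ 0) :
    schPot b κ ψ x - deriv (riccati ψ r) x - riccati ψ r x ^ 2
      = r * (4 * theta ψ x * (ψ x / deriv (theta ψ) x))
        - r ^ 2 * (ψ x / deriv (theta ψ) x) ^ 4 := by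
  have hp := P.deriv_theta_ne hx
  have h1 : HasDerivAt (deriv (theta ψ)) (deriv (deriv (theta ψ)) x) x :=
    (P.hasDerivAt_deriv_theta x).differentiableAt.hasDerivAt
  have h2 := ((P.hasDerivAt_deriv2_theta x).div h1 hp).add
    ((((P.hasDerivAt x).div h1 hp).pow 2).const_mul r)
  have h3 : deriv (riccati ψ r) x = _ := h2.deriv
  rw [h3, riccati, schPot, P.deriv_eq_theta]
  simp only [Pi.div_apply]
  push_cast
  field_simp
  ring

/-- The gap estimate on a set where the logarithmic slope has sign `s` and is bounded below. -/
lemma exists_riccati {D : Set ℝ} {s z : ℝ} (hs : s ^ 2 = 1) (hz : 0 < z)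
    (hD : ∀ x ∈ D, x ≠ 0 ∧ z ≤ s * logSlope ψ x) : ∃ δ > 0, ∃ r, (∃ Ka, ∀ x ∈ D,
      |riccati ψ r x| ≤ Ka) ∧
      ∀ x ∈ D, δ ≤ schPot b κ ψ x - deriv (riccati ψ r) x - riccati ψ r x ^ 2 := by
  obtain ⟨C, hC⟩ := P.comp_theta_le (F := fun t => potV1 b κ t / 8)
    (F' := fun t => potV2 b κ t / 8) (fun t ht => (hasDerivAt_potV1 ht).div_const 8)
    ((continuousOn_potV2 b κ).div_const 8) (by simp)
  set θ₀ := theta ψ 0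
  have hθ₀ : 0 < θ₀ := P.theta_pos 0
  -- Upper bound of |ψ/θ'|: this quotient is 2θ divided by the logarithmic slope, with θ < 1.
  set m := 2 / z with hm
  have hm0 : 0 < m := by positivity
  -- This choice maximizes the lower bound 8εθ₀² - ε²m⁴ of the gap; the maximum is 16θ₀⁴/m⁴.
  set ε := 4 * θ₀ ^ 2 / m ^ 4 with hε
  have hε0 : 0 < ε := by positivity
  have hq : ∀ x ∈ D, 2 * θ₀ ≤ s * (ψ x / deriv (theta ψ) x) ∧
      |ψ x / deriv (theta ψ) x| ≤ m := by
    intro x hx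
    obtain ⟨hx0, hzx⟩ := hD x hx
    have hz1 : s * logSlope ψ x ≤ 1 := by
      have h1 := P.abs_logSlope_le x
      have h2 : |s * logSlope ψ x| ≤ 1 := by
        rw [abs_mul, abs_eq_one_of_sq_eq_one hs, one_mul]; exact h1
      exact (le_abs_self _).trans h2
    have hθ := P.theta_pos x
    have hsz : 0 < s * logSlope ψ x := hz.trans_le hzx
    have e : s * (ψ x / deriv (theta ψ) x) = 2 * theta ψ x / (s * logSlope ψ x) := by
      rw [P.quot_eq hx0]
      have hz0 : logSlope ψ x ≠ 0 := by rintro h; rw [h, mul_zero] at hsz; exact lt_irrefl _ hsz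
      have hs0 : s ≠ 0 := by rintro rfl; norm_num at hs
      field_simp
      linear_combination hs
    have e2 : |ψ x / deriv (theta ψ) x| = |s * (ψ x / deriv (theta ψ) x)| := by
      rw [abs_mul, abs_eq_one_of_sq_eq_one hs, one_mul]
    constructor
    · rw [e, le_div_iff₀ hsz]
      have := P.theta_zero_le x
      nlinarith
    · rw [e2, e, abs_of_pos (by positivity), hm]
      exact div_le_div₀ (by norm_num) (by linarith [P.theta_lt_one x]) hz hzx
  refine ⟨16 * θ₀ ^ 4 / m ^ 4, by positivity, s * ε, ⟨|C| * m + ε * m ^ 2, fun x hx => ?_⟩,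
    fun x hx => ?_⟩
  · obtain ⟨h1, h2⟩ := hq x hx
    rw [riccati]
    refine (abs_add_le _ _).trans (add_le_add ?_ ?_)
    · rw [abs_div, P.deriv_deriv_theta]
      have h3 : |potV1 b κ (theta ψ x) / 8| ≤ |C| * |ψ x| :=
        (hC x).trans (mul_le_mul_of_nonneg_right (le_abs_self _) (abs_nonneg _))
      calc _ ≤ |C| * |ψ x| / |deriv (theta ψ) x| := by gcongr
        _ = |C| * |ψ x / deriv (theta ψ) x| := by rw [abs_div]; ring
        _ ≤ _ := by gcongr
    · rw [abs_mul, abs_mul, abs_eq_one_of_sq_eq_one hs, one_mul, abs_of_pos hε0, abs_pow]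
      gcongr
  · obtain ⟨h1, h2⟩ := hq x hx
    rw [P.riccati_eval _ (hD x hx).1]
    have h4 : (ψ x / deriv (theta ψ) x) ^ 4 ≤ m ^ 4 := by
      rw [← Even.pow_abs (by decide : Even 4)]
      exact pow_le_pow_left₀ (abs_nonneg _) h2 4
    have h5 := P.theta_zero_le x
    have e1 : s * ε * (4 * theta ψ x * (ψ x / deriv (theta ψ) x))
        = 4 * ε * (theta ψ x * (s * (ψ x / deriv (theta ψ) x))) := by ring
    have e2 : θ₀ * (2 * θ₀) ≤ theta ψ x * (s * (ψ x / deriv (theta ψ) x)) :=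
      mul_le_mul h5 h1 (by positivity) (P.theta_pos x).le
    have e3 : (s * ε) ^ 2 = ε ^ 2 := by rw [mul_pow, hs, one_mul]
    have e4 : 16 * θ₀ ^ 4 / m ^ 4 = 4 * ε * (θ₀ * (2 * θ₀)) - ε ^ 2 * m ^ 4 := by
      rw [hε]; field_simp; ring
    rw [e1, e3, e4]
    have e5 := mul_le_mul_of_nonneg_left e2 (by positivity : 0 ≤ 4 * ε)
    have e6 := mul_le_mul_of_nonneg_left h4 (by positivity : 0 ≤ ε ^ 2)
    linarith

lemma hasDerivAt_potY_theta (x : ℝ) : HasDerivAt (fun x => -(potY b (theta ψ x)) / 8)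
    (schRhs b ψ x * deriv (theta ψ) x) x := by
  have hb1 : b - 1 ≠ 0 := by linarith [P.hb]
  refine (((hasDerivAt_potY P.hb (P.theta_pos x)).comp x
    (P.hasDerivAt_theta x)).neg.div_const 8).congr_deriv ?_
  rw [schRhs]; field_simp; ring

lemma expDecay_potY : ExpDecay (fun x => potY b (theta ψ x)) :=
  P.expDecay_comp_theta (F := potY b) (fun _ ht => hasDerivAt_potY P.hb ht)
    (continuousOn_const.mul (continuousOn_potF b)) (potY_one b)

lemma potY_theta_neg (x : ℝ) : potY b (theta ψ x) < 0 := by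
  have h1 := P.sq_mul_rem_eq x
  have h2 := mul_pos (pow_pos (P.pos x) 2) (rem_pos P.hb (P.lt_one x))
  have h3 := pow_pos (P.theta_pos x) 2
  by_contra h
  push Not at h
  have := mul_nonneg h3.le h
  linarith

lemma bdd_deriv_theta : ∃ C, ∀ x, |deriv (theta ψ) x| ≤ C := by
  obtain ⟨C, hC, ν, hν, h⟩ := P.expDecay_deriv_theta
  refine ⟨C, fun x => (h x).trans ?_⟩
  have : Real.exp (-ν * |x|) ≤ 1 := Real.exp_le_one_iff.2 (by nlinarith [abs_nonneg x])
  nlinarith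

theorem spectralData : ∃ K, SpectralData (schPot b κ ψ) (deriv (theta ψ)) (thetaParam b κ ψ)
    (schRhs b ψ) (transWeight b ψ) K := by
  obtain ⟨K, hK⟩ := P.bdd_schPot
  have hsm1 := (contDiff_infty_iff_deriv.1 P.contDiff_theta).2
  have hsm2 := (contDiff_infty_iff_deriv.1 hsm1).2
  have hint : Integrable (fun x => schRhs b ψ x * deriv (theta ψ) x) := by
    obtain ⟨C, hC⟩ := P.bdd_deriv_theta
    refine ((P.expDecay_schRhs.mul_bdd hC).integrable
      (P.continuous_deriv_theta.mul P.continuous_schRhs)).congr (Eventually.of_forall fun x => ?_)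
    simp only; ring
  have hlim : ∀ l : Filter ℝ, Tendsto (fun x => potY b (theta ψ x)) l (𝓝 0) →
      Tendsto (fun x => -(potY b (theta ψ x)) / 8) l (𝓝 0) := fun l h => by
    simpa using h.neg.div_const 8
  -- f θ' is the exact derivative of -Y(θ)/8, so the half-line integrals reduce to the value Y(θ(0))
  -- < 0.
  have hIoi : ∫ x in Ioi (0 : ℝ), schRhs b ψ x * deriv (theta ψ) x = potY b (theta ψ 0) / 8 := by
    rw [integral_Ioi_of_hasDerivAt_of_tendsto' (fun x _ => P.hasDerivAt_potY_theta x)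
      hint.integrableOn (hlim _ P.expDecay_potY.tendsto_atTop)]
    ring
  have hIic : ∫ x in Iic (0 : ℝ), schRhs b ψ x * deriv (theta ψ) x = -(potY b (theta ψ 0) / 8) := by
    rw [integral_Iic_of_hasDerivAt_of_tendsto' (fun x _ => P.hasDerivAt_potY_theta x)
      hint.integrableOn (hlim _ P.expDecay_potY.tendsto_atBot)]
    ring
  have hY := P.potY_theta_neg 0
  have hwc : ContinuousOn (fun t : ℝ => (t ^ (-(2 * b)) / t) ^ 2) (Ioi 0) :=
    ((continuousOn_rpow_neg b).div continuousOn_id fun _ ht => ht.ne').pow 2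
  refine ⟨K, hK, ?_, ?_, ?_, ?_, ?_, ?_, ?_, ?_, ?_, ?_, ?_, ?_, ?_, ?_, ?_, ?_, ?_, ?_⟩
  · exact P.expDecay_deriv_theta.memH1 P.expDecay_deriv2_theta (hsm1.of_le (by simp))
  · exact P.expDecay_deriv2_theta.memH1 P.expDecay_deriv3_theta (hsm2.of_le (by simp))
  · intro x; rw [sub_zero]; exact P.hasDerivAt_deriv2_theta x
  · rw [P.deriv_theta, P.deriv_zero]; simp
  · intro x hx
    rw [P.deriv_theta]
    exact div_pos (by linarith [P.deriv_neg hx]) (mul_pos two_pos (P.theta_pos x))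
  · intro x hx
    rw [P.deriv_theta]
    exact div_neg_of_neg_of_pos (by linarith [P.deriv_pos hx]) (mul_pos two_pos (P.theta_pos x))
  · exact P.expDecay_thetaParam.memH1 P.expDecay_deriv_thetaParam P.contDiff_thetaParam
  · exact P.expDecay_deriv_thetaParam.memH1 P.expDecay_deriv2_thetaParam
      P.contDiff_deriv_thetaParam
  · exact P.hasDerivAt_deriv_thetaParam
  · exact P.thetaParam_zero_ne
  · exact P.expDecay_schRhs.memLp P.continuous_schRhs
  · rw [hIoi]; exact (div_neg_of_neg_of_pos hY (by norm_num)).ne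
  · rw [hIoi, hIic]
  · exact P.continuous_comp_theta hwc
  · intro x
    have := P.theta_pos x
    rw [transWeight]; positivity
  · exact P.bdd_comp_theta hwc
  · intro l hl
    obtain ⟨δ, hδ, r, h1, h2⟩ := P.exists_riccati (D := Ici l) (s := 1) (by norm_num)
      (P.logSlope_pos hl) (fun x hx => ⟨(hl.trans_le hx).ne', by
        rw [one_mul]; exact P.strictMono_logSlope.monotone hx⟩)
    exact ⟨δ, hδ, riccati ψ r, fun x hx =>
      (P.contDiffAt_riccati r (ne_of_gt hx)).contDiffWithinAt, h1, h2⟩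
  · intro l hl
    obtain ⟨δ, hδ, r, h1, h2⟩ := P.exists_riccati (D := Iic l) (s := -1) (by norm_num)
      (neg_pos.2 (P.logSlope_neg hl)) (fun x hx => ⟨(lt_of_le_of_lt hx hl).ne, by
        have := P.strictMono_logSlope.monotone (show x ≤ l from hx); linarith⟩)
    exact ⟨δ, hδ, riccati ψ r, fun x hx =>
      (P.contDiffAt_riccati r (ne_of_lt hx)).contDiffWithinAt, h1, h2⟩

end Profile

/-! ### Differentiation of ∫ Y(θ) in κ through the phase variable -/

/-- The density of `-Q` with respect to the phase variable. -/
noncomputable def phaseDens (b y : ℝ) : ℝ := y * rem b y / ((1 - y) * rem1 b y)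

/-- The derivative of `phaseDens`. -/
noncomputable def phaseDens' (b y : ℝ) : ℝ :=
  ((rem b y + y * rem1 b y) * ((1 - y) * rem1 b y)
    - y * rem b y * (-rem1 b y + (1 - y) * rem2 b y)) / ((1 - y) * rem1 b y) ^ 2

/-- The inverse of `rem b` on `(0, 1)`. -/
noncomputable def remInv (b : ℝ) : ℝ → ℝ := Function.invFunOn (rem b) (Ioo 0 1)

/-- The value of `rem b` at the phase `y`. -/
noncomputable def phaseRem (b κ y : ℝ) : ℝ := (1 - y ^ 2) / κ + b * y ^ 2

section
variable {b : ℝ} (hb : 1 < b)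
include hb

lemma hasDerivAt_phaseDens {y : ℝ} (hy : y < 1) :
    HasDerivAt (phaseDens b) (phaseDens' b y) y := by
  have h0 : (1 - y) * rem1 b y ≠ 0 := mul_ne_zero (by linarith) (rem1_pos hb hy).ne'
  have hd : HasDerivAt (fun y : ℝ => 1 - y) (-1) y := by
    simpa using (hasDerivAt_id y).const_sub 1
  refine (((hasDerivAt_id y).mul (hasDerivAt_rem hb hy)).div (hd.mul (hasDerivAt_rem1 hb hy))
    h0).congr_deriv ?_
  rw [phaseDens']
  simp only [id, Pi.mul_apply]
  congr 1
  ring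

lemma continuousOn_phaseDens' : ContinuousOn (phaseDens' b) (Iio 1) := by
  have h0 := continuousOn_rem hb
  have h1 := continuousOn_rem1 hb
  have h2 := continuousOn_rem2 hb
  have hi : ContinuousOn (fun y : ℝ => y) (Iio 1) := continuousOn_id
  have hs : ContinuousOn (fun y : ℝ => 1 - y) (Iio 1) := continuousOn_const.sub continuousOn_id
  refine ContinuousOn.div ?_ ((hs.mul h1).pow 2) fun y hy => pow_ne_zero _
    (mul_ne_zero (sub_pos.2 hy).ne' (rem1_pos hb hy).ne')
  exact ((h0.add (hi.mul h1)).mul (hs.mul h1)).sub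
    ((hi.mul h0).mul (h1.neg.add (hs.mul h2)))

lemma remInv_rem {y : ℝ} (hy : y ∈ Ioo (0 : ℝ) 1) : remInv b (rem b y) = y := by
  have hinj : InjOn (rem b) (Ioo 0 1) := (strictMonoOn_rem hb).injOn.mono fun z hz => hz.2
  exact hinj.leftInvOn_invFunOn hy

lemma b_lt_rem {y : ℝ} (hy : y ∈ Ioo (0 : ℝ) 1) : b < rem b y := by
  conv_lhs => rw [← rem_zero (b := b)]
  exact strictMonoOn_rem hb (mem_Iio.2 one_pos) hy.2 hy.1

variable (hs : ∀ ρ > b, ∃ y ∈ Ioo (0 : ℝ) 1, rem b y = ρ)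
include hs

lemma remInv_mem {ρ : ℝ} (hρ : b < ρ) : remInv b ρ ∈ Ioo (0 : ℝ) 1 ∧ rem b (remInv b ρ) = ρ := by
  obtain ⟨y, hy, rfl⟩ := hs ρ hρ
  rw [remInv_rem hb hy]; exact ⟨hy, rfl⟩

lemma strictMonoOn_remInv : StrictMonoOn (remInv b) (Ioi b) := by
  intro x hx y hy hxy
  obtain ⟨h1, h2⟩ := remInv_mem hb hs hx
  obtain ⟨h3, h4⟩ := remInv_mem hb hs hy
  by_contra hcon
  have := (strictMonoOn_rem hb).monotoneOn h3.2 h1.2 (not_lt.1 hcon)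
  rw [h2, h4] at this
  linarith

lemma hasDerivAt_remInv {ρ : ℝ} (hρ : b < ρ) :
    HasDerivAt (remInv b) (rem1 b (remInv b ρ))⁻¹ ρ := by
  obtain ⟨h1, h2⟩ := remInv_mem hb hs hρ
  refine HasDerivAt.of_local_left_inverse ?_ (hasDerivAt_rem hb h1.2) (rem1_pos hb h1.2).ne' ?_
  · refine (strictMonoOn_remInv hb hs).continuousAt_of_image_mem_nhds (Ioi_mem_nhds hρ) ?_
    refine mem_of_superset (Ioo_mem_nhds h1.1 h1.2) fun y hy => ?_
    exact ⟨rem b y, b_lt_rem hb hy, remInv_rem hb hy⟩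
  · filter_upwards [Ioi_mem_nhds hρ] with y hy using (remInv_mem hb hs hy).2

omit hb hs in
-- The value is a convex combination of 1/κ > b and b, with positive weight on 1/κ.
lemma lt_phaseRem {κ y : ℝ} (hκ : 0 < κ) (hκb : κ * b < 1) (hy : y ∈ Ioo (-1 : ℝ) 1) :
    b < phaseRem b κ y := by
  have h1 : 0 < 1 - y ^ 2 := by nlinarith [hy.1, hy.2]
  have h2 : b < 1 / κ := by rw [lt_div_iff₀ hκ]; linarith
  have h3 : phaseRem b κ y = (1 - y ^ 2) * (1 / κ) + b * y ^ 2 := by rw [phaseRem]; ring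
  rw [h3]
  nlinarith

lemma hasDerivAt_phaseDens_comp {κ y : ℝ} (hκ : 0 < κ) (hκb : κ * b < 1)
    (hy : y ∈ Ioo (-1 : ℝ) 1) :
    HasDerivAt (fun κ => phaseDens b (remInv b (phaseRem b κ y)))
      (phaseDens' b (remInv b (phaseRem b κ y)) / rem1 b (remInv b (phaseRem b κ y))
        * (-(1 - y ^ 2) / κ ^ 2)) κ := by
  have h1 := lt_phaseRem hκ hκb hy
  have h2 : HasDerivAt (fun κ => phaseRem b κ y) (-(1 - y ^ 2) / κ ^ 2) κ := by
    refine (((hasDerivAt_inv hκ.ne').const_mul (1 - y ^ 2)).add_const (b * y ^ 2)).congr_deriv ?_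
    ring
  have h3 := (hasDerivAt_phaseDens hb (remInv_mem hb hs h1).1.2).comp _
    (hasDerivAt_remInv hb hs h1)
  refine (h3.comp κ h2).congr_deriv ?_
  ring

lemma continuousOn_remInv_phaseRem {κ : ℝ} (hκ : 0 < κ) (hκb : κ * b < 1) :
    ContinuousOn (fun y => remInv b (phaseRem b κ y)) (Ioo (-1) 1) := by
  intro y hy
  have h1 := (hasDerivAt_remInv hb hs (lt_phaseRem hκ hκb hy)).continuousAt
  have h2 : Continuous (phaseRem b κ) := by unfold phaseRem; fun_prop
  exact (ContinuousAt.comp (g := remInv b) h1 h2.continuousAt).continuousWithinAt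

/-- Differentiation of the phase integral with respect to the parameter. -/
lemma hasDerivAt_phaseIntegral {κ : ℝ} (hκ : 0 < κ) (hκb : κ * b < 1) :
    HasDerivAt (fun κ => ∫ y in Ioo (-1 : ℝ) 1, phaseDens b (remInv b (phaseRem b κ y)))
      (∫ y in Ioo (-1 : ℝ) 1, phaseDens' b (remInv b (phaseRem b κ y))
        / rem1 b (remInv b (phaseRem b κ y)) * (-(1 - y ^ 2) / κ ^ 2)) κ := by
  have hb0 : 0 < b := by linarith
  have hκ' : κ < 1 / b := by rw [lt_div_iff₀ hb0]; exact hκb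
  obtain ⟨κ₂, hκ₂, hκ₂b⟩ := exists_between hκ'
  have hκ₂b' : κ₂ * b < 1 := by rw [← lt_div_iff₀ hb0]; exact hκ₂b
  set κ₁ := κ / 2 with hκ₁
  have hκ₁0 : 0 < κ₁ := by positivity
  have hcond : ∀ z ∈ Ioo κ₁ κ₂, 0 < z ∧ z * b < 1 := fun z hz =>
    ⟨hκ₁0.trans hz.1, lt_trans (mul_lt_mul_of_pos_right hz.2 hb0) hκ₂b'⟩
  -- For all parameters above κ₁ the value of R at any phase is at most 1/κ₁. So ψ stays in a
  -- compact part [0,M] of [0,1), where all integrands are bounded.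
  have hρ : b < 1 / κ₁ := by rw [lt_div_iff₀ hκ₁0]; nlinarith
  obtain ⟨hM, hM2⟩ := remInv_mem hb hs hρ
  set M := remInv b (1 / κ₁)
  have hcF : ContinuousOn (fun y => phaseDens' b y / rem1 b y) (Iio 1) :=
    (continuousOn_phaseDens' hb).div (continuousOn_rem1 hb) fun y hy => (rem1_pos hb hy).ne'
  obtain ⟨C, hC⟩ := isCompact_Icc.exists_bound_of_continuousOn
    (hcF.mono (fun y (hy : y ∈ Icc 0 M) => lt_of_le_of_lt hy.2 hM.2))
  have hC0 : 0 ≤ C := (norm_nonneg _).trans (hC 0 ⟨le_rfl, hM.1.le⟩)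
  have hcS := fun z (hz : z ∈ Ioo κ₁ κ₂) =>
    continuousOn_remInv_phaseRem hb hs (hcond z hz).1 (hcond z hz).2
  have hmaps := fun z (hz : z ∈ Ioo κ₁ κ₂) y (hy : y ∈ Ioo (-1 : ℝ) 1) =>
    (remInv_mem hb hs (lt_phaseRem (hcond z hz).1 (hcond z hz).2 hy)).1
  have hcD : ContinuousOn (phaseDens b) (Iio 1) := fun y hy =>
    (hasDerivAt_phaseDens hb hy).continuousAt.continuousWithinAt
  have hκmem : κ ∈ Ioo κ₁ κ₂ := ⟨by rw [hκ₁]; linarith, hκ₂⟩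
  have hcomp := fun z (hz : z ∈ Ioo κ₁ κ₂) =>
    hcD.comp (hcS z hz) fun y hy => (hmaps z hz y hy).2
  have hle : ∀ z ∈ Ioo κ₁ κ₂, ∀ y ∈ Ioo (-1 : ℝ) 1, remInv b (phaseRem b z y) ≤ M := by
    intro z hz y hy
    have h1 := lt_phaseRem (hcond z hz).1 (hcond z hz).2 hy
    refine (strictMonoOn_remInv hb hs).monotoneOn h1 hρ ?_
    have h2 : 1 / z ≤ 1 / κ₁ := one_div_le_one_div_of_le hκ₁0 hz.1.le
    have h3 : 0 < 1 - y ^ 2 := by nlinarith [hy.1, hy.2]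
    have h4 : phaseRem b z y = (1 - y ^ 2) * (1 / z) + b * y ^ 2 := by rw [phaseRem]; ring
    rw [h4]
    nlinarith [sq_nonneg y]
  obtain ⟨C', hC'⟩ := isCompact_Icc.exists_bound_of_continuousOn
    (hcD.mono (fun y (hy : y ∈ Icc 0 M) => lt_of_le_of_lt hy.2 hM.2))
  refine (hasDerivAt_integral_of_dominated_loc_of_deriv_le (s := Ioo κ₁ κ₂)
    (F := fun κ y => phaseDens b (remInv b (phaseRem b κ y)))
    (F' := fun κ y => phaseDens' b (remInv b (phaseRem b κ y))
        / rem1 b (remInv b (phaseRem b κ y)) * (-(1 - y ^ 2) / κ ^ 2))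
    (bound := fun _ => C * (1 / κ₁ ^ 2)) (isOpen_Ioo.mem_nhds hκmem) ?_ ?_ ?_ ?_ ?_ ?_).2
  · filter_upwards [isOpen_Ioo.mem_nhds hκmem] with z hz
    exact (hcomp z hz).aestronglyMeasurable measurableSet_Ioo
  · refine Integrable.of_bound ((hcomp κ hκmem).aestronglyMeasurable measurableSet_Ioo) C' ?_
    rw [ae_restrict_iff' measurableSet_Ioo]
    exact Eventually.of_forall fun y hy =>
      hC' _ ⟨(hmaps κ hκmem y hy).1.le, hle κ hκmem y hy⟩
  · refine ContinuousOn.aestronglyMeasurable ?_ measurableSet_Ioo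
    exact (hcF.comp (hcS κ hκmem) fun y hy => (hmaps κ hκmem y hy).2).mul (by fun_prop)
  · rw [ae_restrict_iff' measurableSet_Ioo]
    refine Eventually.of_forall fun y hy z hz => ?_
    rw [norm_mul]
    refine mul_le_mul (hC _ ⟨(hmaps z hz y hy).1.le, hle z hz y hy⟩) ?_ (norm_nonneg _) hC0
    have h3 : 0 < 1 - y ^ 2 := by nlinarith [hy.1, hy.2]
    rw [Real.norm_eq_abs, abs_div, abs_neg, abs_of_pos h3, abs_of_pos (pow_pos (hcond z hz).1 2)]
    exact div_le_div₀ zero_le_one (by nlinarith [sq_nonneg y]) (by positivity)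
      (pow_le_pow_left₀ hκ₁0.le hz.1.le 2)
  · exact integrableOn_const (by simp)
  · rw [ae_restrict_iff' measurableSet_Ioo]
    exact Eventually.of_forall fun y hy z hz =>
      hasDerivAt_phaseDens_comp hb hs (hcond z hz).1 (hcond z hz).2 hy

end

namespace Profile
variable {b κ : ℝ} {ψ : ℝ → ℝ} (P : Profile b κ ψ)
include P

/-- Change of variables to the phase `y = -ψ'/(ψ sqrt(1 - κ b))`. -/
lemma integral_phase (g : ℝ → ℝ) : ∫ y in Ioo (-1 : ℝ) 1, g y = ∫ x,
    κ * (ψ x * rem1 b (ψ x)) / 2 / Real.sqrt (1 - κ * b)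
      * g (logSlope ψ x / Real.sqrt (1 - κ * b)) := by
  set z := Real.sqrt (1 - κ * b) with hz
  have hz0 : 0 < z := Real.sqrt_pos.2 P.gap_pos
  have hz2 : z ^ 2 = 1 - κ * b := Real.sq_sqrt P.gap_pos.le
  set f := fun x => logSlope ψ x / z with hf
  have hd : ∀ x, HasDerivAt f (κ * (ψ x * rem1 b (ψ x)) / 2 / z) x :=
    fun x => (P.hasDerivAt_logSlope x).div_const z
  have hmono : StrictMono f := fun x y hxy =>
    div_lt_div_of_pos_right (P.strictMono_logSlope hxy) hz0
  have hsq : ∀ x, f x ^ 2 < 1 := fun x => by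
    rw [hf]; simp only
    rw [div_pow, hz2, div_lt_one P.gap_pos]; exact P.logSlope_sq_lt x
  -- As ψ tends to 0, R(ψ) tends to b and the squared slope to 1 - κb, so the phase exhausts (-1,1).
  have hlim : ∀ l : Filter ℝ, Tendsto ψ l (𝓝 0) → Tendsto (fun x => |f x|) l (𝓝 1) := by
    intro l hl
    have h1 : Tendsto (fun x => logSlope ψ x ^ 2) l (𝓝 (1 - κ * rem b 0)) :=
      ((((hasDerivAt_rem P.hb one_pos).continuousAt.tendsto.comp hl).const_mul κ).const_sub
        1).congr fun x => (P.logSlope_sq x).symm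
    rw [rem_zero] at h1
    have h2 := (Real.continuous_sqrt.tendsto _).comp (h1.div_const (z ^ 2))
    rw [hz2, div_self P.gap_pos.ne', Real.sqrt_one] at h2
    refine h2.congr fun x => ?_
    rw [Function.comp, ← hz2, ← div_pow, Real.sqrt_sq_eq_abs]
  have himg : f '' univ = Ioo (-1) 1 := by
    rw [image_univ]
    ext y
    constructor
    · rintro ⟨x, rfl⟩
      have := hsq x
      exact ⟨by nlinarith, by nlinarith⟩
    · intro hy
      have hyabs : |y| < 1 := abs_lt.2 hy
      refine mem_range_of_exists_le_of_exists_ge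
        (continuous_iff_continuousAt.2 fun x => (hd x).continuousAt) ?_ ?_
      · obtain ⟨x, h1, h2⟩ := (((hlim _ P.tendsto_atBot).eventually_const_lt hyabs).and
          (eventually_lt_atBot 0)).exists
        refine ⟨x, ?_⟩
        have h3 : f x < 0 := div_neg_of_neg_of_pos (P.logSlope_neg h2) hz0
        rw [abs_of_neg h3] at h1
        linarith [neg_abs_le y]
      · obtain ⟨x, h1, h2⟩ := (((hlim _ P.tendsto_atTop).eventually_const_lt hyabs).and
          (eventually_gt_atTop 0)).exists
        refine ⟨x, ?_⟩
        have h3 : 0 < f x := div_pos (P.logSlope_pos h2) hz0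
        rw [abs_of_pos h3] at h1
        linarith [le_abs_self y]
  have key := integral_image_eq_integral_abs_deriv_smul MeasurableSet.univ
    (fun x _ => (hd x).hasDerivWithinAt) hmono.injective.injOn g
  rw [himg, setIntegral_univ] at key
  rw [key]
  congr 1; funext x
  have h1 := rem1_pos P.hb (P.lt_one x)
  have h2 := P.pos x
  have h3 := P.κ_pos
  rw [smul_eq_mul, abs_of_pos (by positivity)]

lemma phaseRem_logSlope (x : ℝ) :
    phaseRem b κ (logSlope ψ x / Real.sqrt (1 - κ * b)) = rem b (ψ x) := by
  have h1 := P.gap_pos.ne'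
  have h2 := P.κ_pos.ne'
  rw [phaseRem, div_pow, Real.sq_sqrt P.gap_pos.le, P.logSlope_sq]
  field_simp
  ring

lemma mem_Ioo (x : ℝ) : ψ x ∈ Ioo (0 : ℝ) 1 := ⟨P.pos x, P.lt_one x⟩

lemma potY_eq (x : ℝ) : potY b (theta ψ x) = -(ψ x * rem1 b (ψ x) * phaseDens b (ψ x)) := by
  have h1 := P.sq_mul_rem_eq x
  have h2 := (rem1_pos P.hb (P.lt_one x)).ne'
  have h3 := (P.one_sub_pos x).ne'
  rw [P.theta_sq] at h1
  rw [phaseDens]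
  field_simp
  linarith

/-- The factor ψR'(ψ) in Y is absorbed by the Jacobian of the phase. The right-hand side depends on
b and κ only, not on how the profile was chosen. -/
lemma integral_potY : ∫ x, potY b (theta ψ x) = -(2 * Real.sqrt (1 - κ * b) / κ) *
    ∫ y in Ioo (-1 : ℝ) 1, phaseDens b (remInv b (phaseRem b κ y)) := by
  have hz0 := (Real.sqrt_pos.2 P.gap_pos).ne'
  have hκ := P.κ_pos.ne'
  rw [P.integral_phase, ← integral_const_mul]
  congr 1; funext x
  rw [P.phaseRem_logSlope, remInv_rem P.hb (P.mem_Ioo x), P.potY_eq]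
  field_simp

/-- The pointwise identity behind the derivative of `Q`. -/
lemma phase_identity {x : ℝ} (hx : x ≠ 0) :
    -(2 - κ * b) / (2 * κ * (1 - κ * b)) * potY b (theta ψ x)
      + ψ x * phaseDens' b (ψ x) * (rem b (ψ x) - b) / (κ * (1 - κ * b))
    = -8 * (schRhs b ψ x * thetaParam b κ ψ x)
      + (-8 * (schRhs b ψ x * deriv (theta ψ) x) * phaseShift b κ ψ x
        + potY b (theta ψ x) * phaseRate b κ (ψ x)) := by
  have hb := P.hb
  have h1 := (rem1_pos hb (P.lt_one x)).ne'
  have hψ := (P.pos x).ne'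
  have ht := (P.theta_pos x).ne'
  have hp := P.deriv_theta_ne hx
  obtain ⟨hκ, hq⟩ := mul_ne_zero_iff.1 P.gap_ne
  have hds := mul_dslope_rem b (ψ x)
  -- the derivative of `Y` with respect to `ψ`
  have hYψ : 4 * schRhs b ψ x / theta ψ x = -((rem1 b (ψ x) + ψ x * rem2 b (ψ x))
      * phaseDens b (ψ x) + ψ x * rem1 b (ψ x) * phaseDens' b (ψ x)) := by
    have d1 := (P.hasDerivAt_potY_theta x).const_mul (-8)
    have d2 := (((hasDerivAt_id (ψ x)).mul (hasDerivAt_rem1 hb (P.lt_one x))).mul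
      (hasDerivAt_phaseDens hb (P.lt_one x))).neg.comp x (P.hasDerivAt x)
    have e : (fun x => -8 * (-(potY b (theta ψ x)) / 8))
        = (-((id * rem1 b) * phaseDens b)) ∘ ψ := by
      funext y
      simp only [Function.comp, Pi.neg_apply, Pi.mul_apply, id]
      rw [P.potY_eq]; ring
    rw [e] at d1
    have d3 := d1.unique d2
    rw [P.deriv_eq_theta] at d3
    simp only [Pi.mul_apply, id, one_mul] at d3
    refine mul_right_cancel₀ (mul_ne_zero (mul_ne_zero two_ne_zero ht) hp) ?_
    have e4 : 4 * schRhs b ψ x / theta ψ x * (2 * theta ψ x * deriv (theta ψ) x)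
        = 8 * (schRhs b ψ x * deriv (theta ψ) x) := by field_simp; ring
    rw [e4]
    linear_combination -d3
  have hX : ψ x * phaseQuot b κ (ψ x) = -(rem b (ψ x) - b) / (κ * (1 - κ * b) * rem1 b (ψ x)) := by
    rw [← hds, phaseQuot]; ring
  have hζ : -8 * (schRhs b ψ x * thetaParam b κ ψ x)
      = 4 * schRhs b ψ x / theta ψ x * (ψ x * phaseQuot b κ (ψ x))
        + 8 * (schRhs b ψ x * deriv (theta ψ) x) * phaseShift b κ ψ x := by
    rw [thetaParam, paramDeriv, P.deriv_eq_theta]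
    field_simp
    ring
  have hD : phaseQuot b κ (ψ x)
      = -(rem b (ψ x) - b) / (κ * (1 - κ * b) * rem1 b (ψ x)) / ψ x := by
    rw [← hX]; field_simp
  rw [hζ, hYψ, phaseRate, phaseDeriv, P.potY_eq, hD]
  generalize phaseDens b (ψ x) = H at *
  generalize phaseDens' b (ψ x) = H' at *
  field_simp
  ring

lemma integrable_phase : Integrable (fun x =>
    ψ x * phaseDens' b (ψ x) * (rem b (ψ x) - b) / (κ * (1 - κ * b))) := by
  have hc : ContinuousOn (fun y => phaseDens' b y * (rem b y - b) / (κ * (1 - κ * b))) (Iio 1) :=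
    ((continuousOn_phaseDens' P.hb).mul ((continuousOn_rem P.hb).sub
      continuousOn_const)).div_const _
  obtain ⟨C, hC⟩ := P.bdd_comp hc
  refine ((P.expDecay.mul_bdd hC).integrable ((P.continuous_comp hc).mul P.continuous)).congr
    (Eventually.of_forall fun x => ?_)
  simp only; ring

/-- The phase integral is differentiated over a fixed interval, so no regularity of κ' ↦ Ψ κ' is
needed. Back in the variable x, the integrand equals -8 f ζ up to the derivative of Y(θ) times the
phase shift. -/
theorem hasDerivAt_integral_potY {Ψ : ℝ → ℝ → ℝ}
    (hΨ : ∀ κ', 0 < κ' → κ' * b < 1 → Profile b κ' (Ψ κ')) :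
    HasDerivAt (fun κ' => ∫ x, potY b (theta (Ψ κ') x))
      (-8 * inner2 (schRhs b ψ) (thetaParam b κ ψ)) κ := by
  have hb := P.hb
  have hb0 : 0 < b := by linarith
  -- R maps (0,1) onto (b,∞) because waves exist: the crest of the wave with κ = 1/ρ satisfies
  -- κR(ψ(0)) = 1.
  have hs : ∀ ρ > b, ∃ y ∈ Ioo (0 : ℝ) 1, rem b y = ρ := by
    intro ρ hρ
    have hρ0 : 0 < ρ := hb0.trans hρ
    have P' := hΨ (1 / ρ) (by positivity) (by rw [one_div_mul_eq_div, div_lt_one hρ0]; exact hρ)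
    refine ⟨Ψ (1 / ρ) 0, P'.mem_Ioo 0, ?_⟩
    have h1 := P'.logSlope_sq 0
    rw [P'.logSlope_zero] at h1
    field_simp at h1
    linarith
  obtain ⟨hκ, hq⟩ := mul_ne_zero_iff.1 P.gap_ne
  set z := Real.sqrt (1 - κ * b) with hz
  have hz0 : 0 < z := Real.sqrt_pos.2 P.gap_pos
  have hz2 : z ^ 2 = 1 - κ * b := Real.sq_sqrt P.gap_pos.le
  have h1 := hasDerivAt_phaseIntegral hb hs P.κ_pos P.κ_lt
  have h2 : HasDerivAt (fun κ => -(2 * Real.sqrt (1 - κ * b) / κ))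
      (-(2 * z / κ) * (-(2 - κ * b) / (2 * κ * (1 - κ * b)))) κ := by
    have hd : HasDerivAt (fun κ : ℝ => 1 - κ * b) (-b) κ := by
      simpa using ((hasDerivAt_id κ).mul_const b).const_sub 1
    refine (((hd.sqrt P.gap_pos.ne').const_mul 2).div (hasDerivAt_id κ) hκ).neg.congr_deriv ?_
    rw [← hz, ← hz2]
    simp only [id]
    field_simp
    linear_combination 2 * hz2
  have h3 := h2.mul h1
  have e : (fun κ' => ∫ x, potY b (theta (Ψ κ') x)) =ᶠ[𝓝 κ] fun κ =>
      -(2 * Real.sqrt (1 - κ * b) / κ) *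
        ∫ y in Ioo (-1 : ℝ) 1, phaseDens b (remInv b (phaseRem b κ y)) := by
    have o1 : ∀ᶠ κ' in 𝓝 κ, 0 < κ' := Ioi_mem_nhds P.κ_pos
    have o2 : ∀ᶠ κ' in 𝓝 κ, κ' * b < 1 :=
      ((continuous_id.mul continuous_const).tendsto κ).eventually_lt_const P.κ_lt
    filter_upwards [o1, o2] with κ' i1 i2 using (hΨ κ' i1 i2).integral_potY
  refine (h3.congr_of_eventuallyEq e).congr_deriv ?_
  have e1 := P.integral_potY
  rw [← hz] at e1 ⊢
  have e2 : -(2 * z / κ) * (-(2 - κ * b) / (2 * κ * (1 - κ * b))) *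
      ∫ y in Ioo (-1 : ℝ) 1, phaseDens b (remInv b (phaseRem b κ y))
      = ∫ x, -(2 - κ * b) / (2 * κ * (1 - κ * b)) * potY b (theta ψ x) := by
    rw [integral_const_mul, e1]; ring
  have hcY : Continuous (fun x => potY b (theta ψ x)) :=
    P.continuous_comp_theta fun t ht => (hasDerivAt_potY hb ht).continuousAt.continuousWithinAt
  have e3 : -(2 * z / κ) * ∫ y in Ioo (-1 : ℝ) 1, phaseDens' b (remInv b (phaseRem b κ y))
        / rem1 b (remInv b (phaseRem b κ y)) * (-(1 - y ^ 2) / κ ^ 2)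
      = ∫ x, ψ x * phaseDens' b (ψ x) * (rem b (ψ x) - b) / (κ * (1 - κ * b)) := by
    rw [P.integral_phase, ← integral_const_mul]
    congr 1; funext x
    rw [P.phaseRem_logSlope, remInv_rem hb (P.mem_Ioo x), div_pow, P.logSlope_sq, ← hz, hz2]
    have := (rem1_pos hb (P.lt_one x)).ne'
    field_simp
    ring
  rw [e2, e3, ← integral_add ((P.expDecay_potY.integrable hcY).const_mul _) P.integrable_phase]
  have iζ : Integrable (fun x => schRhs b ψ x * thetaParam b κ ψ x) :=
    integrable_mul_of_memLp (P.expDecay_schRhs.memLp P.continuous_schRhs)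
      (P.expDecay_thetaParam.memLp P.continuous_thetaParam)
  obtain ⟨C, hC⟩ := P.abs_phaseShift_le
  have hYg : ∀ x, HasDerivAt (fun x => potY b (theta ψ x) * phaseShift b κ ψ x)
      (-8 * (schRhs b ψ x * deriv (theta ψ) x) * phaseShift b κ ψ x
        + potY b (theta ψ x) * phaseRate b κ (ψ x)) x := by
    intro x
    have d1 := (P.hasDerivAt_potY_theta x).const_mul (-8)
    have e : (fun x => -8 * (-(potY b (theta ψ x)) / 8)) = fun x => potY b (theta ψ x) := by
      funext y; ring
    rw [e] at d1
    exact d1.mul (P.hasDerivAt_phaseShift x)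
  have dYg := P.expDecay_potY.mul_abs hC
  have iD : Integrable (fun x => -8 * (schRhs b ψ x * deriv (theta ψ) x) * phaseShift b κ ψ x
        + potY b (theta ψ x) * phaseRate b κ (ψ x)) := by
    obtain ⟨C₁, hC₁⟩ := P.bdd_deriv_theta
    obtain ⟨C₂, hC₂⟩ := P.bdd_comp (continuousOn_phaseRate P.hb κ P.gap_ne)
    have d1 := ((P.expDecay_schRhs.mul_bdd hC₁).mul_abs hC).mul_bdd (h := fun _ => (-8 : ℝ))
      (fun _ => le_rfl)
    have d2 := P.expDecay_potY.mul_bdd hC₂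
    refine ((d1.add d2).integrable ?_).congr (Eventually.of_forall fun x => ?_)
    · exact (continuous_const.mul (P.continuous_phaseShift.mul
        (P.continuous_deriv_theta.mul P.continuous_schRhs))).add (P.continuous_phaseRate.mul hcY)
    · simp only; ring
  -- The boundary values vanish since Y(θ) decays exponentially and the phase shift grows at most
  -- linearly.
  have hD0 : ∫ x, (-8 * (schRhs b ψ x * deriv (theta ψ) x) * phaseShift b κ ψ x
        + potY b (theta ψ x) * phaseRate b κ (ψ x)) = 0 := by
    have hl : (fun x => potY b (theta ψ x) * phaseShift b κ ψ x)
        = fun x => phaseShift b κ ψ x * potY b (theta ψ x) := by funext x; ring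
    rw [integral_of_hasDerivAt_of_tendsto hYg iD (m := 0) (n := 0)
      (by rw [hl]; exact dYg.tendsto_atBot) (by rw [hl]; exact dYg.tendsto_atTop), sub_zero]
  rw [inner2, ← integral_const_mul, ← add_zero (∫ x, -8 * (schRhs b ψ x * thetaParam b κ ψ x)),
    ← hD0, ← integral_add (iζ.const_mul _) iD]
  refine integral_congr_ae ?_
  filter_upwards [compl_mem_ae_iff.2 (measure_singleton (0 : ℝ))] with x hx
  exact P.phase_identity hx

end Profile

/-! ### Taylor estimates and bounds in H¹ -/

lemma abs_sub_le_of_hasDerivAt {F F' : ℝ → ℝ} {l u K : ℝ}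
    (h1 : ∀ t ∈ Icc l u, HasDerivAt F (F' t) t) (hK : ∀ t ∈ Icc l u, |F' t| ≤ K) {x y : ℝ}
    (hx : x ∈ Icc l u) (hy : y ∈ Icc l u) : |F y - F x| ≤ K * |y - x| :=
  (convex_Icc l u).norm_image_sub_le_of_norm_hasDerivWithin_le
    (fun t ht => (h1 t ht).hasDerivWithinAt) hK hx hy

/-- The constant K, in place of K/2, comes from the mean value inequality applied to F(t) - F'(x)(t
- x); it suffices for the remainders below. -/
lemma taylor_two {F F' F'' : ℝ → ℝ} {l u K : ℝ} (h1 : ∀ t ∈ Icc l u, HasDerivAt F (F' t) t)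
    (h2 : ∀ t ∈ Icc l u, HasDerivAt F' (F'' t) t) (hK : ∀ t ∈ Icc l u, |F'' t| ≤ K) {x y : ℝ}
    (hx : x ∈ Icc l u) (hy : y ∈ Icc l u) : |F y - F x - F' x * (y - x)| ≤ K * (y - x) ^ 2 := by
  have hK0 : 0 ≤ K := (abs_nonneg _).trans (hK x hx)
  have hsub : uIcc x y ⊆ Icc l u := uIcc_subset_Icc hx hy
  have h := (convex_uIcc x y).norm_image_sub_le_of_norm_hasDerivWithin_le
    (f := fun t => F t - F' x * (t - x)) (f' := fun t => F' t - F' x) (C := K * |y - x|)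
    (fun t ht => by
      have := (h1 t (hsub ht)).sub (((hasDerivAt_id t).sub_const x).const_mul (F' x))
      rw [mul_one] at this
      exact this.hasDerivWithinAt)
    (fun t ht => (abs_sub_le_of_hasDerivAt h2 hK hx (hsub ht)).trans
      (mul_le_mul_of_nonneg_left (abs_sub_left_of_mem_uIcc ht) hK0)) left_mem_uIcc right_mem_uIcc
  simp only [Real.norm_eq_abs, sub_self, mul_zero, sub_zero] at h
  rw [mul_assoc, ← pow_two, sq_abs] at h
  rwa [sub_right_comm]

lemma taylor_three {F F' F'' F''' : ℝ → ℝ} {l u K : ℝ}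
    (h1 : ∀ t ∈ Icc l u, HasDerivAt F (F' t) t) (h2 : ∀ t ∈ Icc l u, HasDerivAt F' (F'' t) t)
    (h3 : ∀ t ∈ Icc l u, HasDerivAt F'' (F''' t) t) (hK : ∀ t ∈ Icc l u, |F''' t| ≤ K) {x y : ℝ}
    (hx : x ∈ Icc l u) (hy : y ∈ Icc l u) :
    |F y - F x - F' x * (y - x) - F'' x / 2 * (y - x) ^ 2| ≤ K * |y - x| ^ 3 := by
  have hK0 : 0 ≤ K := (abs_nonneg _).trans (hK x hx)
  have hsub : uIcc x y ⊆ Icc l u := uIcc_subset_Icc hx hy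
  have h := (convex_uIcc x y).norm_image_sub_le_of_norm_hasDerivWithin_le
    (f := fun t => F t - F' x * (t - x) - F'' x / 2 * (t - x) ^ 2)
    (f' := fun t => F' t - F' x - F'' x * (t - x)) (C := K * (y - x) ^ 2)
    (fun t ht => by
      have hd := (hasDerivAt_id t).sub_const x
      refine (((h1 t (hsub ht)).sub (hd.const_mul (F' x))).sub
        ((hd.pow 2).const_mul (F'' x / 2))).hasDerivWithinAt.congr_deriv ?_
      simp only [id]
      push_cast
      ring)
    (fun t ht => (taylor_two h2 h3 hK hx (hsub ht)).trans
      (mul_le_mul_of_nonneg_left (sq_le_sq.2 (abs_sub_left_of_mem_uIcc ht)) hK0))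
    left_mem_uIcc right_mem_uIcc
  simp only [Real.norm_eq_abs, sub_self, mul_zero, sub_zero] at h
  have e : F y - F' x * (y - x) - F'' x / 2 * (y - x) ^ 2 - (F x - F'' x / 2 * 0 ^ 2)
    = F y - F x - F' x * (y - x) - F'' x / 2 * (y - x) ^ 2 := by ring
  rw [e] at h
  refine h.trans (le_of_eq ?_)
  rw [← sq_abs]; ring

/-- Domination in `H¹`. -/
lemma memH1_of_le {f h : ℝ → ℝ} (hf : LocAC f) (hh : MemH1 h) {A : ℝ} (hA : 0 ≤ A)
    (h1 : ∀ x, |f x| ≤ A * |h x|) (h2 : ∀ᵐ x, |deriv f x| ≤ A * (|h x| + |deriv h x|)) :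
    MemH1 f ∧ h1Norm f ≤ 2 * A * h1Norm h := by
  have m1 : MemH1 f := by
    refine ⟨hf, hh.2.1.of_le_mul (c := A) hf.continuous.aestronglyMeasurable
      (Eventually.of_forall h1), (hh.2.1.abs.add hh.2.2.abs).of_le_mul (c := A)
      (measurable_deriv f).aestronglyMeasurable ?_⟩
    filter_upwards [h2] with x hx
    refine hx.trans (mul_le_mul_of_nonneg_left ?_ hA)
    simpa using le_abs_self (|h x| + |deriv h x|)
  refine ⟨m1, _root_.le_of_sq_le_sq ?_ (by have := h1Norm_nonneg h; positivity)⟩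
  rw [mul_pow, h1Norm_sq, h1Norm_sq, ← integral_const_mul]
  refine integral_mono_ae m1.integrable_sq_add (hh.integrable_sq_add.const_mul _) ?_
  filter_upwards [h2] with x hx
  have e1 : f x ^ 2 ≤ A ^ 2 * h x ^ 2 := by
    rw [← sq_abs, ← sq_abs (h x), ← mul_pow]
    exact pow_le_pow_left₀ (abs_nonneg _) (h1 x) 2
  have e2 : deriv f x ^ 2 ≤ A ^ 2 * (2 * (h x ^ 2 + deriv h x ^ 2)) := by
    rw [← sq_abs (deriv f x), ← sq_abs (h x), ← sq_abs (deriv h x)]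
    refine (pow_le_pow_left₀ (abs_nonneg _) hx 2).trans ?_
    rw [mul_pow]
    exact mul_le_mul_of_nonneg_left (sq_add_two_le _ _) (sq_nonneg A)
  have := sq_nonneg (A * deriv h x)
  have := sq_nonneg (A * h x)
  nlinarith

lemma BddPotential.abs_form_le {W : ℝ → ℝ} {K : ℝ} (hW : BddPotential W K) {σ τ : ℝ → ℝ}
    (hσ : MemH1 σ) (hτ : MemH1 τ) : |schForm W σ τ| ≤ (1 + K) * (h1Norm σ * h1Norm τ) := by
  have hK := hW.nonneg
  have sσ := hσ.h1Norm_sq_eq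
  have sτ := hτ.h1Norm_sq_eq
  have p1 : 0 ≤ ∫ x, σ x ^ 2 := integral_nonneg fun x => sq_nonneg _
  have p2 : 0 ≤ ∫ x, deriv σ x ^ 2 := integral_nonneg fun x => sq_nonneg _
  have p3 : 0 ≤ ∫ x, τ x ^ 2 := integral_nonneg fun x => sq_nonneg _
  have p4 : 0 ≤ ∫ x, deriv τ x ^ 2 := integral_nonneg fun x => sq_nonneg _
  have n1 := h1Norm_nonneg σ
  have n2 := h1Norm_nonneg τ
  have a1 : |∫ x, deriv σ x * deriv τ x| ≤ h1Norm σ * h1Norm τ := by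
    refine abs_le_of_sq_le_sq ?_ (by positivity)
    refine (integral_mul_sq_le hσ.2.2 hτ.2.2).trans ?_
    rw [mul_pow]
    exact mul_le_mul (by linarith) (by linarith) p4 (by positivity)
  have hWτ := memLp_mul_bdd hτ.2.1 hW.cont.aestronglyMeasurable hW.bdd
  have a2 : |∫ x, σ x * (W x * τ x)| ≤ K * (h1Norm σ * h1Norm τ) := by
    refine abs_le_of_sq_le_sq ?_ (by positivity)
    refine (integral_mul_sq_le hσ.2.1 hWτ).trans ?_
    have : ∫ x, (W x * τ x) ^ 2 ≤ K ^ 2 * ∫ x, τ x ^ 2 := by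
      rw [← integral_const_mul]
      refine integral_mono hWτ.integrable_sq (hτ.2.1.integrable_sq.const_mul _) fun x => ?_
      simp only
      rw [mul_pow]
      exact mul_le_mul_of_nonneg_right (sq_le_sq' (neg_le_of_abs_le (hW.bdd x))
        (le_of_abs_le (hW.bdd x))) (sq_nonneg _)
    have e : (K * (h1Norm σ * h1Norm τ)) ^ 2 = h1Norm σ ^ 2 * (K ^ 2 * h1Norm τ ^ 2) := by ring
    rw [e]
    refine mul_le_mul (by linarith) (this.trans ?_) (integral_nonneg fun x => sq_nonneg _)
      (by positivity)
    exact mul_le_mul_of_nonneg_left (by linarith) (sq_nonneg K)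
  have e : schForm W σ τ = (∫ x, deriv σ x * deriv τ x) + ∫ x, σ x * (W x * τ x) := by
    rw [schForm, ← integral_add (integrable_mul_of_memLp hσ.2.2 hτ.2.2)
      (integrable_mul_of_memLp hσ.2.1 hWτ)]
    congr 1; funext x; ring
  rw [e]
  refine (abs_add_le _ _).trans ?_
  linarith

/-! ### The action as a kinetic plus a potential energy -/

/-- The variable `s = (m / k)^(-1/(2b))`, in which the action is a sum of a kinetic and a
potential energy; `scaleDeriv b k n` is its `n`-th derivative. -/
noncomputable def scaleDeriv (b k : ℝ) : ℕ → ℝ → ℝ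
  | 0, m => (m / k) ^ (-(1 / (2 * b)))
  | n + 1, m => (-(1 / (2 * b)) - n) / m * scaleDeriv b k n m

section
variable {b k : ℝ} (hk : 0 < k)
include hk

lemma scaleDeriv_eq (n : ℕ) : ∃ A : ℝ, ∀ m > 0,
    scaleDeriv b k n m = A * (m / k) ^ (-(1 / (2 * b)) - n) := by
  induction n with
  | zero => exact ⟨1, fun m _ => by simp [scaleDeriv]⟩
  | succ n ih =>
    obtain ⟨A, hA⟩ := ih
    refine ⟨(-(1 / (2 * b)) - n) / k * A, fun m hm => ?_⟩
    rw [scaleDeriv, hA m hm]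
    have : -(1 / (2 * b)) - ((n + 1 : ℕ) : ℝ) = -(1 / (2 * b)) - n - 1 := by push_cast; ring
    rw [this, Real.rpow_sub_one (div_pos hm hk).ne']
    field_simp

lemma hasDerivAt_scaleDeriv (n : ℕ) {m : ℝ} (hm : 0 < m) :
    HasDerivAt (scaleDeriv b k n) (scaleDeriv b k (n + 1) m) m := by
  obtain ⟨A, hA⟩ := scaleDeriv_eq (b := b) hk n
  have h1 : HasDerivAt (fun m : ℝ => m / k) (1 / k) m := (hasDerivAt_id m).div_const k
  have h2 := (h1.rpow_const (p := -(1 / (2 * b)) - n) (Or.inl (div_pos hm hk).ne')).const_mul A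
  refine (h2.congr_of_eventuallyEq ?_).congr_deriv ?_
  · filter_upwards [Ioi_mem_nhds hm] with y hy using hA y hy
  · rw [scaleDeriv, hA m hm, Real.rpow_sub_one (div_pos hm hk).ne']
    field_simp

lemma continuousOn_scaleDeriv (n : ℕ) : ContinuousOn (scaleDeriv b k n) (Ioi 0) := fun _ hm =>
  (hasDerivAt_scaleDeriv hk n hm).continuousAt.continuousWithinAt

lemma scaleDeriv_zero_pos {m : ℝ} (hm : 0 < m) : 0 < scaleDeriv b k 0 m :=
  Real.rpow_pos_of_pos (div_pos hm hk) _

lemma scaleDeriv_zero_self : scaleDeriv b k 0 k = 1 := by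
  rw [scaleDeriv, div_self hk.ne', Real.one_rpow]

lemma contDiffOn_scaleDeriv_zero {l u : ℝ} (hl : 0 < l) :
    ContDiffOn ℝ 1 (scaleDeriv b k 0) (Icc l u) := by
  intro m hm
  have hm0 : 0 < m := hl.trans_le hm.1
  exact ((contDiffAt_id.div_const k).rpow_const_of_ne
    (div_pos hm0 hk).ne').contDiffWithinAt

lemma scaleDeriv_zero_mul_rpow {t : ℝ} (hb : 1 < b) (ht : 0 < t) :
    scaleDeriv b k 0 (k * t ^ (-(2 * b))) = t := by
  rw [scaleDeriv, mul_div_cancel_left₀ _ hk.ne', ← Real.rpow_mul ht.le]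
  have : -(2 * b) * -(1 / (2 * b)) = 1 := by field_simp
  rw [this, Real.rpow_one]

end

lemma continuous_of_mem_X {k : ℝ} {m : ℝ → ℝ} (hm : m ∈ X k) : Continuous m :=
  (hm.1.continuous.add (continuous_const (y := k))).congr fun _ => sub_add_cancel _ _

/-- Pointwise positivity becomes a uniform lower bound because m tends to k > 0 at both ends. -/
lemma X_bounds {k : ℝ} (hk : 0 < k) {m : ℝ → ℝ} (hm : m ∈ X k) :
    ∃ l u, 0 < l ∧ k ∈ Icc l u ∧ ∀ x, m x ∈ Icc l u := by
  obtain ⟨h1, h2⟩ := hm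
  have hc : Continuous m := continuous_of_mem_X ⟨h1, h2⟩
  have e1 : ∀ᶠ x in atTop, k / 2 < m x := by
    filter_upwards [h1.tendsto_atTop.eventually_const_lt (by linarith : -(k / 2) < 0)] with x hx
    linarith
  have e2 : ∀ᶠ x in atBot, k / 2 < m x := by
    filter_upwards [h1.tendsto_atBot.eventually_const_lt (by linarith : -(k / 2) < 0)] with x hx
    linarith
  obtain ⟨r, hr⟩ := eventually_atTop.1 e1
  obtain ⟨l, hl⟩ := eventually_atBot.1 e2
  obtain ⟨x₀, hx₀, hmin⟩ := (isCompact_Icc (a := l) (b := max l r)).exists_isMinOn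
    ⟨l, le_rfl, le_max_left _ _⟩ hc.continuousOn
  refine ⟨min (k / 2) (m x₀), k + h1Norm (fun x => m x - k), lt_min (by linarith) (h2 _),
    ⟨(min_le_left _ _).trans (by linarith), by linarith [h1Norm_nonneg (fun x => m x - k)]⟩,
    fun x => ⟨?_, ?_⟩⟩
  · rcases le_total x l with h | h
    · exact (min_le_left _ _).trans (hl x h).le
    · rcases le_total x (max l r) with h' | h'
      · exact (min_le_right _ _).trans (hmin ⟨h, h'⟩)
      · exact (min_le_left _ _).trans (hr x ((le_max_right _ _).trans h')).le
  · linarith [le_of_abs_le (h1.abs_le x)]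

/-- The density of the energy in the variable `s = (m / k)^(-1/(2b))`. -/
noncomputable def energyDensity (b κ k : ℝ) (m : ℝ → ℝ) (x : ℝ) : ℝ :=
  4 * (scaleDeriv b k 1 (m x) * deriv m x) ^ 2 + potV b κ (scaleDeriv b k 0 (m x))

/-- With m = k s^(-2b), the powers m^(∓1/b) are multiples of s^(±2), and m_x²/(b²m²) = 4s_x²/s². The
factor m^(-1/b) in the second energy therefore makes its kinetic part a constant multiple of s_x².
-/
lemma neg_actionDensity_eq {b c k : ℝ} (hb : 1 < b) (hk : 0 < k) (hkc : k < c) {m : ℝ → ℝ} {x : ℝ}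
    (hm : 0 < m x) : -actionDensity b c k m x
      = (b - 1) * (c - k) / 2 * energyDensity b (k / (c - k)) k m x := by
  have hb0 : b ≠ 0 := by linarith
  have hb1 : b - 1 ≠ 0 := by linarith
  have hck : c - k ≠ 0 := by linarith
  have hs := scaleDeriv_zero_pos (b := b) hk hm
  set s := scaleDeriv b k 0 (m x) with hsdef
  have e1 : scaleDeriv b k 1 (m x) = -(1 / (2 * b)) / m x * s := by
    simp [scaleDeriv, hsdef]
  have hmk : 0 < m x / k := div_pos hm hk
  have p1 : (m x / k) = s ^ (-(2 * b)) := by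
    rw [hsdef, scaleDeriv, ← Real.rpow_mul hmk.le]
    have : -(1 / (2 * b)) * -(2 * b) = 1 := by field_simp
    rw [this, Real.rpow_one]
  have p2 : m x ^ (-(1 / b)) = k ^ (-(1 / b)) * s ^ 2 := by
    have : (m x / k) ^ (-(1 / b)) = s ^ 2 := by
      rw [hsdef, scaleDeriv, ← Real.rpow_natCast, ← Real.rpow_mul hmk.le]
      congr 1; push_cast; field_simp
    rw [← this, Real.div_rpow hm.le hk.le]
    have := (Real.rpow_pos_of_pos hk (-(1 / b))).ne'
    field_simp
  have p3 : m x ^ (1 / b) = k ^ (1 / b) * (s ^ 2)⁻¹ := by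
    have h1 := p2
    rw [Real.rpow_neg hm.le, Real.rpow_neg hk.le] at h1
    have h2 := (Real.rpow_pos_of_pos hk (1 / b)).ne'
    have h3 := (Real.rpow_pos_of_pos hm (1 / b)).ne'
    field_simp at h1 ⊢
    linarith
  have p4 : m x = k * s ^ (-(2 * b)) := by rw [← p1]; field_simp
  have hkb : k ^ (-(1 / b)) = (k ^ (1 / b))⁻¹ := Real.rpow_neg hk.le _
  have hkb0 := (Real.rpow_pos_of_pos hk (1 / b)).ne'
  rw [actionDensity, massDensity, F1Density, F2Density, energyDensity, potV, potY, omega1, omega2,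
    p3, p2, e1, ← hsdef, hkb]
  have hm0 := hm.ne'
  have hs0 := hs.ne'
  have p5 : s ^ (-(2 * b)) = m x / k := p1.symm
  rw [p5]
  field_simp
  ring

lemma exists_abs_le_of_continuousOn {F : ℝ → ℝ} (hF : ContinuousOn F (Ioi 0)) {l u : ℝ}
    (hl : 0 < l) : ∃ K, ∀ t ∈ Icc l u, |F t| ≤ K :=
  isCompact_Icc.exists_bound_of_continuousOn (hF.mono fun _ ht => hl.trans_le ht.1)

/-- V has a double zero at s = 1, that is at m = k, so the potential part is O((m-k)²): the terms
linear in m - k have cancelled. -/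
lemma integrable_energyDensity {b κ k : ℝ} (hb : 1 < b) (hk : 0 < k) {m : ℝ → ℝ} (hm : m ∈ X k) :
    Integrable (energyDensity b κ k m) := by
  obtain ⟨l, u, hl, hku, hmlu⟩ := X_bounds hk hm
  have hc : Continuous m := continuous_of_mem_X hm
  have hd : deriv (fun x => m x - k) = deriv m := by funext x; simp
  have hmap : MapsTo (scaleDeriv b k 0) (Ioi 0) (Ioi 0) := fun t ht => scaleDeriv_zero_pos hk ht
  have hc0 := continuousOn_scaleDeriv (b := b) hk 0
  have hc1 := continuousOn_scaleDeriv (b := b) hk 1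
  have hc2 := continuousOn_scaleDeriv (b := b) hk 2
  have hV1 : ContinuousOn (potV1 b κ) (Ioi 0) := fun t ht =>
    (hasDerivAt_potV1 ht).continuousAt.continuousWithinAt
  have hV : ContinuousOn (potV b κ) (Ioi 0) := fun t ht =>
    (hasDerivAt_potV hb ht).continuousAt.continuousWithinAt
  obtain ⟨K, hK⟩ := exists_abs_le_of_continuousOn (F := fun t =>
    potV2 b κ (scaleDeriv b k 0 t) * scaleDeriv b k 1 t * scaleDeriv b k 1 t
      + potV1 b κ (scaleDeriv b k 0 t) * scaleDeriv b k 2 t)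
    (((((continuousOn_potV2 b κ).comp hc0 hmap).mul hc1).mul hc1).add
      ((hV1.comp hc0 hmap).mul hc2)) (u := u) hl
  obtain ⟨K', hK'⟩ := exists_abs_le_of_continuousOn hc1 (u := u) hl
  refine Integrable.add ?_ ?_
  · have h2 := hm.1.2.2
    rw [hd] at h2
    have := (memLp_mul_bdd h2 (hc1.comp_continuous hc hm.2).aestronglyMeasurable
      (fun x => hK' _ (hmlu x))).integrable_sq
    exact this.const_mul 4
  · refine (hm.1.2.1.integrable_sq.const_mul K).mono'
      ((hV.comp hc0 hmap).comp_continuous hc hm.2).aestronglyMeasurable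
      (Eventually.of_forall fun x => ?_)
    have hpos : ∀ t ∈ Icc l u, 0 < t := fun t ht => hl.trans_le ht.1
    have h := taylor_two (F := fun t => potV b κ (scaleDeriv b k 0 t))
      (F' := fun t => potV1 b κ (scaleDeriv b k 0 t) * scaleDeriv b k 1 t)
      (fun t ht => (hasDerivAt_potV hb (hmap (hpos t ht))).comp t
        (hasDerivAt_scaleDeriv hk 0 (hpos t ht)))
      (fun t ht => ((hasDerivAt_potV1 (hmap (hpos t ht))).comp t
        (hasDerivAt_scaleDeriv hk 0 (hpos t ht))).mul (hasDerivAt_scaleDeriv hk 1 (hpos t ht)))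
      hK hku (hmlu x)
    simp only [scaleDeriv_zero_self hk, potV_one, potV1_one] at h
    simpa using h

/-- The energy in the variable `s = (m / k)^(-1/(2b))`. -/
noncomputable def energy (b κ k : ℝ) (m : ℝ → ℝ) : ℝ := ∫ x, energyDensity b κ k m x

section
variable {b c k : ℝ} (hb : 1 < b) (hk : 0 < k) (hkc : k < c) {m : ℝ → ℝ} (hm : m ∈ X k)
include hb hk hkc hm

lemma neg_actionDensity_eq_of_mem : actionDensity b c k m
      = fun x => -((b - 1) * (c - k) / 2) * energyDensity b (k / (c - k)) k m x := by
  funext x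
  linarith [neg_actionDensity_eq hb hk hkc (hm.2 x)]

lemma integrable_actionDensity : Integrable (actionDensity b c k m) := by
  rw [neg_actionDensity_eq_of_mem hb hk hkc hm]
  exact (integrable_energyDensity hb hk hm).const_mul _

lemma neg_action_eq :
    -action b c k m = (b - 1) * (c - k) / 2 * energy b (k / (c - k)) k m := by
  rw [action, neg_actionDensity_eq_of_mem hb hk hkc hm, integral_const_mul, energy]
  ring

end

/-! ### The second-order expansion of the energy at the wave -/

/-- The momentum density of the profile, `k θ^(-2b)`. -/
noncomputable def density (b k : ℝ) (ψ : ℝ → ℝ) (x : ℝ) : ℝ := k * theta ψ x ^ (-(2 * b))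

/-- The factor between a perturbation of the density and its linearization in `θ`. -/
noncomputable def linFactor (b k : ℝ) (ψ : ℝ → ℝ) (x : ℝ) : ℝ := scaleDeriv b k 1 (density b k ψ x)

lemma integral_sub_sub_sub {f g p q : ℝ → ℝ} (hf : Integrable f) (hg : Integrable g)
    (hp : Integrable p) (hq : Integrable q) : ∫ x, (f x - g x - p x - q x)
      = (∫ x, f x) - (∫ x, g x) - (∫ x, p x) - ∫ x, q x := by
  have h1 := integral_sub ((hf.sub hg).sub hp) hq
  have h2 := integral_sub (hf.sub hg) hp
  have h3 := integral_sub hf hg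
  simp only [Pi.sub_apply] at h1 h2 h3
  rw [h1, h2, h3]

namespace Profile
variable {b κ : ℝ} {ψ : ℝ → ℝ} (P : Profile b κ ψ)
include P

lemma density_pos {k : ℝ} (hk : 0 < k) (x : ℝ) : 0 < density b k ψ x :=
  mul_pos hk (Real.rpow_pos_of_pos (P.theta_pos x) _)

lemma scale_density {k : ℝ} (hk : 0 < k) (x : ℝ) : scaleDeriv b k 0 (density b k ψ x) = theta ψ x :=
  scaleDeriv_zero_mul_rpow hk P.hb (P.theta_pos x)

lemma hasDerivAt_density (k x : ℝ) : HasDerivAt (density b k ψ)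
    (-(2 * b) * density b k ψ x / theta ψ x * deriv (theta ψ) x) x := by
  refine (((hasDerivAt_rpow_two_mul (b := b) (P.theta_pos x)).comp x
    (P.hasDerivAt_theta x)).const_mul k).congr_deriv ?_
  rw [density]; ring

lemma deriv_density (k x : ℝ) : deriv (density b k ψ) x
    = -(2 * b) * density b k ψ x / theta ψ x * deriv (theta ψ) x := (P.hasDerivAt_density k x).deriv

lemma contDiff_density (k : ℝ) : ContDiff ℝ ∞ (density b k ψ) :=
  contDiff_const.mul (P.contDiff_theta.rpow_const_of_ne fun x => (P.theta_pos x).ne')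

lemma linFactor_eq (k : ℝ) (hk : 0 < k) (x : ℝ) :
    linFactor b k ψ x = -(theta ψ x / (2 * b * density b k ψ x)) := by
  have hb : b ≠ 0 := by linarith [P.hb]
  have h := P.scale_density hk x
  have h2 := (P.density_pos hk x).ne'
  rw [linFactor, scaleDeriv, h]
  push_cast
  field_simp
  ring

lemma density_le {k : ℝ} (hk : 0 < k) (x : ℝ) :
    density b k ψ x ∈ Icc k (density b k ψ 0) := by
  have hb := P.hb
  constructor
  · have := Real.one_le_rpow_of_pos_of_le_one_of_nonpos (P.theta_pos x) (P.theta_lt_one x).le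
      (show -(2 * b) ≤ 0 by linarith)
    rw [density]; nlinarith
  · exact mul_le_mul_of_nonneg_left (Real.rpow_le_rpow_of_nonpos (P.theta_pos 0)
      (P.theta_zero_le x) (by linarith)) hk.le

lemma expDecay_density_sub (k : ℝ) : ExpDecay (fun x => density b k ψ x - k) :=
  P.expDecay_comp_theta (F := fun t => k * t ^ (-(2 * b)) - k)
    (F' := fun t => k * (-(2 * b) * (t ^ (-(2 * b)) / t)))
    (fun t ht => ((hasDerivAt_rpow_two_mul ht).const_mul k).sub_const k)
    (continuousOn_const.mul (continuousOn_const.mul ((continuousOn_rpow_neg b).div continuousOn_id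
      fun _ ht => ne_of_gt ht))) (by simp)

lemma expDecay_deriv_density (k : ℝ) : ExpDecay (deriv (density b k ψ)) := by
  obtain ⟨C, hC⟩ := P.bdd_comp_theta (F := fun t => -(2 * b) * (k * t ^ (-(2 * b))) / t)
    ((continuousOn_const.mul (continuousOn_const.mul (continuousOn_rpow_neg b))).div continuousOn_id
      fun _ ht => ne_of_gt ht)
  have h := P.expDecay_deriv_theta.mul_bdd hC
  rwa [show deriv (density b k ψ) = _ from funext (P.deriv_density k)]

lemma density_mem_X {k : ℝ} (hk : 0 < k) : density b k ψ ∈ X k := by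
  refine ⟨(P.expDecay_density_sub k).memH1 ?_ (((P.contDiff_density k).of_le (by simp)).sub
    contDiff_const), P.density_pos hk⟩
  simpa using P.expDecay_deriv_density k

lemma hasDerivAt_linFactor {k : ℝ} (hk : 0 < k) (x : ℝ) : HasDerivAt (linFactor b k ψ)
    (scaleDeriv b k 2 (density b k ψ x) * deriv (density b k ψ) x) x :=
  (hasDerivAt_scaleDeriv hk 1 (P.density_pos hk x)).comp x
    ((P.hasDerivAt_density k x).differentiableAt.hasDerivAt)

lemma contDiff_linFactor {k : ℝ} (hk : 0 < k) : ContDiff ℝ ∞ (linFactor b k ψ) := by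
  have hb : b ≠ 0 := by linarith [P.hb]
  rw [show linFactor b k ψ = _ from funext (P.linFactor_eq k hk)]
  exact (P.contDiff_theta.div (contDiff_const.mul (P.contDiff_density k)) fun x =>
    mul_ne_zero (by simpa using hb) (P.density_pos hk x).ne').neg

lemma deriv_theta_eq {k : ℝ} (hk : 0 < k) (x : ℝ) :
    deriv (theta ψ) x = linFactor b k ψ x * deriv (density b k ψ) x := by
  have hb : b ≠ 0 := by linarith [P.hb]
  have h2 := (P.density_pos hk x).ne'
  have h3 := (P.theta_pos x).ne'
  rw [P.linFactor_eq k hk, P.deriv_density]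
  field_simp

set_option maxHeartbeats 1000000 in
/-- Second-order expansion of the energy at the profile. -/
lemma energy_expansion {k : ℝ} (hk : 0 < k) : ∃ C, 0 ≤ C ∧ ∃ δ > 0, ∀ h, MemH1 h → h1Norm h ≤ δ →
    (fun x => density b k ψ x + h x) ∈ X k ∧
    |energy b κ k (fun x => density b k ψ x + h x) - energy b κ k (density b k ψ)
      - 4 * schForm (schPot b κ ψ) (fun x => linFactor b k ψ x * h x)
        (fun x => linFactor b k ψ x * h x)| ≤ C * h1Norm h ^ 3 := by
  have hb := P.hb
  set μ := density b k ψ with hμ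
  set Ω := linFactor b k ψ with hΩ
  obtain ⟨KW, hW⟩ := P.bdd_schPot
  -- By the Sobolev inequality a perturbation of H¹ norm at most k/2 keeps the density in the
  -- compact interval [l,u] of positive numbers.
  set l := k / 2 with hl
  set u := μ 0 + k / 2 with hu
  have hl0 : 0 < l := by positivity
  have hlu : ∀ t ∈ Icc l u, 0 < t := fun t ht => hl0.trans_le ht.1
  have hμm : ∀ x, μ x ∈ Icc l u := fun x => by
    have := P.density_le hk x
    exact ⟨by linarith [this.1], by linarith [this.2]⟩
  obtain ⟨A₁, hA₁⟩ := exists_abs_le_of_continuousOn (continuousOn_scaleDeriv (b := b) hk 1)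
    (u := u) hl0
  obtain ⟨A₂, hA₂⟩ := exists_abs_le_of_continuousOn (continuousOn_scaleDeriv (b := b) hk 2)
    (u := u) hl0
  obtain ⟨A₃, hA₃⟩ := exists_abs_le_of_continuousOn (continuousOn_scaleDeriv (b := b) hk 3)
    (u := u) hl0
  obtain ⟨B, hB⟩ : ∃ B, ∀ x, |deriv μ x| ≤ B := by
    obtain ⟨B, -, ν, hν, h⟩ := P.expDecay_deriv_density k
    exact ⟨B, fun x => (h x).trans (by
      have : 0 ≤ B := by
        have := (abs_nonneg _).trans (h 0); simpa using this
      have h1 : Real.exp (-ν * |x|) ≤ 1 := by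
        rw [Real.exp_le_one_iff]; nlinarith [abs_nonneg x]
      nlinarith)⟩
  have hA₁0 : 0 ≤ A₁ := (abs_nonneg _).trans (hA₁ _ (hμm 0))
  have hA₂0 : 0 ≤ A₂ := (abs_nonneg _).trans (hA₂ _ (hμm 0))
  have hA₃0 : 0 ≤ A₃ := (abs_nonneg _).trans (hA₃ _ (hμm 0))
  have hB0 : 0 ≤ B := (abs_nonneg _).trans (hB 0)
  have d0 := fun t (ht : t ∈ Icc l u) => hasDerivAt_scaleDeriv (b := b) hk 0 (hlu t ht)
  have d1 := fun t (ht : t ∈ Icc l u) => hasDerivAt_scaleDeriv (b := b) hk 1 (hlu t ht)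
  have d2 := fun t (ht : t ∈ Icc l u) => hasDerivAt_scaleDeriv (b := b) hk 2 (hlu t ht)
  -- range of the scale variable
  obtain ⟨tl, tu, htl, htr⟩ : ∃ tl tu, 0 < tl ∧ ∀ t ∈ Icc l u, scaleDeriv b k 0 t ∈ Icc tl tu := by
    refine ⟨scaleDeriv b k 0 u, scaleDeriv b k 0 l,
      scaleDeriv_zero_pos hk (hlu u ⟨(hμm 0).1.trans (hμm 0).2, le_rfl⟩), fun t ht => ?_⟩
    have hp : -(1 / (2 * b)) ≤ 0 := by
      have : 0 < 1 / (2 * b) := by positivity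
      linarith
    exact ⟨Real.rpow_le_rpow_of_nonpos (div_pos (hlu t ht) hk)
      (div_le_div_of_nonneg_right ht.2 hk.le) hp, Real.rpow_le_rpow_of_nonpos (div_pos hl0 hk)
      (div_le_div_of_nonneg_right ht.1 hk.le) hp⟩
  have htpos : ∀ t ∈ Icc tl tu, 0 < t := fun t ht => htl.trans_le ht.1
  obtain ⟨V₃, hV₃⟩ : ∃ V₃, ∀ t ∈ Icc tl tu, |deriv (potV2 b κ) t| ≤ V₃ := by
    have h2 : ContDiffOn ℝ 1 (potV2 b κ) (Ioi 0) := fun t ht => (contDiffAt_potV2 ht).contDiffWithinAt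
    exact exists_abs_le_of_continuousOn (h2.continuousOn_deriv_of_isOpen isOpen_Ioi le_rfl) htl
  have hV₃0 : 0 ≤ V₃ := (abs_nonneg _).trans (hV₃ _ (htr _ (hμm 0)))
  set Aσ := A₁ + A₂ * B with hAσ
  have hAσ0 : 0 ≤ Aσ := by positivity
  set Aρ := A₂ + A₃ * B with hAρ
  have hAρ0 : 0 ≤ Aρ := by positivity
  refine ⟨8 * (1 + KW) * (2 * Aσ) * (2 * Aρ) + 4 * (1 + KW) * (2 * Aρ) ^ 2 * l + V₃ * A₁ ^ 3,
    by have := hW.nonneg; positivity, l, hl0, fun h hh hhl => ?_⟩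
  set N := h1Norm h with hN
  have hN0 : 0 ≤ N := h1Norm_nonneg h
  have hhx : ∀ x, |h x| ≤ N := hh.abs_le
  have hMm : ∀ x, μ x + h x ∈ Icc l u := fun x => by
    have h1 := P.density_le hk x
    have h2 := abs_le.1 ((hhx x).trans hhl)
    exact ⟨by linarith [h1.1, h2.1], by linarith [h1.2, h2.2]⟩
  have hMX : (fun x => μ x + h x) ∈ X k := by
    refine ⟨?_, fun x => hlu _ (hMm x)⟩
    have e : (fun x => μ x + h x - k) = fun x => (μ x - k) + h x := by funext x; ring
    simp only [e]
    exact (P.density_mem_X hk).1.add hh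
  refine ⟨hMX, ?_⟩
  set θ := theta ψ with hθ
  have hθμ : ∀ x, scaleDeriv b k 0 (μ x) = θ x := P.scale_density hk
  set σ := fun x => Ω x * h x with hσ
  -- χ is the exact perturbation of θ, σ its linearization and ρ = χ - σ; the point is that ρ is
  -- quadratic in h for the H¹ norm.
  set χ := fun x => scaleDeriv b k 0 (μ x + h x) - θ x with hχ
  set ρ := fun x => χ x + (-1) * σ x with hρ
  have cΩ : ContDiff ℝ 1 Ω := (P.contDiff_linFactor hk).of_le (by simp)
  have cθ : ContDiff ℝ 1 θ := P.contDiff_theta.of_le (by simp)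
  have cμ : ContDiff ℝ 1 μ := (P.contDiff_density k).of_le (by simp)
  have lσ : LocAC σ := (locAC_of_contDiff cΩ).mul hh.locAC
  have lM : LocAC (fun x => μ x + h x) := (locAC_of_contDiff cμ).add hh.locAC
  have lS : LocAC (fun x => scaleDeriv b k 0 (μ x + h x)) :=
    lM.comp_contDiffOn (contDiffOn_scaleDeriv_zero hk hl0) hMm
  have lχ : LocAC χ := by
    have := lS.add ((locAC_of_contDiff cθ).const_mul (-1))
    refine cast (congrArg LocAC ?_) this
    funext x; simp only [hχ]; ring
  have lρ : LocAC ρ := lχ.add (lσ.const_mul (-1))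
  -- derivatives
  have hdae : ∀ᵐ x, HasDerivAt h (deriv h x) x := by
    filter_upwards [hh.locAC.ae_differentiableAt] with x hx using hx.hasDerivAt
  have dμ : ∀ x, HasDerivAt μ (deriv μ x) x := fun x =>
    (P.hasDerivAt_density k x).differentiableAt.hasDerivAt
  have dσ : ∀ᵐ x, deriv σ x = scaleDeriv b k 2 (μ x) * deriv μ x * h x + Ω x * deriv h x := by
    filter_upwards [hdae] with x hx
    exact ((P.hasDerivAt_linFactor hk x).mul hx).deriv
  have dM : ∀ᵐ x, deriv (fun x => μ x + h x) x = deriv μ x + deriv h x := by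
    filter_upwards [hdae] with x hx using ((dμ x).add hx).deriv
  have dχ' : ∀ᵐ x, HasDerivAt χ
      (scaleDeriv b k 1 (μ x + h x) * (deriv μ x + deriv h x) - deriv θ x) x := by
    filter_upwards [hdae] with x hx
    exact ((d0 _ (hMm x)).comp x ((dμ x).add hx)).sub (P.hasDerivAt_theta x)
  have dχ : ∀ᵐ x, deriv χ x
      = scaleDeriv b k 1 (μ x + h x) * (deriv μ x + deriv h x) - deriv θ x := by
    filter_upwards [dχ'] with x hx using hx.deriv
  have dθ : ∀ x, deriv θ x = Ω x * deriv μ x := P.deriv_theta_eq hk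
  -- Grouped so that the factor of μ' is a second-order Taylor remainder and the factor of h' is
  -- O(h). Thus |ρ'| is at most a multiple of ‖h‖(|h| + |h'|).
  have dρ : ∀ᵐ x, deriv ρ x = (scaleDeriv b k 1 (μ x + h x) - scaleDeriv b k 1 (μ x)
      - scaleDeriv b k 2 (μ x) * (μ x + h x - μ x)) * deriv μ x
      + (scaleDeriv b k 1 (μ x + h x) - scaleDeriv b k 1 (μ x)) * deriv h x := by
    filter_upwards [dχ', hdae] with x hx hx2
    have hd : HasDerivAt ρ _ x := hx.add (((P.hasDerivAt_linFactor hk x).mul hx2).const_mul (-1))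
    rw [hd.deriv, dθ x, hΩ, linFactor]
    ring
  -- bounds
  have hΩA : ∀ x, |Ω x| ≤ A₁ := fun x => hA₁ _ (hμm x)
  obtain ⟨mσ, nσ⟩ : MemH1 σ ∧ h1Norm σ ≤ 2 * Aσ * N := by
    refine memH1_of_le lσ hh hAσ0 (fun x => ?_) ?_
    · simp only [hσ, abs_mul]
      exact mul_le_mul_of_nonneg_right ((hΩA x).trans (by rw [hAσ]; nlinarith)) (abs_nonneg _)
    · filter_upwards [dσ] with x hx
      rw [hx]
      have h1 : |scaleDeriv b k 2 (μ x) * deriv μ x| ≤ A₂ * B := by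
        rw [abs_mul]; exact mul_le_mul (hA₂ _ (hμm x)) (hB x) (abs_nonneg _) hA₂0
      have h2 := mul_le_mul_of_nonneg_right h1 (abs_nonneg (h x))
      have h3 := mul_le_mul_of_nonneg_right (hΩA x) (abs_nonneg (deriv h x))
      refine (abs_add_le _ _).trans ?_
      rw [abs_mul _ (h x), abs_mul (Ω x), hAσ]
      nlinarith [abs_nonneg (h x), abs_nonneg (deriv h x), mul_nonneg hA₁0 (abs_nonneg (h x)),
        mul_nonneg (mul_nonneg hA₂0 hB0) (abs_nonneg (deriv h x))]
  obtain ⟨mρ, nρ⟩ : MemH1 ρ ∧ h1Norm ρ ≤ 2 * (Aρ * N) * N := by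
    refine memH1_of_le lρ hh (by positivity) (fun x => ?_) ?_
    · have h1 := taylor_two d0 d1 hA₂ (hμm x) (hMm x)
      have e : scaleDeriv b k 0 (μ x + h x) - scaleDeriv b k 0 (μ x)
          - scaleDeriv b k (0 + 1) (μ x) * (μ x + h x - μ x) = ρ x := by
        rw [hθμ]; simp only [hρ, hχ, hσ, hΩ, linFactor, ← hμ]; ring
      rw [e] at h1
      refine h1.trans ?_
      rw [add_sub_cancel_left, ← sq_abs, pow_two, ← mul_assoc]
      refine mul_le_mul_of_nonneg_right ?_ (abs_nonneg _)
      refine mul_le_mul ?_ (hhx x) (abs_nonneg _) hAρ0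
      rw [hAρ]; nlinarith [mul_nonneg hA₃0 hB0]
    · filter_upwards [dρ] with x hx
      rw [hx]
      have h1 := taylor_two d1 d2 hA₃ (hμm x) (hMm x)
      have h2 := abs_sub_le_of_hasDerivAt d1 hA₂ (hμm x) (hMm x)
      refine (abs_add_le _ _).trans ?_
      rw [abs_mul, abs_mul _ (deriv h x)]
      have h3 := mul_le_mul h1 (hB x) (abs_nonneg _) (by positivity)
      have h4 := mul_le_mul_of_nonneg_right h2 (abs_nonneg (deriv h x))
      refine (add_le_add h3 h4).trans ?_
      rw [add_sub_cancel_left, ← sq_abs, hAρ]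
      have q0 := abs_nonneg (h x)
      have q1 := abs_nonneg (deriv h x)
      have q2 : |h x| * |h x| ≤ N * |h x| := mul_le_mul_of_nonneg_right (hhx x) q0
      have q3 : |h x| * |deriv h x| ≤ N * |deriv h x| := mul_le_mul_of_nonneg_right (hhx x) q1
      have q4 := mul_le_mul_of_nonneg_left q2 (mul_nonneg hA₃0 hB0)
      have q5 := mul_le_mul_of_nonneg_left q3 hA₂0
      have q6 : 0 ≤ A₂ * (N * |h x|) := by positivity
      have q7 : 0 ≤ A₃ * B * (N * |deriv h x|) := by positivity
      nlinarith
  have mχ : MemH1 χ := by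
    have := mρ.add mσ
    refine cast (congrArg MemH1 ?_) this
    funext x; simp only [hρ]; ring
  have eχ : χ = fun x => σ x + ρ x := by funext x; simp only [hρ]; ring
  -- the quadratic form at `χ`
  have hform : |schForm (schPot b κ ψ) χ χ - schForm (schPot b κ ψ) σ σ|
      ≤ 2 * ((1 + KW) * (2 * Aσ * N * (2 * (Aρ * N) * N)))
        + (1 + KW) * ((2 * (Aρ * N) * N) * (2 * (Aρ * N) * N)) := by
    have e : schForm (schPot b κ ψ) χ χ - schForm (schPot b κ ψ) σ σ
        = 2 * schForm (schPot b κ ψ) σ ρ + schForm (schPot b κ ψ) ρ ρ := by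
      rw [eχ, hW.form_add mσ mρ (mσ.add mρ), schForm_comm σ, schForm_comm ρ,
        hW.form_add mσ mρ mσ, hW.form_add mσ mρ mρ, schForm_comm ρ σ]
      ring
    have h1 := hW.abs_form_le mσ mρ
    have h2 := hW.abs_form_le mρ mρ
    have hK := hW.nonneg
    rw [e]
    refine (abs_add_le _ _).trans (add_le_add ?_ (h2.trans ?_))
    · rw [abs_mul, abs_two]
      refine mul_le_mul_of_nonneg_left (h1.trans ?_) two_pos.le
      refine mul_le_mul_of_nonneg_left ?_ (by linarith)
      exact mul_le_mul nσ nρ (h1Norm_nonneg _) (by positivity)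
    · refine mul_le_mul_of_nonneg_left ?_ (by linarith)
      exact mul_le_mul nρ nρ (h1Norm_nonneg _) (by positivity)
  -- the remainder of the potential energy
  have hrem : ∀ x, |potV b κ (θ x + χ x) - potV b κ (θ x) - potV1 b κ (θ x) * χ x
      - 4 * schPot b κ ψ x * χ x ^ 2| ≤ V₃ * A₁ ^ 3 * (N * h x ^ 2) := by
    intro x
    have t1 : θ x ∈ Icc tl tu := by rw [← hθμ]; exact htr _ (hμm x)
    have t2 : θ x + χ x ∈ Icc tl tu := by
      simp only [hχ, add_sub_cancel]; exact htr _ (hMm x)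
    have h1 := taylor_three (fun t ht => hasDerivAt_potV (b := b) (κ := κ) hb (htpos t ht))
      (fun t ht => hasDerivAt_potV1 (htpos t ht))
      (fun t ht => ((contDiffAt_potV2 (n := 1) (htpos t ht)).differentiableAt
        (by simp)).hasDerivAt) hV₃ t1 t2
    rw [add_sub_cancel_left] at h1
    have e : potV2 b κ (θ x) / 2 = 4 * schPot b κ ψ x := by rw [schPot]; ring
    rw [e] at h1
    refine h1.trans ?_
    have h2 : |χ x| ≤ A₁ * |h x| := by
      have := abs_sub_le_of_hasDerivAt d0 hA₁ (hμm x) (hMm x)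
      rwa [hθμ, add_sub_cancel_left] at this
    rw [mul_assoc]
    refine mul_le_mul_of_nonneg_left ?_ hV₃0
    refine (pow_le_pow_left₀ (abs_nonneg _) h2 3).trans ?_
    rw [mul_pow, ← sq_abs (h x)]
    refine mul_le_mul_of_nonneg_left ?_ (by positivity)
    have := mul_le_mul_of_nonneg_right (hhx x) (sq_nonneg |h x|)
    nlinarith
  set r := fun x => potV b κ (θ x + χ x) - potV b κ (θ x) - potV1 b κ (θ x) * χ x
      - 4 * schPot b κ ψ x * χ x ^ 2 with hr
  have mp : MemH1 (deriv θ) := P.expDecay_deriv_theta.memH1 P.expDecay_deriv2_theta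
    ((contDiff_infty_iff_deriv.1 P.contDiff_theta).2.of_le (by simp))
  have i0 := integrable_energyDensity (κ := κ) hb hk (P.density_mem_X hk)
  have i1 := integrable_energyDensity (κ := κ) hb hk hMX
  have i2 : Integrable (fun x => 8 * (deriv θ x * deriv χ x + deriv (deriv θ) x * χ x)) :=
    ((integrable_mul_of_memLp mp.2.1 mχ.2.2).add
      (integrable_mul_of_memLp mp.2.2 mχ.2.1)).const_mul 8
  have i3 := (hW.integrable_form mχ mχ).const_mul 4
  -- The kinetic energy is exactly quadratic in θ' + χ', so only the Taylor remainder of V survives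
  -- the subtraction.
  have hpt : ∀ᵐ x, energyDensity b κ k (fun x => μ x + h x) x - energyDensity b κ k μ x
      - 8 * (deriv θ x * deriv χ x + deriv (deriv θ) x * χ x)
      - 4 * (deriv χ x * deriv χ x + schPot b κ ψ x * (χ x * χ x)) = r x := by
    filter_upwards [dχ, dM] with x hx hx2
    have e1 : scaleDeriv b k 1 (μ x + h x) * (deriv μ x + deriv h x) = deriv θ x + deriv χ x := by
      rw [hx]; ring
    have e2 : scaleDeriv b k 1 (μ x) * deriv μ x = deriv θ x := (dθ x).symm
    have e3 : scaleDeriv b k 0 (μ x + h x) = θ x + χ x := by simp [hχ]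
    have e4 : deriv (deriv θ) x = potV1 b κ (θ x) / 8 := by rw [hθ, P.deriv_deriv_theta]
    simp only [energyDensity]
    rw [hx2, e1, e2, e3, hθμ, e4]
    simp only [hr]
    ring
  have i4 : Integrable r := (((i1.sub i0).sub i2).sub i3).congr hpt
  -- Criticality of the wave: the first-order term 8(θ'χ' + θ''χ) integrates to zero by parts.
  have hI : energy b κ k (fun x => μ x + h x) - energy b κ k μ
      - 4 * schForm (schPot b κ ψ) χ χ = ∫ x, r x := by
    rw [← integral_congr_ae hpt, integral_sub_sub_sub i1 i0 i2 i3, integral_const_mul, integral_const_mul, integral_add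
      (integrable_mul_of_memLp mp.2.1 mχ.2.2) (integrable_mul_of_memLp mp.2.2 mχ.2.1),
      mp.integral_by_parts mχ, neg_add_cancel, mul_zero, sub_zero]
    rfl
  have hIr : |∫ x, r x| ≤ V₃ * A₁ ^ 3 * (N * N ^ 2) := by
    refine (abs_integral_le_integral_abs).trans ?_
    refine (integral_mono i4.abs ((hh.2.1.integrable_sq.const_mul N).const_mul (V₃ * A₁ ^ 3))
      hrem).trans ?_
    rw [integral_const_mul, integral_const_mul]
    refine mul_le_mul_of_nonneg_left (mul_le_mul_of_nonneg_left ?_ hN0) (by positivity)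
    rw [hN, hh.h1Norm_sq_eq]
    linarith [integral_nonneg (μ := volume) (f := fun x => deriv h x ^ 2) fun x => sq_nonneg _]
  have e : energy b κ k (fun x => μ x + h x) - energy b κ k μ - 4 * schForm (schPot b κ ψ) σ σ
      = (∫ x, r x) + 4 * (schForm (schPot b κ ψ) χ χ - schForm (schPot b κ ψ) σ σ) := by
    rw [← hI]; ring
  rw [e]
  refine (abs_add_le _ _).trans ?_
  rw [abs_mul, abs_of_pos (four_pos : (0 : ℝ) < 4)]
  -- The quartic contribution of ρ to the form is absorbed into the cubic bound by N ≤ l.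
  have hN4 : N ^ 3 * N ≤ N ^ 3 * l := mul_le_mul_of_nonneg_left hhl (by positivity)
  have hK := hW.nonneg
  have := mul_le_mul_of_nonneg_left hN4 (show 0 ≤ 4 * (1 + KW) * (2 * Aρ) ^ 2 by positivity)
  linarith

end Profile

/-! ### Transfer of the constraints to σ = Ωh and the variational criteria -/

/-- Multiplication by a bounded function with bounded derivative is bounded on `H¹`. -/
lemma exists_h1Norm_mul_le {g : ℝ → ℝ} (hg : ContDiff ℝ 1 g) {K K' : ℝ} (hK : ∀ x, |g x| ≤ K)
    (hK' : ∀ x, |deriv g x| ≤ K') : ∃ A > 0, ∀ f, MemH1 f →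
      MemH1 (fun x => g x * f x) ∧ h1Norm (fun x => g x * f x) ≤ A * h1Norm f := by
  have hK0 : 0 ≤ K := (abs_nonneg _).trans (hK 0)
  have hK0' : 0 ≤ K' := (abs_nonneg _).trans (hK' 0)
  refine ⟨2 * (K + K' + 1), by positivity, fun f hf => ?_⟩
  refine memH1_of_le ((locAC_of_contDiff hg).mul hf.locAC) hf (by positivity) (fun x => ?_) ?_
  · rw [abs_mul]
    exact mul_le_mul_of_nonneg_right ((hK x).trans (by linarith)) (abs_nonneg _)
  · filter_upwards [(locAC_of_contDiff hg).deriv_mul hf.locAC] with x hx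
    rw [hx]
    refine (abs_add_le _ _).trans ?_
    rw [abs_mul, abs_mul]
    have h1 := mul_le_mul_of_nonneg_right (hK' x) (abs_nonneg (f x))
    have h2 := mul_le_mul_of_nonneg_right (hK x) (abs_nonneg (deriv f x))
    nlinarith [abs_nonneg (f x), abs_nonneg (deriv f x), mul_nonneg hK0 (abs_nonneg (f x)),
      mul_nonneg hK0' (abs_nonneg (deriv f x))]

lemma HasSecondVariation.unique {J : (ℝ → ℝ) → ℝ} {μ h : ℝ → ℝ} {q q' : ℝ}
    (h1 : HasSecondVariation J μ h q) (h2 : HasSecondVariation J μ h q') : q = q' := by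
  have h3 := IsLittleO.sub h1 h2
  have e : (fun t : ℝ => J (fun x => μ x + t * h x) - J μ - q / 2 * t ^ 2
      - (J (fun x => μ x + t * h x) - J μ - q' / 2 * t ^ 2)) = fun t => (q' - q) / 2 * t ^ 2 := by
    funext t; ring
  rw [e] at h3
  by_contra hne
  have h4 : (fun t : ℝ => t ^ 2) =o[𝓝 0] (fun t : ℝ => t ^ 2) := by
    have hc : (q' - q) / 2 ≠ 0 := div_ne_zero (sub_ne_zero.2 (Ne.symm hne)) two_ne_zero
    exact (isLittleO_const_mul_left_iff hc).1 h3
  have h5 := h4.def (c := 1 / 2) (by norm_num)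
  obtain ⟨ε, hε, h6⟩ := Metric.eventually_nhds_iff.1 h5
  have h7 := h6 (y := ε / 2) (by rw [Real.dist_eq, sub_zero, abs_of_pos (by linarith)]; linarith)
  have h8 : 0 < (ε / 2) ^ 2 := by positivity
  rw [Real.norm_eq_abs, abs_of_pos h8] at h7
  linarith

namespace Profile
variable {b κ : ℝ} {ψ : ℝ → ℝ} (P : Profile b κ ψ) {k : ℝ} (hk : 0 < k)
include P hk

lemma linFactor_ne (x : ℝ) : linFactor b k ψ x ≠ 0 := by
  have hb : b ≠ 0 := by linarith [P.hb]
  rw [P.linFactor_eq k hk]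
  exact neg_ne_zero.2 (div_ne_zero (P.theta_pos x).ne' (mul_ne_zero (by simpa using hb)
    (P.density_pos hk x).ne'))

lemma inv_linFactor (x : ℝ) :
    (linFactor b k ψ x)⁻¹ = -(2 * b * k) * (theta ψ x ^ (-(2 * b)) / theta ψ x) := by
  rw [P.linFactor_eq k hk, inv_neg, inv_div, density]; ring

lemma exists_linFactor_bound : ∃ A > 0, ∀ h, MemH1 h → MemH1 (fun x => linFactor b k ψ x * h x) ∧
    h1Norm (fun x => linFactor b k ψ x * h x) ≤ A * h1Norm h := by
  obtain ⟨B, hB⟩ := P.bdd_deriv_theta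
  have hpos : ∀ t > (0 : ℝ), 0 < k * t ^ (-(2 * b)) := fun t ht =>
    mul_pos hk (Real.rpow_pos_of_pos ht _)
  have hc : ∀ n, ContinuousOn (fun t : ℝ => scaleDeriv b k n (k * t ^ (-(2 * b)))) (Ioi 0) :=
    fun n => (continuousOn_scaleDeriv hk n).comp
      (continuousOn_const.mul (continuousOn_rpow_neg b)) hpos
  obtain ⟨K, hK⟩ := P.bdd_comp_theta (hc 1)
  obtain ⟨K', hK'⟩ := P.bdd_comp_theta (((hc 2).mul
    (continuousOn_const (c := -(2 * b)))).mul ((continuousOn_const (c := k)).mul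
      ((continuousOn_rpow_neg b).div continuousOn_id fun _ ht => ne_of_gt ht)))
  refine exists_h1Norm_mul_le ((P.contDiff_linFactor hk).of_le (by simp)) hK (K' := K' * B)
    fun x => ?_
  rw [(P.hasDerivAt_linFactor hk x).deriv, P.deriv_density]
  have e : scaleDeriv b k 2 (density b k ψ x)
      * (-(2 * b) * density b k ψ x / theta ψ x * deriv (theta ψ) x)
      = scaleDeriv b k 2 (k * theta ψ x ^ (-(2 * b))) * -(2 * b)
        * (k * (theta ψ x ^ (-(2 * b)) / theta ψ x)) * deriv (theta ψ) x := by
    rw [density]; ring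
  rw [e, abs_mul]
  exact mul_le_mul (hK' x) (hB x) (abs_nonneg _) ((abs_nonneg _).trans (hK' x))

lemma exists_inv_linFactor_bound : ∃ A > 0, ∀ σ, MemH1 σ →
    MemH1 (fun x => (linFactor b k ψ x)⁻¹ * σ x) ∧
    h1Norm (fun x => (linFactor b k ψ x)⁻¹ * σ x) ≤ A * h1Norm σ := by
  obtain ⟨B, hB⟩ := P.bdd_deriv_theta
  have hc := (continuousOn_rpow_neg b).div continuousOn_id fun _ ht => ne_of_gt ht
  obtain ⟨K, hK⟩ := P.bdd_comp_theta ((continuousOn_const (c := -(2 * b * k))).mul hc)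
  obtain ⟨K', hK'⟩ := P.bdd_comp_theta (F := fun t =>
    -(2 * b * k) * (-(2 * b + 1) * (t ^ (-(2 * b)) / t / t)))
    (continuousOn_const.mul (continuousOn_const.mul
      (hc.div continuousOn_id fun _ ht => ne_of_gt ht)))
  have hd : ∀ x, HasDerivAt (fun x => (linFactor b k ψ x)⁻¹)
      (-(2 * b * k) * (-(2 * b + 1) * (theta ψ x ^ (-(2 * b)) / theta ψ x / theta ψ x))
        * deriv (theta ψ) x) x := by
    intro x
    have ht := P.theta_pos x
    rw [show (fun x => (linFactor b k ψ x)⁻¹) = _ from funext (P.inv_linFactor hk)]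
    have h1 := (((hasDerivAt_rpow_two_mul (b := b) ht).div (hasDerivAt_id _) ht.ne').const_mul
      (-(2 * b * k))).comp x (P.hasDerivAt_theta x)
    refine h1.congr_deriv ?_
    simp only [id]
    field_simp
    ring
  refine exists_h1Norm_mul_le (K := K) (K' := K' * B) (((P.contDiff_linFactor hk).inv
    (P.linFactor_ne hk)).of_le (by simp)) (fun x => ?_) fun x => ?_
  · rw [P.inv_linFactor hk]; exact hK x
  · rw [(hd x).deriv, abs_mul]
    exact mul_le_mul (hK' x) (hB x) (abs_nonneg _) ((abs_nonneg _).trans (hK' x))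

/-- The weight of (∗) is a nonzero multiple of Ωf, so the constraint on h is orthogonality of σ = Ωh
to f. -/
lemma weight_mul (x y : ℝ) : weight b k (density b k ψ) x * y
    = -(4 * (b - 1) * k ^ (1 / b)) * (schRhs b ψ x * (linFactor b k ψ x * y)) := by
  have hb := P.hb
  have hb0 : b ≠ 0 := by linarith
  have hb1 : b - 1 ≠ 0 := by linarith
  have ht := P.theta_pos x
  have hinv := P.inv_linFactor hk x
  have hne := P.linFactor_ne hk x
  set Ω := linFactor b k ψ x with hΩ
  set θ := theta ψ x with hθ
  have h1 : weight b k (density b k ψ) x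
      = k ^ (1 / b) / k * ((θ ^ (-(2 * b)))⁻¹ / θ ^ 2 - 1) := by
    rw [weight, density, Real.mul_rpow hk.le (Real.rpow_nonneg ht.le _),
      Real.rpow_sub_one hk.ne', ← Real.rpow_mul ht.le, ← Real.rpow_neg ht.le,
      ← Real.rpow_natCast θ 2, ← Real.rpow_sub ht]
    have : -(2 * b) * (1 / b - 1) = - -(2 * b) - ((2 : ℕ) : ℝ) := by push_cast; field_simp; ring
    rw [this]; ring
  have h2 : y = Ω⁻¹ * (Ω * y) := by field_simp
  rw [h1]
  conv_lhs => rw [h2]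
  rw [hinv, schRhs, potF, ← hθ]
  have h3 := (Real.rpow_pos_of_pos ht (-(2 * b))).ne'
  generalize Ω * y = z
  field_simp
  ring

lemma inner2_weight (h : ℝ → ℝ) : inner2 (weight b k (density b k ψ)) h
    = -(4 * (b - 1) * k ^ (1 / b)) * inner2 (schRhs b ψ) (fun x => linFactor b k ψ x * h x) := by
  rw [inner2, inner2, ← integral_const_mul]
  congr 1; funext x; exact P.weight_mul hk x _

lemma inner2_weight_eq_zero_iff (h : ℝ → ℝ) : inner2 (weight b k (density b k ψ)) h = 0 ↔
    inner2 (schRhs b ψ) (fun x => linFactor b k ψ x * h x) = 0 := by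
  have hb1 : 0 < b - 1 := by linarith [P.hb]
  rw [P.inner2_weight hk, mul_eq_zero, or_iff_right]
  have := Real.rpow_pos_of_pos hk (1 / b)
  exact neg_ne_zero.2 (by positivity)

/-- Since θ' = Ωμ', the product μ'h equals Ω⁻²θ'σ. This is the reason for the weight ϖ in the
transverse condition. -/
lemma inner2_deriv_density (h : ℝ → ℝ) : inner2 (deriv (density b k ψ)) h = (2 * b * k) ^ 2 *
    inner2 (fun x => transWeight b ψ x * deriv (theta ψ) x) (fun x => linFactor b k ψ x * h x) := by
  rw [inner2, inner2, ← integral_const_mul]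
  congr 1; funext x
  have hne := P.linFactor_ne hk x
  have h1 : (2 * b * k) ^ 2 * transWeight b ψ x = (linFactor b k ψ x)⁻¹ ^ 2 := by
    rw [P.inv_linFactor hk, transWeight]; ring
  have h2 : (2 * b * k) ^ 2 * (transWeight b ψ x * deriv (theta ψ) x * (linFactor b k ψ x * h x))
      = (2 * b * k) ^ 2 * transWeight b ψ x
        * (deriv (theta ψ) x * (linFactor b k ψ x * h x)) := by ring
  rw [h2, h1, P.deriv_theta_eq hk]
  field_simp

lemma inner2_deriv_density_eq_zero_iff (h : ℝ → ℝ) : inner2 (deriv (density b k ψ)) h = 0 ↔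
    inner2 (fun x => transWeight b ψ x * deriv (theta ψ) x)
      (fun x => linFactor b k ψ x * h x) = 0 := by
  have hb : 0 < b := by linarith [P.hb]
  rw [P.inner2_deriv_density hk, mul_eq_zero, or_iff_right (by positivity)]

lemma mul_inv_linFactor (σ : ℝ → ℝ) :
    (fun x => linFactor b k ψ x * ((linFactor b k ψ x)⁻¹ * σ x)) = σ := by
  funext x; rw [mul_inv_cancel_left₀ (P.linFactor_ne hk x)]

lemma inv_mul_linFactor (h : ℝ → ℝ) :
    (fun x => (linFactor b k ψ x)⁻¹ * (linFactor b k ψ x * h x)) = h := by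
  funext x; rw [inv_mul_cancel_left₀ (P.linFactor_ne hk x)]

/-- Perturbations of the density and of `θ` correspond to each other. -/
lemma exists_perturbation {σ : ℝ → ℝ} (hσ : MemH1 σ) (h0 : inner2 (schRhs b ψ) σ = 0) :
    ∃ h, MemH1 h ∧ inner2 (weight b k (density b k ψ)) h = 0 ∧
      (fun x => linFactor b k ψ x * h x) = σ := by
  obtain ⟨A, -, hA⟩ := P.exists_inv_linFactor_bound hk
  refine ⟨_, (hA σ hσ).1, ?_, P.mul_inv_linFactor hk σ⟩
  rw [P.inner2_weight_eq_zero_iff hk, P.mul_inv_linFactor hk]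
  exact h0

section
variable {J : (ℝ → ℝ) → ℝ} {γ : ℝ} (hγ : 0 < γ) (hJ : ∀ m ∈ X k, J m = γ * energy b κ k m)
include hγ hJ

/-- Second-order expansion of the functional along a line. -/
lemma line_expansion {h : ℝ → ℝ} (hh : MemH1 h) : ∃ C, 0 ≤ C ∧ ∀ᶠ t in 𝓝 (0 : ℝ),
    |J (fun x => density b k ψ x + t * h x) - J (density b k ψ)
      - 4 * γ * schForm (schPot b κ ψ) (fun x => linFactor b k ψ x * h x)
        (fun x => linFactor b k ψ x * h x) * t ^ 2| ≤ C * |t| ^ 3 := by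
  obtain ⟨C, hC, δ, hδ, H⟩ := P.energy_expansion hk
  refine ⟨γ * (C * h1Norm h ^ 3), by have := h1Norm_nonneg h; positivity, ?_⟩
  have hlim : Tendsto (fun t : ℝ => |t| * h1Norm h) (𝓝 0) (𝓝 0) := by
    have : Continuous (fun t : ℝ => |t| * h1Norm h) := by fun_prop
    simpa using this.tendsto 0
  filter_upwards [hlim.eventually_le_const hδ] with t ht
  obtain ⟨h1, h2⟩ := H (fun x => t * h x) (hh.const_mul t) (by rwa [h1Norm_const_mul])
  rw [h1Norm_const_mul] at h2
  rw [hJ _ h1, hJ _ (P.density_mem_X hk)]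
  have e : (fun x => linFactor b k ψ x * (t * h x)) = fun x => t * (linFactor b k ψ x * h x) := by
    funext x; ring
  rw [e, schForm_const_mul, schForm_comm, schForm_const_mul] at h2
  set B := schForm (schPot b κ ψ) (fun x => linFactor b k ψ x * h x)
    (fun x => linFactor b k ψ x * h x)
  rw [show γ * energy b κ k (fun x => density b k ψ x + t * h x) - γ * energy b κ k (density b k ψ)
      - 4 * γ * B * t ^ 2 = γ * (energy b κ k (fun x => density b k ψ x + t * h x)
      - energy b κ k (density b k ψ) - 4 * (t * (t * B))) by ring, abs_mul, abs_of_pos hγ]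
  refine (mul_le_mul_of_nonneg_left h2 hγ.le).trans (le_of_eq ?_)
  ring

lemma hasSecondVariation_form {h : ℝ → ℝ} (hh : MemH1 h) : HasSecondVariation J (density b k ψ) h
    (8 * γ * schForm (schPot b κ ψ) (fun x => linFactor b k ψ x * h x)
        (fun x => linFactor b k ψ x * h x)) := by
  obtain ⟨C, hC, H⟩ := P.line_expansion hk hγ hJ hh
  have h1 : (fun t : ℝ => |t| ^ 3) =o[𝓝 0] (fun t : ℝ => t ^ 2) := by
    have h2 : (fun t : ℝ => t ^ 3) =o[𝓝 0] (fun t : ℝ => t ^ 2) :=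
      isLittleO_pow_pow (by norm_num)
    refine h2.norm_left.congr_left fun t => ?_
    rw [norm_pow, Real.norm_eq_abs]
  refine (IsBigO.of_bound C ?_).trans_isLittleO h1
  filter_upwards [H] with t ht
  rw [Real.norm_eq_abs, Real.norm_eq_abs, abs_pow, abs_abs]
  refine le_trans (le_of_eq ?_) ht
  congr 1
  ring

lemma hasSecondVariation_iff {h : ℝ → ℝ} (hh : MemH1 h) {q : ℝ} :
    HasSecondVariation J (density b k ψ) h q ↔
    q = 8 * γ * schForm (schPot b κ ψ) (fun x => linFactor b k ψ x * h x)
        (fun x => linFactor b k ψ x * h x) :=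
  ⟨fun h1 => h1.unique (P.hasSecondVariation_form hk hγ hJ hh),
    fun h1 => h1 ▸ P.hasSecondVariation_form hk hγ hJ hh⟩

theorem isConstrainedMinimizer_iff :
    IsConstrainedMinimizer J (density b k ψ) (weight b k (density b k ψ)) ↔
      inner2 (schRhs b ψ) (thetaParam b κ ψ) ≤ 0 := by
  obtain ⟨K, S⟩ := P.spectralData
  obtain ⟨A, -, hA⟩ := P.exists_linFactor_bound hk
  constructor
  · intro H
    by_contra hN
    obtain ⟨σ, hσ, h0, -, hB⟩ := S.exists_neg (not_le.1 hN)
    obtain ⟨h, hh, hw, hhσ⟩ := P.exists_perturbation hk hσ h0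
    obtain ⟨q, hq, hv⟩ := H h hh hw
    rw [P.hasSecondVariation_iff hk hγ hJ hh, hhσ] at hv
    nlinarith
  · intro hN h hh hw
    refine ⟨_, ?_, P.hasSecondVariation_form hk hγ hJ hh⟩
    have := S.form_nonneg hN (hA h hh).1 ((P.inner2_weight_eq_zero_iff hk h).1 hw)
    positivity

/-- If ⟨f,ζ⟩ = 0, the null direction built from ζ is nonzero at 0, where μ' vanishes. If ⟨f,ζ⟩ < 0,
coercivity modulo p leaves only multiples of p = Ωμ'. -/
theorem degenerateOnlyByTranslation_iff :
    IsConstrainedMinimizer J (density b k ψ) (weight b k (density b k ψ)) ∧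
      DegenerateOnlyByTranslation J (density b k ψ) (weight b k (density b k ψ)) ↔
      inner2 (schRhs b ψ) (thetaParam b κ ψ) < 0 := by
  obtain ⟨K, S⟩ := P.spectralData
  obtain ⟨A, -, hA⟩ := P.exists_linFactor_bound hk
  rw [P.isConstrainedMinimizer_iff hk hγ hJ]
  constructor
  · rintro ⟨hN, H⟩
    refine lt_of_le_of_ne hN fun hN0 => ?_
    obtain ⟨σ, hσ, h0, -, hB, hne⟩ := S.exists_null hN0
    obtain ⟨h, hh, hw, hhσ⟩ := P.exists_perturbation hk hσ h0
    obtain ⟨s, hs⟩ := H h hh hw (by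
      rw [P.hasSecondVariation_iff hk hγ hJ hh, hhσ, hB, mul_zero])
    refine hne ?_
    have hp0 : deriv (theta ψ) 0 = 0 := by rw [P.deriv_theta, P.deriv_zero]; simp
    have h1 := P.deriv_theta_eq hk 0
    rw [hp0] at h1
    rw [← hhσ]
    simp only
    rw [hs 0]
    linear_combination -s * h1
  · intro hN
    refine ⟨hN.le, fun h hh hw hv => ?_⟩
    rw [P.hasSecondVariation_iff hk hγ hJ hh] at hv
    have hB : schForm (schPot b κ ψ) (fun x => linFactor b k ψ x * h x)
        (fun x => linFactor b k ψ x * h x) = 0 := by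
      rcases mul_eq_zero.1 hv.symm with h1 | h1
      · linarith
      · exact h1
    obtain ⟨s, hs⟩ := S.eq_mul_p hN (hA h hh).1 ((P.inner2_weight_eq_zero_iff hk h).1 hw) hB
    refine ⟨s, fun x => mul_left_cancel₀ (P.linFactor_ne hk x) ?_⟩
    rw [hs x, P.deriv_theta_eq hk]
    ring

/-- Quadratic growth along t h, divided by t² as t tends to 0 from the right, forces h = 0 whenever
the form is nonpositive there; this excludes the directions available when ⟨f,ζ⟩ ≥ 0. Conversely,
coercivity dominates the cubic remainder near μ. -/
theorem isMinimizerTransverseToTranslation_iff :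
    IsMinimizerTransverseToTranslation J (density b k ψ) (weight b k (density b k ψ)) ↔
      inner2 (schRhs b ψ) (thetaParam b κ ψ) < 0 := by
  obtain ⟨K, S⟩ := P.spectralData
  constructor
  · rintro ⟨C, hC, ε, hε, H⟩
    have key : ∀ σ, MemH1 σ → inner2 (schRhs b ψ) σ = 0 →
        inner2 (fun x => transWeight b ψ x * deriv (theta ψ) x) σ = 0 →
        schForm (schPot b κ ψ) σ σ ≤ 0 → schForm (schPot b κ ψ) σ σ = 0 ∧ ∀ x, σ x = 0 := by
      intro σ hσ h0 ht hB
      obtain ⟨h, hh, hw, hhσ⟩ := P.exists_perturbation hk hσ h0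
      have ht' : inner2 (deriv (density b k ψ)) h = 0 := by
        rw [P.inner2_deriv_density_eq_zero_iff hk, hhσ]; exact ht
      obtain ⟨C', hC', E⟩ := P.line_expansion hk hγ hJ hh
      rw [hhσ] at E
      have hlim : Tendsto (fun t : ℝ => |t| * h1Norm h) (𝓝 0) (𝓝 0) := by
        have : Continuous (fun t : ℝ => |t| * h1Norm h) := by fun_prop
        simpa using this.tendsto 0
      have hle : ∀ᶠ t in 𝓝[>] (0 : ℝ), C * h1Norm h ^ 2
          ≤ 4 * γ * schForm (schPot b κ ψ) σ σ + C' * t := by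
        filter_upwards [nhdsWithin_le_nhds E, nhdsWithin_le_nhds (hlim.eventually_lt_const hε),
          self_mem_nhdsWithin] with t h1 h2 h3
        have h3 : 0 < t := h3
        have h4 := H (fun x => t * h x) (hh.const_mul t)
          (by rw [inner2_const_mul_right, hw, mul_zero])
          (by rw [inner2_const_mul_right, ht', mul_zero]) (by rwa [h1Norm_const_mul])
        rw [h1Norm_const_mul, abs_of_pos h3] at h4
        rw [abs_of_pos h3] at h1
        have h5 := le_of_abs_le h1
        refine le_of_mul_le_mul_right ?_ (pow_pos h3 2)
        linarith
      have hl2 : Tendsto (fun t : ℝ => 4 * γ * schForm (schPot b κ ψ) σ σ + C' * t) (𝓝[>] 0)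
          (𝓝 (4 * γ * schForm (schPot b κ ψ) σ σ)) := by
        have : Continuous (fun t : ℝ => 4 * γ * schForm (schPot b κ ψ) σ σ + C' * t) := by fun_prop
        simpa using (this.tendsto 0).mono_left nhdsWithin_le_nhds
      have hfin := ge_of_tendsto hl2 hle
      have h6 : h1Norm h = 0 := by
        have h7 : C * h1Norm h ^ 2 ≤ 0 := hfin.trans (by nlinarith)
        have h8 : h1Norm h ^ 2 ≤ 0 := by
          by_contra hcon
          nlinarith [mul_pos hC (not_le.1 hcon)]
        nlinarith [h1Norm_nonneg h]
      have h9 := hh.eq_zero_of_h1Norm h6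
      refine ⟨le_antisymm hB ?_, fun x => by rw [← hhσ]; simp [h9 x]⟩
      rw [h6] at hfin
      by_contra hcon
      nlinarith [mul_pos hγ (neg_pos.2 (not_le.1 hcon))]
    by_contra hN
    rcases eq_or_lt_of_le (not_lt.1 hN) with hN | hN
    · obtain ⟨σ, hσ, h0, h1, hB, hne⟩ := S.exists_null hN.symm
      exact hne ((key σ hσ h0 h1 hB.le).2 0)
    · obtain ⟨σ, hσ, h0, h1, hB⟩ := S.exists_neg hN
      exact hB.ne (key σ hσ h0 h1 hB.le).1
  · intro hN
    obtain ⟨C₀, hC₀, H₀⟩ := S.coercive hN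
    obtain ⟨A, hA0, hA⟩ := P.exists_inv_linFactor_bound hk
    obtain ⟨A', -, hA'⟩ := P.exists_linFactor_bound hk
    obtain ⟨C, hC, δ, hδ, E⟩ := P.energy_expansion hk
    set D := C₀ / A ^ 2 with hD
    have hD0 : 0 < D := by positivity
    -- The quadratic part is at least 4D‖h‖². Below the second radius the cubic remainder costs at
    -- most D‖h‖², so the growth constant D, times γ, is safe.
    refine ⟨γ * D, by positivity, min δ (D / (C + 1)), lt_min hδ (by positivity),
      fun h hh hw ht hn => ?_⟩
    have mσ := (hA' h hh).1
    obtain ⟨h1, h2⟩ := E h hh (hn.le.trans (min_le_left _ _))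
    have h3 := H₀ _ mσ ((P.inner2_weight_eq_zero_iff hk h).1 hw)
      ((P.inner2_deriv_density_eq_zero_iff hk h).1 ht)
    have h4 := (hA _ mσ).2
    rw [P.inv_mul_linFactor hk] at h4
    have hN0 := h1Norm_nonneg h
    have h5 : D * h1Norm h ^ 2 ≤ C₀ * h1Norm (fun x => linFactor b k ψ x * h x) ^ 2 := by
      rw [hD, div_mul_eq_mul_div, div_le_iff₀ (by positivity), mul_assoc]
      refine mul_le_mul_of_nonneg_left ?_ hC₀.le
      refine (pow_le_pow_left₀ hN0 h4 2).trans (le_of_eq ?_)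
      ring
    have h6 : C * h1Norm h ^ 3 ≤ D * h1Norm h ^ 2 := by
      have h7 : h1Norm h ≤ D / (C + 1) := hn.le.trans (min_le_right _ _)
      rw [le_div_iff₀ (by linarith)] at h7
      nlinarith [sq_nonneg (h1Norm h)]
    rw [hJ _ h1, hJ _ (P.density_mem_X hk)]
    have h8 := neg_le_of_abs_le h2
    have h9 : D * h1Norm h ^ 2 ≤ energy b κ k (fun x => density b k ψ x + h x)
        - energy b κ k (density b k ψ) := by nlinarith [sq_nonneg (h1Norm h)]
    nlinarith [mul_le_mul_of_nonneg_left h9 hγ.le]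

end

end Profile

/-! ### The Liouville transform and the operator 𝓛 -/

namespace Profile
variable {b κ : ℝ} {ψ : ℝ → ℝ} (P : Profile b κ ψ)
include P

lemma memH1_comp_theta_mul {F F' : ℝ → ℝ} (hF : ∀ t > 0, HasDerivAt F (F' t) t)
    (hF' : ContinuousOn F' (Ioi 0)) {f : ℝ → ℝ} (hf : MemH1 f) :
    MemH1 (fun x => F (theta ψ x) * f x) := by
  obtain ⟨B, hB⟩ := P.bdd_deriv_theta
  obtain ⟨K, hK⟩ := P.bdd_comp_theta (F := F) fun t ht =>
    (hF t ht).continuousAt.continuousWithinAt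
  obtain ⟨K', hK'⟩ := P.bdd_comp_theta hF'
  have hd : ∀ x, HasDerivAt (fun x => F (theta ψ x)) (F' (theta ψ x) * deriv (theta ψ) x) x :=
    fun x => (hF _ (P.theta_pos x)).comp x (P.hasDerivAt_theta x)
  have hd' : deriv (fun x => F (theta ψ x)) = fun x => F' (theta ψ x) * deriv (theta ψ) x :=
    funext fun x => (hd x).deriv
  refine hf.mul_bdd (contDiff_one_iff_deriv.2 ⟨fun x => (hd x).differentiableAt, ?_⟩) hK
    (K' := K' * B) fun x => ?_
  · rw [hd']; exact (P.continuous_comp_theta hF').mul P.continuous_deriv_theta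
  · rw [hd', abs_mul]
    exact mul_le_mul (hK' x) (hB x) (abs_nonneg _) ((abs_nonneg _).trans (hK' x))

lemma memH1_deriv_theta_mul {f : ℝ → ℝ} (hf : MemH1 f) :
    MemH1 (fun x => deriv (theta ψ) x * f x) := by
  obtain ⟨B, hB⟩ := P.bdd_deriv_theta
  obtain ⟨K, hK⟩ := P.bdd_comp_theta (F := fun t => potV1 b κ t / 8) fun t ht =>
    (hasDerivAt_potV1 ht).continuousAt.continuousWithinAt.div_const 8
  refine hf.mul_bdd ((contDiff_infty_iff_deriv.1 P.contDiff_theta).2.of_le (by simp)) hB (K' := K)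
    fun x => ?_
  rw [P.deriv_deriv_theta]; exact hK x

section
variable {k : ℝ} (hk : 0 < k)
include hk

lemma hasDerivAt_linFactor' (x : ℝ) : HasDerivAt (linFactor b k ψ)
    ((2 * b + 1) * (linFactor b k ψ x * deriv (theta ψ) x / theta ψ x)) x := by
  have hb : b ≠ 0 := by linarith [P.hb]
  have hμ := (P.density_pos hk x).ne'
  have ht := (P.theta_pos x).ne'
  rw [show linFactor b k ψ = _ from funext (P.linFactor_eq k hk)]
  refine (((P.hasDerivAt_theta x).div ((P.hasDerivAt_density k x).const_mul (2 * b))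
    (mul_ne_zero (by simpa using hb) hμ)).neg).congr_deriv ?_
  field_simp
  ring

/-- The Liouville transform of a strong solution. -/
noncomputable def liouville (b k : ℝ) (ψ σ : ℝ → ℝ) (x : ℝ) : ℝ := σ x / linFactor b k ψ x

lemma memH2_liouville {σ : ℝ → ℝ} (hσ : Differentiable ℝ σ) (h1 : MemH1 σ) (h2 : MemH1 (deriv σ)) :
    MemH2 (liouville b k ψ σ) := by
  have hG : ∀ t > (0 : ℝ), HasDerivAt (fun t : ℝ => -(2 * b * k) * (t ^ (-(2 * b)) / t))
      (2 * b * k * (2 * b + 1) * (t ^ (-(2 * b)) / t ^ 2)) t := fun t ht => by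
    refine (((hasDerivAt_rpow_two_mul (b := b) ht).div (hasDerivAt_id t) ht.ne').const_mul
      (-(2 * b * k))).congr_deriv ?_
    simp only [id]
    field_simp
    ring
  have hG' : ∀ t > (0 : ℝ), HasDerivAt (fun t : ℝ =>
      2 * b * k * (2 * b + 1) * (t ^ (-(2 * b)) / t ^ 2))
      (-(2 * b * k * (2 * b + 1) * (2 * b + 2) * (t ^ (-(2 * b)) / t ^ 3))) t := fun t ht => by
    refine (((hasDerivAt_rpow_two_mul (b := b) ht).div (hasDerivAt_pow 2 t)
      (pow_ne_zero 2 ht.ne')).const_mul (2 * b * k * (2 * b + 1))).congr_deriv ?_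
    field_simp
    ring
  have hcG' : ContinuousOn (fun t : ℝ =>
      2 * b * k * (2 * b + 1) * (t ^ (-(2 * b)) / t ^ 2)) (Ioi 0) := fun t ht =>
    (hG' t ht).continuousAt.continuousWithinAt
  have hcG'' : ContinuousOn (fun t : ℝ =>
      -(2 * b * k * (2 * b + 1) * (2 * b + 2) * (t ^ (-(2 * b)) / t ^ 3))) (Ioi 0) :=
    (continuousOn_const.mul ((continuousOn_rpow_neg b).div (continuousOn_id.pow 3)
      fun t ht => pow_ne_zero 3 (ne_of_gt ht))).neg
  have e : liouville b k ψ σ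
      = fun x => -(2 * b * k) * (theta ψ x ^ (-(2 * b)) / theta ψ x) * σ x := by
    funext x
    rw [liouville, div_eq_inv_mul, P.inv_linFactor hk]
  have hd : ∀ x, HasDerivAt (liouville b k ψ σ)
      (2 * b * k * (2 * b + 1) * (theta ψ x ^ (-(2 * b)) / theta ψ x ^ 2)
        * (deriv (theta ψ) x * σ x)
        + -(2 * b * k) * (theta ψ x ^ (-(2 * b)) / theta ψ x) * deriv σ x) x := by
    intro x
    rw [e]
    refine (((hG _ (P.theta_pos x)).comp x (P.hasDerivAt_theta x)).mul
      (hσ x).hasDerivAt).congr_deriv ?_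
    simp only [Function.comp]
    ring
  refine ⟨fun x => (hd x).differentiableAt, ?_, ?_⟩
  · rw [e]; exact P.memH1_comp_theta_mul hG hcG' h1
  · rw [show deriv (liouville b k ψ σ) = _ from funext fun x => (hd x).deriv]
    exact (P.memH1_comp_theta_mul hG' hcG'' (P.memH1_deriv_theta_mul h1)).add
      (P.memH1_comp_theta_mul hG hcG' h2)

section
variable {c : ℝ} (hkc : k < c) (hκ : κ * (c - k) = k) {φ : ℝ → ℝ}
  (hφ : ∀ x, c - φ x = (c - k) * theta ψ x ^ 2) (hμ : momentum φ = density b k ψ)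
include hkc hφ hμ

omit hkc in
lemma leading_eq (x : ℝ) : (c - φ x) / momentum φ x ^ 2
    = 4 * b ^ 2 * (c - k) * linFactor b k ψ x ^ 2 := by
  have hb : b ≠ 0 := by linarith [P.hb]
  have h2 := (P.density_pos hk x).ne'
  rw [hφ, hμ, P.linFactor_eq k hk]
  field_simp
  ring

include hκ

/-- The term subtracted from W is Ω''/Ω, because Ω' = (2b+1)Ωθ'/θ. It is what the leading part of 𝓛
produces under the substitution w = σ/Ω. -/
lemma potential_eq (x : ℝ) : potential b c k φ x = 4 * b ^ 2 * (c - k) * linFactor b k ψ x ^ 2 *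
    (schPot b κ ψ x - (2 * b + 1) * (deriv (deriv (theta ψ)) x / theta ψ x
      + 2 * b * deriv (theta ψ) x ^ 2 / theta ψ x ^ 2)) := by
  have hb : b ≠ 0 := by linarith [P.hb]
  have hb1 : b - 1 ≠ 0 := by linarith [P.hb]
  have hck : c - k ≠ 0 := by linarith
  have h1 := (P.density_pos hk x).ne'
  have ht := (P.theta_pos x).ne'
  have d2 : iteratedDeriv 2 (density b k ψ) x = -(2 * b) * density b k ψ x
      * (deriv (deriv (theta ψ)) x / theta ψ x
        - (2 * b + 1) * deriv (theta ψ) x ^ 2 / theta ψ x ^ 2) := by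
    rw [iteratedDeriv_two_eq, show deriv (density b k ψ) = _ from funext (P.deriv_density k)]
    have h := (((P.hasDerivAt_density k x).const_mul (-(2 * b))).div (P.hasDerivAt_theta x) ht).mul
      (P.hasDerivAt_deriv_theta x)
    refine h.deriv.trans ?_
    rw [P.deriv_deriv_theta]
    simp only [Pi.div_apply]
    field_simp
    ring
  rw [potential, hμ, hφ, d2, P.deriv_density, P.linFactor_eq k hk]
  generalize density b k ψ x = m at *
  have e1 : c = k + k / κ := by
    have : κ ≠ 0 := P.κ_pos.ne'
    field_simp
    linarith
  have hW : schPot b κ ψ x = (b + 1) / 2 - (2 * b + 1) * (deriv (deriv (theta ψ)) x / theta ψ x)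
      - ((b - 1) * c + (b + 1) * k) / (2 * (c - k) * theta ψ x ^ 4) := by
    have e2 : ((b - 1) * c + (b + 1) * k) / (2 * (c - k) * theta ψ x ^ 4)
        = ((b - 1) + 2 * b * κ) / (2 * theta ψ x ^ 4) := by
      rw [div_eq_div_iff (by positivity) (by positivity)]
      linear_combination (-4 * b * theta ψ x ^ 4) * hκ
    rw [e2, P.deriv_deriv_theta]
    simp only [schPot, potV1, potV2, potF, potF']
    field_simp
    ring
  rw [hW]
  field_simp
  ring

/-- The leading coefficient is 4b²(c-k)Ω², and (Ω²(σ/Ω)')' = Ωσ'' - Ω''σ. The potential compensates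
Ω''σ, so 𝓛 is the Schrödinger operator conjugated by Ω. -/
lemma opL_liouville {σ τ : ℝ → ℝ} (hσ : Differentiable ℝ σ)
    (hd : ∀ x, HasDerivAt (deriv σ) (schPot b κ ψ x * σ x - τ x) x) (x : ℝ) :
    opL b c k φ (liouville b k ψ σ) x = 4 * b ^ 2 * (c - k) * (linFactor b k ψ x * τ x) := by
  have hΩ := P.linFactor_ne hk
  have hθ := fun x => (P.theta_pos x).ne'
  set Ω := linFactor b k ψ with hΩdef
  have dw : ∀ x, deriv (liouville b k ψ σ) x = (deriv σ x * Ω x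
      - σ x * ((2 * b + 1) * (Ω x * deriv (theta ψ) x / theta ψ x))) / Ω x ^ 2 := fun x =>
    ((hσ x).hasDerivAt.div (P.hasDerivAt_linFactor' hk x) (hΩ x)).deriv
  have e : (fun y => (c - φ y) / momentum φ y ^ 2 * deriv (liouville b k ψ σ) y)
      = fun y => 4 * b ^ 2 * (c - k) * (deriv σ y * Ω y
        - σ y * ((2 * b + 1) * (Ω y * deriv (theta ψ) y / theta ψ y))) := by
    funext y
    rw [P.leading_eq hk hφ hμ, dw y, ← hΩdef]
    have := hΩ y
    field_simp
  have d2 := (((hd x).mul (P.hasDerivAt_linFactor' hk x)).sub ((hσ x).hasDerivAt.mul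
    (((P.hasDerivAt_linFactor' hk x).mul (P.hasDerivAt_deriv_theta x)).div
      (P.hasDerivAt_theta x) (hθ x) |>.const_mul (2 * b + 1)))).const_mul (4 * b ^ 2 * (c - k))
  have d3 : deriv (fun y => 4 * b ^ 2 * (c - k) * (deriv σ y * Ω y
        - σ y * ((2 * b + 1) * (Ω y * deriv (theta ψ) y / theta ψ y)))) x = _ := d2.deriv
  rw [opL, e, d3, P.potential_eq hk hkc hκ hφ hμ, P.deriv_deriv_theta, liouville, ← hΩdef]
  simp only [Pi.mul_apply, Pi.div_apply]
  have h1 := hΩ x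
  have h2 := hθ x
  field_simp
  ring

end

end

end Profile

namespace Profile
variable {b κ : ℝ} {ψ : ℝ → ℝ} (P : Profile b κ ψ)
include P

section
variable {c k : ℝ} (hk : 0 < k) (hkc : k < c) (hκ : κ * (c - k) = k) {φ : ℝ → ℝ}
  (hφ : ∀ x, c - φ x = (c - k) * theta ψ x ^ 2) (hμ : momentum φ = density b k ψ)
include hk hkc hφ

/-- The constant relating `v₀` to the derivative of the profile in the parameter. -/
noncomputable def liouvilleConst (b c k : ℝ) : ℝ :=
  -(k * (b - 1) * ((c - k) ^ (b - 1) / (c - k)) / b ^ 2)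

/-- v₀ is a constant multiple of Ωf, which makes the same multiple of ζ, divided by Ω and rescaled,
the solution of 𝓛w = v₀. -/
lemma v0_eq (x : ℝ) : v0 b c k φ x
    = 4 * b ^ 2 * (c - k) * (linFactor b k ψ x * (liouvilleConst b c k * schRhs b ψ x)) := by
  have hb := P.hb
  have hb0 : b ≠ 0 := by linarith
  have hb1 : b - 1 ≠ 0 := by linarith
  have hck : 0 < c - k := by linarith
  have ht := P.theta_pos x
  have e : (theta ψ x ^ 2) ^ (b - 1) = (theta ψ x ^ (-(2 * b)))⁻¹ / theta ψ x ^ 2 := by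
    rw [← Real.rpow_natCast, ← Real.rpow_mul ht.le, ← Real.rpow_neg ht.le, ← Real.rpow_sub ht]
    congr 1; push_cast; ring
  rw [v0, hφ, Real.mul_rpow hck.le (by positivity), e, P.linFactor_eq k hk, density, schRhs, potF,
    liouvilleConst]
  have hR := (Real.rpow_pos_of_pos ht (-(2 * b))).ne'
  have hck0 := hck.ne'
  have ht0 := ht.ne'
  field_simp
  ring

include hμ hκ

lemma opL_liouville_thetaParam (x : ℝ) :
    opL b c k φ (liouville b k ψ fun x => liouvilleConst b c k * thetaParam b κ ψ x) x
      = v0 b c k φ x := by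
  have hζ : Differentiable ℝ (thetaParam b κ ψ) := P.contDiff_thetaParam.differentiable (by simp)
  rw [P.v0_eq hk hkc hφ]
  refine P.opL_liouville (τ := fun x => liouvilleConst b c k * schRhs b ψ x) hk hkc hκ hφ hμ
    (hζ.const_mul _) (fun x => ?_) x
  rw [deriv_const_mul_fun]
  exact ((P.hasDerivAt_deriv_thetaParam x).const_mul _).congr_deriv (by ring)

omit hkc hκ hφ hμ in
lemma memH2_liouville_thetaParam (r : ℝ) :
    MemH2 (liouville b k ψ fun x => r * thetaParam b κ ψ x) := by
  have hζ : Differentiable ℝ (thetaParam b κ ψ) := P.contDiff_thetaParam.differentiable (by simp)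
  refine P.memH2_liouville hk (hζ.const_mul _) ((P.expDecay_thetaParam.memH1
    P.expDecay_deriv_thetaParam P.contDiff_thetaParam).const_mul r) ?_
  rw [deriv_const_mul_fun]
  exact (P.expDecay_deriv_thetaParam.memH1 P.expDecay_deriv2_thetaParam
    P.contDiff_deriv_thetaParam).const_mul r

omit hkc hκ in
lemma memH1_leading_mul {f : ℝ → ℝ} (hf : MemH1 f) :
    MemH1 (fun x => (c - φ x) / momentum φ x ^ 2 * f x) := by
  obtain ⟨A, -, hA⟩ := P.exists_linFactor_bound hk
  have h := (hA _ (hA f hf).1).1.const_mul (4 * b ^ 2 * (c - k))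
  refine cast (congrArg MemH1 ?_) h
  funext x
  rw [P.leading_eq hk hφ hμ]; ring

omit hμ hκ in
lemma memLp_v0 : MemLp (v0 b c k φ) 2 volume := by
  have hmem : MemLp (schRhs b ψ) 2 volume := P.expDecay_schRhs.memLp P.continuous_schRhs
  obtain ⟨K, hK⟩ := P.bdd_comp_theta (F := fun t => scaleDeriv b k 1 (k * t ^ (-(2 * b))))
    ((continuousOn_scaleDeriv hk 1).comp (continuousOn_const.mul (continuousOn_rpow_neg b))
      fun t ht => mul_pos hk (Real.rpow_pos_of_pos ht _))
  have h := (memLp_mul_bdd hmem (P.contDiff_linFactor hk).continuous.aestronglyMeasurable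
    hK).const_mul (4 * b ^ 2 * (c - k) * liouvilleConst b c k)
  refine h.ae_eq (Eventually.of_forall fun x => ?_)
  rw [P.v0_eq hk hkc hφ]
  ring

omit hκ in
/-- The operator is symmetric on `H²`. -/
lemma inner2_eq_of_opL_eq {w w₁ : ℝ → ℝ} (hw : MemH2 w) (hw₁ : MemH2 w₁)
    (h : opL b c k φ w =ᵐ[volume] v0 b c k φ) (h₁ : opL b c k φ w₁ =ᵐ[volume] v0 b c k φ) :
    inner2 w (v0 b c k φ) = inner2 w₁ (v0 b c k φ) := by
  have hv := P.memLp_v0 hk hkc hφ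
  have m := P.memH1_leading_mul hk hφ hμ hw.2.2
  have m₁ := P.memH1_leading_mul hk hφ hμ hw₁.2.2
  have e1 := hw.2.1.integral_by_parts m₁
  have e2 := hw₁.2.1.integral_by_parts m
  have e3 : ∫ x, deriv w x * ((c - φ x) / momentum φ x ^ 2 * deriv w₁ x)
      = ∫ x, deriv w₁ x * ((c - φ x) / momentum φ x ^ 2 * deriv w x) := by
    congr 1; funext x; ring
  rw [← sub_eq_zero, inner2, inner2, ← integral_sub (integrable_mul_of_memLp hw.2.1.2.1 hv)
    (integrable_mul_of_memLp hw₁.2.1.2.1 hv)]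
  -- Each v₀ is replaced by 𝓛 of the other solution; the potential terms cancel and the leading
  -- parts are symmetric after integration by parts.
  have e4 : (fun x => w x * v0 b c k φ x - w₁ x * v0 b c k φ x) =ᵐ[volume] fun x =>
      w₁ x * deriv (fun y => (c - φ y) / momentum φ y ^ 2 * deriv w y) x
      - w x * deriv (fun y => (c - φ y) / momentum φ y ^ 2 * deriv w₁ y) x := by
    filter_upwards [h, h₁] with x hx hx₁
    nth_rw 1 [← hx₁]
    rw [← hx, opL, opL]
    ring
  rw [integral_congr_ae e4, integral_sub (integrable_mul_of_memLp hw₁.2.1.2.1 m.2.2)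
    (integrable_mul_of_memLp hw.2.1.2.1 m₁.2.2), e1, e2, e3, sub_self]

omit hκ hμ in
lemma inner2_liouville_thetaParam :
    inner2 (liouville b k ψ fun x => liouvilleConst b c k * thetaParam b κ ψ x) (v0 b c k φ)
      = 4 * b ^ 2 * (c - k) * liouvilleConst b c k ^ 2
        * inner2 (schRhs b ψ) (thetaParam b κ ψ) := by
  rw [inner2, inner2, ← integral_const_mul]
  congr 1; funext x
  have := P.linFactor_ne hk x
  rw [P.v0_eq hk hkc hφ, liouville]
  field_simp

omit hk hμ hκ in
lemma QDensity_eq (x : ℝ) : QDensity b c k φ x = (b - 1) / 2 * potY b (theta ψ x) := by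
  have hb1 : b - 1 ≠ 0 := by linarith [P.hb]
  have hck : c - k ≠ 0 := by linarith
  have ht := P.theta_pos x
  have e : (c - k) / (c - φ x) = (theta ψ x ^ 2)⁻¹ := by
    rw [hφ]; field_simp
  have e2 : ((theta ψ x ^ 2)⁻¹) ^ b = theta ψ x ^ (-(2 * b)) := by
    rw [← Real.rpow_natCast, ← Real.rpow_neg ht.le, ← Real.rpow_mul ht.le]
    congr 1; push_cast; ring
  rw [QDensity, e, e2, potY]
  field_simp
  ring

omit hk hμ hκ in
lemma integrable_QDensity : Integrable (QDensity b c k φ) := by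
  have hcY : Continuous (fun x => potY b (theta ψ x)) :=
    P.continuous_comp_theta fun t ht => (hasDerivAt_potY P.hb ht).continuousAt.continuousWithinAt
  rw [show QDensity b c k φ = _ from funext (P.QDensity_eq hkc hφ)]
  exact (P.expDecay_potY.integrable hcY).const_mul _

end

end Profile

/-! ### Return to the parameter k and conclusion -/

lemma lt_of_mem_parameters {b c k : ℝ} (hb : 1 < b) (hk : k ∈ Ioo 0 (c / (b + 1))) : k < c := by
  have h := hk.2
  rw [lt_div_iff₀ (by linarith)] at h
  nlinarith [hk.1]

namespace IsSolitaryWave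
variable {b c k : ℝ} {φ : ℝ → ℝ} (h : IsSolitaryWave b c k φ)
include h

/-- The profile normalized to the background `0` and the speed `1`. -/
noncomputable def normalized (c k : ℝ) (φ : ℝ → ℝ) (x : ℝ) : ℝ := (φ x - k) / (c - k)

lemma theta_normalized (hb : 1 < b) (hk : k ∈ Ioo 0 (c / (b + 1))) (x : ℝ) :
    c - φ x = (c - k) * theta (normalized c k φ) x ^ 2 := by
  have hkc := lt_of_mem_parameters hb hk
  have hck : c - k ≠ 0 := by linarith
  have P : Profile b (k / (c - k)) (normalized c k φ) := h.profile hb hk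
  rw [P.theta_sq, normalized]
  field_simp
  ring

lemma momentum_normalized (hb : 1 < b) (hk : k ∈ Ioo 0 (c / (b + 1))) :
    momentum φ = density b k (normalized c k φ) := by
  have hkc := lt_of_mem_parameters hb hk
  have P : Profile b (k / (c - k)) (normalized c k φ) := h.profile hb hk
  funext x
  rw [h.momentum_eq hb hk.1 hkc, density, ← P.rpow_neg_eq, normalized]

end IsSolitaryWave

open IsSolitaryWave

lemma hasDerivAt_Q {b c : ℝ} (hb : 1 < b) (hc : 0 < c) {φ : ℝ → ℝ → ℝ}
    (hφ : ∀ k ∈ Ioo 0 (c / (b + 1)), IsSolitaryWave b c k (φ k)) {k : ℝ}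
    (hk : k ∈ Ioo 0 (c / (b + 1))) : HasDerivAt (Q b c φ) (-(4 * (b - 1) * (c / (c - k) ^ 2)) *
      inner2 (schRhs b (normalized c k (φ k)))
        (thetaParam b (k / (c - k)) (normalized c k (φ k)))) k := by
  -- The family is indexed anew by κ: k = cκ/(1+κ) inverts κ = k/(c-k) and carries 0 < κ < 1/b onto
  -- the range of k. The chain rule then contributes dκ/dk = c/(c-k)².
  have hmem : ∀ κ', 0 < κ' → κ' * b < 1 → c * κ' / (1 + κ') ∈ Ioo 0 (c / (b + 1)) := by
    intro κ' h1 h2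
    refine ⟨by positivity, ?_⟩
    rw [div_lt_div_iff₀ (by linarith) (by linarith)]
    nlinarith
  have hquot : ∀ κ', 0 < κ' → c * κ' / (1 + κ') / (c - c * κ' / (1 + κ')) = κ' := by
    intro κ' h1
    have : 1 + κ' ≠ 0 := by linarith
    have e : c - c * κ' / (1 + κ') = c / (1 + κ') := by field_simp; ring
    rw [e]; field_simp
  have hinv : ∀ k ∈ Ioo 0 (c / (b + 1)), c * (k / (c - k)) / (1 + k / (c - k)) = k := by
    intro k hk
    have hkc := lt_of_mem_parameters hb hk
    have h1 : c - k ≠ 0 := by linarith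
    have e : 1 + k / (c - k) = c / (c - k) := by field_simp; ring
    rw [e]; field_simp
  set Ψ : ℝ → ℝ → ℝ := fun κ' =>
    normalized c (c * κ' / (1 + κ')) (φ (c * κ' / (1 + κ'))) with hΨ
  have hΨP : ∀ κ', 0 < κ' → κ' * b < 1 → Profile b κ' (Ψ κ') := by
    intro κ' h1 h2
    have h3 := (hφ _ (hmem κ' h1 h2)).profile hb (hmem κ' h1 h2)
    rwa [hquot κ' h1] at h3
  have P : Profile b (k / (c - k)) (normalized c k (φ k)) := (hφ k hk).profile hb hk
  have hkc := lt_of_mem_parameters hb hk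
  have hck : c - k ≠ 0 := by linarith
  have hd : HasDerivAt (fun k => k / (c - k)) (c / (c - k) ^ 2) k := by
    refine ((hasDerivAt_id k).div ((hasDerivAt_id k).const_sub c) hck).congr_deriv ?_
    simp only [id]
    ring
  have h1 := ((P.hasDerivAt_integral_potY hΨP).comp k hd).const_mul ((b - 1) / 2)
  refine (h1.congr_of_eventuallyEq ?_).congr_deriv (by ring)
  filter_upwards [isOpen_Ioo.mem_nhds hk] with z hz
  have Pz : Profile b (z / (c - z)) (normalized c z (φ z)) := (hφ z hz).profile hb hz
  have hzc := lt_of_mem_parameters hb hz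
  rw [Q, show QDensity b c z (φ z) = _ from
    funext (Pz.QDensity_eq hzc ((hφ z hz).theta_normalized hb hz)), integral_const_mul]
  simp only [Function.comp, hΨ]
  rw [hinv z hz]

end BCH

theorem lemma4 (b c : ℝ) (hb : 1 < b) (hc : 0 < c) (φ : ℝ → ℝ → ℝ)
    (hφ : ∀ k ∈ Ioo 0 (c / (b + 1)), BCH.IsSolitaryWave b c k (φ k)) :
    (∀ k ∈ Ioo 0 (c / (b + 1)),
      -- the action is well defined on `X_k`, which contains `μ`
      BCH.momentum (φ k) ∈ BCH.X k ∧
      (∀ m ∈ BCH.X k, Integrable (BCH.actionDensity b c k m)) ∧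
      -- `Q` is well defined and differentiable
      Integrable (BCH.QDensity b c k (φ k)) ∧
      DifferentiableAt ℝ (BCH.Q b c φ) k ∧
      -- constrained minimizer iff `Q` is increasing
      (BCH.IsConstrainedMinimizer (fun m => -BCH.action b c k m) (BCH.momentum (φ k))
          (BCH.weight b k (BCH.momentum (φ k))) ↔
        0 ≤ deriv (BCH.Q b c φ) k) ∧
      -- degenerate only by translation iff `Q` is strictly increasing
      (BCH.IsConstrainedMinimizer (fun m => -BCH.action b c k m) (BCH.momentum (φ k))
          (BCH.weight b k (BCH.momentum (φ k))) ∧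
        BCH.DegenerateOnlyByTranslation (fun m => -BCH.action b c k m) (BCH.momentum (φ k))
          (BCH.weight b k (BCH.momentum (φ k))) ↔
        0 < deriv (BCH.Q b c φ) k) ∧
      (BCH.IsMinimizerTransverseToTranslation (fun m => -BCH.action b c k m) (BCH.momentum (φ k))
          (BCH.weight b k (BCH.momentum (φ k))) ↔
        0 < deriv (BCH.Q b c φ) k) ∧
      -- `⟨𝓛⁻¹ v₀, v₀⟩` is a negative multiple of `dQ/dk`
      (∃ w, BCH.MemH2 w ∧ BCH.opL b c k (φ k) w =ᵐ[volume] BCH.v0 b c k (φ k)) ∧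
      (∀ w, BCH.MemH2 w → BCH.opL b c k (φ k) w =ᵐ[volume] BCH.v0 b c k (φ k) →
        BCH.inner2 w (BCH.v0 b c k (φ k)) =
          -((k * (c - k) ^ b) * k * (b - 1) / (c * b ^ 2) * (c - k) ^ (b - 1))
            * deriv (BCH.Q b c φ) k)) ∧
    -- the same criterion on intervals of parameters
    (∀ α β : ℝ, Ioo α β ⊆ Ioo 0 (c / (b + 1)) →
      ((∀ k ∈ Ioo α β,
          BCH.IsConstrainedMinimizer (fun m => -BCH.action b c k m) (BCH.momentum (φ k))
            (BCH.weight b k (BCH.momentum (φ k)))) ↔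
        MonotoneOn (BCH.Q b c φ) (Ioo α β))) := by
  have hQ := fun k (hk : k ∈ Ioo 0 (c / (b + 1))) => BCH.hasDerivAt_Q hb hc hφ hk
  have hb1 : 0 < b - 1 := by linarith
  have hP : ∀ k ∈ Ioo 0 (c / (b + 1)),
      BCH.Profile b (k / (c - k)) (BCH.IsSolitaryWave.normalized c k (φ k)) := fun k hk =>
    (hφ k hk).profile hb hk
  have hcoef : ∀ k ∈ Ioo 0 (c / (b + 1)), 0 < 4 * (b - 1) * (c / (c - k) ^ 2) := by
    intro k hk
    have : 0 < c - k := by linarith [BCH.lt_of_mem_parameters hb hk]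
    positivity
  have hJ : ∀ k ∈ Ioo 0 (c / (b + 1)), 0 < (b - 1) * (c - k) / 2 ∧ ∀ m ∈ BCH.X k,
      -BCH.action b c k m = (b - 1) * (c - k) / 2 * BCH.energy b (k / (c - k)) k m := by
    intro k hk
    have hkc := BCH.lt_of_mem_parameters hb hk
    have : 0 < c - k := by linarith
    exact ⟨by positivity, fun m hm => BCH.neg_action_eq hb hk.1 hkc hm⟩
  have hmin : ∀ k ∈ Ioo 0 (c / (b + 1)),
      (BCH.IsConstrainedMinimizer (fun m => -BCH.action b c k m) (BCH.momentum (φ k))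
          (BCH.weight b k (BCH.momentum (φ k))) ↔ 0 ≤ deriv (BCH.Q b c φ) k) := by
    intro k hk
    rw [(hφ k hk).momentum_normalized hb hk, (hP k hk).isConstrainedMinimizer_iff hk.1
      (hJ k hk).1 (hJ k hk).2, (hQ k hk).deriv, neg_mul_comm,
      mul_nonneg_iff_of_pos_left (hcoef k hk), neg_nonneg]
  refine ⟨fun k hk => ?_, fun α β hαβ => ?_⟩
  · have hkc := BCH.lt_of_mem_parameters hb hk
    have hck : 0 < c - k := by linarith
    have P := hP k hk
    have hμ := (hφ k hk).momentum_normalized hb hk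
    have hθ := (hφ k hk).theta_normalized hb hk
    have hκ : k / (c - k) * (c - k) = k := div_mul_cancel₀ _ hck.ne'
    have hsol := P.opL_liouville_thetaParam hk.1 hkc hκ hθ hμ
    have hsol2 := P.memH2_liouville_thetaParam hk.1 (BCH.Profile.liouvilleConst b c k)
    have hpos : 0 < deriv (BCH.Q b c φ) k ↔ BCH.inner2
        (BCH.schRhs b (BCH.IsSolitaryWave.normalized c k (φ k)))
        (BCH.thetaParam b (k / (c - k)) (BCH.IsSolitaryWave.normalized c k (φ k))) < 0 := by
      rw [(hQ k hk).deriv, neg_mul_comm, mul_pos_iff_of_pos_left (hcoef k hk), neg_pos]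
    refine ⟨?_, fun m hm => BCH.integrable_actionDensity hb hk.1 hkc hm,
      P.integrable_QDensity hkc hθ, (hQ k hk).differentiableAt, hmin k hk, ?_, ?_,
      ⟨_, hsol2, Eventually.of_forall hsol⟩, fun w hw hwv => ?_⟩
    · rw [hμ]; exact P.density_mem_X hk.1
    · rw [hpos, hμ]
      exact P.degenerateOnlyByTranslation_iff hk.1 (hJ k hk).1 (hJ k hk).2
    · rw [hpos, hμ]
      exact P.isMinimizerTransverseToTranslation_iff hk.1 (hJ k hk).1 (hJ k hk).2
    · rw [P.inner2_eq_of_opL_eq hk.1 hkc hθ hμ hw hsol2 hwv (Eventually.of_forall hsol),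
        P.inner2_liouville_thetaParam hk.1 hkc hθ, (hQ k hk).deriv, BCH.Profile.liouvilleConst]
      have e : (c - k) ^ b = (c - k) ^ (b - 1) * (c - k) := by
        rw [Real.rpow_sub_one hck.ne']; field_simp
      have hb0 : b ≠ 0 := by linarith
      have hc0 := hc.ne'
      have hck0 := hck.ne'
      rw [e]
      field_simp
  · constructor
    · intro H
      refine monotoneOn_of_deriv_nonneg (convex_Ioo α β)
        (fun k hk => (hQ k (hαβ hk)).continuousAt.continuousWithinAt) ?_ ?_
      · rw [interior_Ioo]
        exact fun k hk => (hQ k (hαβ hk)).differentiableAt.differentiableWithinAt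
      · rw [interior_Ioo]
        exact fun k hk => (hmin k (hαβ hk)).1 (H k hk)
    · intro H k hk
      rw [hmin k (hαβ hk), ← derivWithin_of_isOpen isOpen_Ioo hk]
      exact H.derivWithin_nonneg
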